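/- Let $n\ge 1$ and $\mathfrak g=\mathfrak{gl}_n(\mathbb C)$, with Cartan subalgebra $\mathfrak h$ the diagonal matrices, weights $\lambda=\lambda_1\varepsilon_1+\dots+\lambda_n\varepsilon_n\in\mathfrak h^*$, roots $\varepsilon_i-\varepsilon_j$ ($i\ne j$) with root vectors the matrix units $e_{\varepsilon_i-\varepsilon_j}=E_{ij}$, positive roots those with $i<j$, and simple roots $\alpha_i=\varepsilon_i-\varepsilon_{i+1}$ ($1\le i\le n-1$). Write $\mu\le\nu$ if $\nu-\mu\in\sum_i\mathbb Z_{\ge0}\alpha_i$, and $\mu<\nu$ if moreover $\mu\neq\nu$. Let $\rho$ be the half sum of the positive roots, $W=S_n$ the Weyl group, $s_\alpha\in W$ the reflection in a root $\alpha$, $s_i=s_{\alpha_i}$, $w\cdot\lambda=w(\lambda+\rho)-\rho$, and let $\operatorname{Stab}\lambda=\{w\in W: w\cdot\lambda=\lambda\}$. Put $$\prod_{j=i}^k s_j=\begin{cases}s_is_{i+1}\cdots s_k,& k\ge i,\\ s_is_{i-1}\cdots s_k,& k<i.\end{cases}$$ A weight $\lambda$ is integral if $s_i\cdot\lambda$ and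 $\lambda$ are comparable for every $i$, regular if $\operatorname{Stab}\lambda=\{1\}$, and $W$-maximal if $s_\alpha\cdot\lambda>\lambda$ holds for no root $\alpha$. Let $\dot L(\lambda)$ be the simple quotient of the Verma module of highest weight $\lambda$. The weight $\lambda$ is called bounded if $\dot L(\lambda)$ is the direct sum of its $\mathfrak h$-weight spaces and these are finite-dimensional, of uniformly bounded dimension. For $1\le k\le n-1$, an integral bounded weight $\lambda$ is said to be of type $k$ if the set of roots whose root vectors act injectively on $\dot L(\lambda)$ is $\{\varepsilon_j-\varepsilon_i: i\le k<j\}$, and the set of roots whose root vectors act locally nilpotently on $\dot L(\lambda)$ (each vector is killed by some power of the root vector) consists of all other roots. A weight $\lambda$ is regular, $W$-maximal and integral if and only if $\dim\dot L(\lambda)<\infty$. Moreover: (i) Let $\lambda$ be a regular $W$-maximal integral weight. Then $\lambda$ is bounded, and the bounded weights in the orbit $W\cdot\lambda$ other than $\lambda$ are exactly the weights $\prod_{j=i}^k s_j\cdot\lambda$ with $1\le i,k\le n-1$; there are exactly $(n-1)^2$ of them. For each $1\le i\le n-1$, the bounded weights of type $i$ in the orbit are exactly the weights $\prod_{j=i}^k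 s_j\cdot\lambda$ with $1\le k\le n-1$. (ii) Let $\lambda$ be a $W$-maximal integral weight with $\operatorname{Stab}\lambda=\{1,s_m\}$ for some $1\le m\le n-1$. Then the bounded weights in $W\cdot\lambda$ are exactly the weights $\prod_{j=k}^m s_j\cdot\lambda$ with $1\le k\le n-1$; there are exactly $n-1$ of them. For each $1\le k\le n-1$, there is exactly one bounded weight of type $k$ in the orbit, namely $\prod_{j=k}^m s_j\cdot\lambda$. (iii) If $\lambda$ is an integral weight with $s_i\cdot\lambda=s_j\cdot\lambda=\lambda$ for some $i\ne j$, then the orbit $W\cdot\lambda$ contains no bounded weights. -/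

import Mathlib

namespace GlBounded

/-! ### Weights of `gl_n`, the Weyl group and its dot action -/

/-- A weight `lam` of `gl_n`, i.e. a linear form on the diagonal matrices, written in the basis
`ε_1, …, ε_n` as `(lam_1, …, lam_n)`; its value on `diag(d_1, …, d_n)` is `∑ lam_i d_i`.
Indices are 0-based in the code. -/
abbrev Weight (n : ℕ) : Type := Fin n → ℂ

/-- The root `ε_i - ε_j` (for `i ≠ j`). -/
def root {n : ℕ} (i j : Fin n) : Weight n := Pi.single i 1 - Pi.single j 1

/-- The left end of the `i`-th simple root `ε_i - ε_{i+1}`. -/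
def lo {n : ℕ} (i : Fin (n - 1)) : Fin n := ⟨i.val, by omega⟩

/-- The right end of the `i`-th simple root `ε_i - ε_{i+1}`. -/
def hi {n : ℕ} (i : Fin (n - 1)) : Fin n := ⟨i.val + 1, by omega⟩

/-- The simple root `α_i = ε_i - ε_{i+1}`. -/
def simpleRoot {n : ℕ} (i : Fin (n - 1)) : Weight n := root (lo i) (hi i)

/-- The monoid `Q⁺` of sums of simple roots. -/
def posCone (n : ℕ) : AddSubmonoid (Weight n) :=
  AddSubmonoid.closure (Set.range (simpleRoot (n := n)))

/-- The standard partial order on weights: `μ ≤ ν` if `ν - μ ∈ Q⁺`. -/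
def WLe {n : ℕ} (μ ν : Weight n) : Prop := ν - μ ∈ posCone n

/-- The strict version of the standard partial order on weights. -/
def WLt {n : ℕ} (μ ν : Weight n) : Prop := WLe μ ν ∧ μ ≠ ν

/-- Half the sum of the positive roots. -/
noncomputable def rho (n : ℕ) : Weight n :=
  (1 / 2 : ℂ) • ∑ p ∈ Finset.univ.filter (fun p : Fin n × Fin n => p.1 < p.2), root p.1 p.2

/-- The Weyl group `W` of `gl_n` is the symmetric group; it acts on weights by `w ε_i = ε_{w i}`. -/
def weylAct {n : ℕ} (w : Equiv.Perm (Fin n)) (lam : Weight n) : Weight n := fun i => lam (w⁻¹ i)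

/-- The dot action `w · lam = w (lam + ρ) - ρ`. -/
noncomputable def dot {n : ℕ} (w : Equiv.Perm (Fin n)) (lam : Weight n) : Weight n :=
  weylAct w (lam + rho n) - rho n

/-- The simple reflection `s_i`. -/
def s {n : ℕ} (i : Fin (n - 1)) : Equiv.Perm (Fin n) := Equiv.swap (lo i) (hi i)

/-- The product `∏_{j=i}^k s_j`, which is `s_i s_{i+1} ⋯ s_k` if `i ≤ k`
and `s_i s_{i-1} ⋯ s_k` if `k < i`. -/
def prodS {n : ℕ} (i k : Fin (n - 1)) : Equiv.Perm (Fin n) :=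
  if i ≤ k then
    (((List.finRange (n - 1)).filter (fun j => i ≤ j ∧ j ≤ k)).map s).prod
  else
    (((List.finRange (n - 1)).filter (fun j => k ≤ j ∧ j ≤ i)).reverse.map s).prod

/-- The orbit `W · lam`. -/
def orbit {n : ℕ} (lam : Weight n) : Set (Weight n) :=
  Set.range (fun w : Equiv.Perm (Fin n) => dot w lam)

/-- The stabilizer of `lam` for the dot action. -/
def stab {n : ℕ} (lam : Weight n) : Set (Equiv.Perm (Fin n)) := {w | dot w lam = lam}

/-- `lam` is integral if `s_i · lam` and `lam` are comparable for each `i`. -/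
def IsIntegralWeight {n : ℕ} (lam : Weight n) : Prop :=
  ∀ i : Fin (n - 1), WLe (dot (s i) lam) lam ∨ WLe lam (dot (s i) lam)

/-- `lam` is regular if its stabilizer for the dot action is trivial. -/
def IsRegularWeight {n : ℕ} (lam : Weight n) : Prop := stab lam = {1}

/-- `lam` is `W`-maximal if `s_α · lam > lam` for no root `α`. -/
def IsWMaximal {n : ℕ} (lam : Weight n) : Prop :=
  ∀ i j : Fin n, i ≠ j → ¬ WLt lam (dot (Equiv.swap i j) lam)

/-! ### The Lie algebra `gl_n` and its weight modules -/

attribute [local instance] LieRing.ofAssociativeRing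

/-- The Lie algebra `gl_n` of complex matrices, with the commutator bracket. -/
abbrev gl (n : ℕ) : Type := Matrix (Fin n) (Fin n) ℂ

/-- The matrix unit `E_{ij}`; for `i ≠ j` it spans the root space of `ε_i - ε_j`. -/
def E {n : ℕ} (i j : Fin n) : gl n := Matrix.single i j 1

section Modules

variable {n : ℕ} (M : Type*) [AddCommGroup M] [Module ℂ M] [LieRingModule (gl n) M]
  [LieModule ℂ (gl n) M]

/-- The weight space `M^μ`: the vectors `m` with `h m = μ(h) m` for each diagonal matrix `h`. -/
def wtSpace (μ : Weight n) : Submodule ℂ M where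
  carrier := {m | ∀ d : Fin n → ℂ, ⁅(Matrix.diagonal d : gl n), m⁆ = (∑ i, μ i * d i) • m}
  add_mem' := by
    intro a b ha hb d
    rw [lie_add, ha d, hb d, smul_add]
  zero_mem' := by
    intro d
    rw [lie_zero, smul_zero]
  smul_mem' := by
    intro c a ha d
    rw [lie_smul, ha d, smul_comm]

/-- `M` is a weight module: the direct sum of its weight spaces, all of finite dimension. -/
def IsWeightModule : Prop :=
  DirectSum.IsInternal (fun μ : Weight n => wtSpace M μ) ∧
    ∀ μ : Weight n, FiniteDimensional ℂ (wtSpace M μ)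

/-- `M` is bounded: a weight module whose weight multiplicities are uniformly bounded. -/
def IsBoundedModule : Prop :=
  IsWeightModule (n := n) M ∧ ∃ C : ℕ, ∀ μ : Weight n, Module.finrank ℂ (wtSpace M μ) < C

/-- `Δ^inj M`: the roots `ε_i - ε_j`, recorded as pairs `(i, j)` with `i ≠ j`, whose root vector
acts injectively on `M`. -/
def injRoots : Set (Fin n × Fin n) :=
  {p | p.1 ≠ p.2 ∧ ∀ m : M, m ≠ 0 → ⁅E p.1 p.2, m⁆ ≠ 0}

/-- `Δ^fin M`: the roots `ε_i - ε_j`, recorded as pairs `(i, j)` with `i ≠ j`, whose root vector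
acts locally finitely on `M`, i.e. each vector is killed by a power of it. -/
def finRoots : Set (Fin n × Fin n) :=
  {p | p.1 ≠ p.2 ∧ ∀ m : M, ∃ N : ℕ, 0 < N ∧ (fun x : M => ⁅E p.1 p.2, x⁆)^[N] m = 0}

end Modules

/-- The roots `ε_i - ε_j` with `i ≤ k < j` of the nilradical `n_k`. -/
def nilRoots {n : ℕ} (k : Fin (n - 1)) : Set (Fin n × Fin n) :=
  {p | p.1.val ≤ k.val ∧ k.val < p.2.val}

/-- The roots of the opposite nilradical. -/
def negNilRoots {n : ℕ} (k : Fin (n - 1)) : Set (Fin n × Fin n) :=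
  {p | (p.2, p.1) ∈ nilRoots k}

/-- The roots `ε_i - ε_j` with `i, j ≤ k` or `i, j > k` of the Levi part `s_k`. -/
def leviRoots {n : ℕ} (k : Fin (n - 1)) : Set (Fin n × Fin n) :=
  {p | p.1 ≠ p.2 ∧
    ((p.1.val ≤ k.val ∧ p.2.val ≤ k.val) ∨ (k.val < p.1.val ∧ k.val < p.2.val))}

/-! ### Verma modules and their simple quotients -/

/-- The universal enveloping algebra of `gl_n`. -/
abbrev U (n : ℕ) : Type := UniversalEnvelopingAlgebra ℂ (gl n)

/-- The canonical map `gl_n → U(gl_n)`. -/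
noncomputable abbrev iota (n : ℕ) : gl n →ₗ⁅ℂ⁆ U n := UniversalEnvelopingAlgebra.ι ℂ

/-- The left ideal of `U(gl_n)` generated by the `E_{ij}` with `i < j` and by the `h - lam(h)`
with `h` diagonal. -/
noncomputable def vermaIdeal {n : ℕ} (lam : Weight n) : Submodule (U n) (U n) :=
  Submodule.span (U n)
    ({u | ∃ i j : Fin n, i < j ∧ u = iota n (E i j)} ∪
      {u | ∃ d : Fin n → ℂ, u = iota n (Matrix.diagonal d) -
        algebraMap ℂ (U n) (∑ i, lam i * d i)})

/-- The Verma module of highest weight `lam`. -/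
abbrev Verma {n : ℕ} (lam : Weight n) : Type := U n ⧸ vermaIdeal lam

/-- The largest proper submodule of the Verma module: the sum of all its proper submodules. -/
noncomputable def maxSubmodule {n : ℕ} (lam : Weight n) : Submodule (U n) (Verma lam) :=
  sSup {N | N ≠ ⊤}

/-- The simple quotient of the Verma module of highest weight `lam`. -/
def L {n : ℕ} (lam : Weight n) : Type := Verma lam ⧸ maxSubmodule lam

noncomputable instance {n : ℕ} (lam : Weight n) : AddCommGroup (L lam) :=
  inferInstanceAs (AddCommGroup (Verma lam ⧸ maxSubmodule lam))

noncomputable instance {n : ℕ} (lam : Weight n) : Module (U n) (L lam) :=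
  inferInstanceAs (Module (U n) (Verma lam ⧸ maxSubmodule lam))

noncomputable instance {n : ℕ} (lam : Weight n) : Module ℂ (L lam) :=
  inferInstanceAs (Module ℂ (Verma lam ⧸ maxSubmodule lam))

instance {n : ℕ} (lam : Weight n) : IsScalarTower ℂ (U n) (L lam) :=
  inferInstanceAs (IsScalarTower ℂ (U n) (Verma lam ⧸ maxSubmodule lam))

noncomputable instance {n : ℕ} (lam : Weight n) : LieRingModule (gl n) (L lam) where
  bracket x m := iota n x • m
  add_lie x y m := by
    change iota n (x + y) • m = iota n x • m + iota n y • m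
    rw [map_add, add_smul]
  lie_add x m m' := smul_add _ _ _
  leibniz_lie x y m := by
    change iota n x • iota n y • m = iota n ⁅x, y⁆ • m + iota n y • iota n x • m
    rw [LieHom.map_lie, LieRing.of_associative_ring_bracket, sub_smul, mul_smul, mul_smul,
      sub_add_cancel]

instance {n : ℕ} (lam : Weight n) : LieModule ℂ (gl n) (L lam) where
  smul_lie t x m := by
    change iota n (t • x) • m = t • iota n x • m
    rw [map_smul, smul_assoc]
  lie_smul t x m := by
    change iota n x • t • m = t • iota n x • m
    rw [← algebraMap_smul (U n) t m, ← algebraMap_smul (U n) t (iota n x • m), ← mul_smul,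
      ← mul_smul, Algebra.commutes]

/-! ### Bounded weights and their types -/

/-- `lam` is a `gl_n`-bounded weight if the simple module of highest weight `lam` is bounded. -/
def IsBoundedWeight {n : ℕ} (lam : Weight n) : Prop := IsBoundedModule (n := n) (L lam)

/-- `lam` is an integral bounded weight of type `k`: the shadow of the simple module of highest
weight `lam` is the one given by the parabolic subalgebra `p_k = s_k ⊕ n_k`. -/
def IsBoundedOfType {n : ℕ} (k : Fin (n - 1)) (lam : Weight n) : Prop :=
  IsIntegralWeight lam ∧ IsBoundedWeight lam ∧
    injRoots (n := n) (L lam) = negNilRoots k ∧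
    finRoots (n := n) (L lam) = leviRoots k ∪ nilRoots k

end GlBounded

open GlBounded

namespace GlBounded

attribute [local instance] LieRing.ofAssociativeRing

/-! ### Representations as algebra homomorphisms from the enveloping algebra -/

/-! Up to a common constant, λ + ρ of an integral weight is a vector `a` of integers (`IsShift`),
and the dot action permutes its entries. `W`-maximality says that `a` is weakly decreasing,
regularity that its entries are distinct, finite dimension of the simple module that `a` is strictly
decreasing. Everything else rests on one criterion: an integral weight is bounded iff `a` becomes
strictly decreasing after deletion of one entry (`AlmostAnti`).

Sufficiency (`IsShift.isBoundedWeight_of_almostAnti`): such a weight is the sum of an oscillator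
weight, whose free parameter absorbs the exceptional entry, and a dominant integral weight ν. The
oscillator module has one basis vector for each exponent, so its tensor product with the
finite-dimensional L(ν) has multiplicities at most dim L(ν). The product of the two singular vectors
makes L(λ) a subquotient of it.

Necessity (`IsShift.almostAnti_of_isBoundedWeight`): two adjacent positions at which `a` fails to
descend give a copy of gl_3 with two injective lowering operators and a singular vector, which can
be pushed to an antidominant weight. There the monomials E_qp^x E_rp^k E_rq^y are independent and
the multiplicities grow without bound (`not_isBoundedWeight_of_two`). A single non-descent may still
violate the criterion, but then the reflection at it creates two, and localization at the root
vector carries boundedness over to the reflected weight (`mult_reflect`).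

On a simple module each root vector is injective or locally nilpotent, and the locally nilpotent
roots are closed under addition (`ActsFin.add`). So the type is read off from the simple roots: a
bounded weight has type k iff its only non-descent is at k.

What remains is combinatorics. If `a` is weakly decreasing and `dot w lam` is bounded, then w⁻¹
preserves the order of all points but one; the nontrivial such w are the `prodS i k`, with the
non-descent at i. One repeated pair in `a` forces the deleted entry to be one of the pair, and two
repeated adjacent pairs cannot both be repaired by a single deletion. -/

theorem lie_E {n : ℕ} (i j k l : Fin n) :
    ⁅(E i j : gl n), E k l⁆ = (if j = k then E i l else 0) - (if l = i then E k j else 0) := by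
  rw [LieRing.of_associative_ring_bracket]
  unfold E
  congr 1
  · split_ifs with h
    · subst h; simp
    · simp [Matrix.single_mul_single_of_ne, h]
  · split_ifs with h
    · subst h; simp
    · simp [Matrix.single_mul_single_of_ne, h]

theorem U_induction {n : ℕ} {p : U n → Prop} (hc : ∀ c : ℂ, p (algebraMap ℂ (U n) c))
    (hι : ∀ i j, p (iota n (E i j))) (hadd : ∀ a b, p a → p b → p (a + b))
    (hmul : ∀ a b, p a → p b → p (a * b)) (u : U n) : p u := by
  have hx : ∀ x : gl n, p (iota n x) := by
    intro x
    rw [Matrix.matrix_eq_sum_single x, map_sum]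
    refine Finset.sum_induction _ p hadd (by simpa using hc 0) fun i _ => ?_
    rw [map_sum]
    refine Finset.sum_induction _ p hadd (by simpa using hc 0) fun j _ => ?_
    have : Matrix.single i j (x i j) = x i j • (E i j : gl n) := by simp [E]
    rw [this, map_smul, Algebra.smul_def]
    exact hmul _ _ (hc _) (hι i j)
  obtain ⟨t, rfl⟩ : ∃ t, UniversalEnvelopingAlgebra.mkAlgHom ℂ (gl n) t = u :=
    Quotient.exists_rep u
  induction t using TensorAlgebra.induction with
  | algebraMap r => rw [AlgHom.commutes]; exact hc r
  | ι x => simpa [UniversalEnvelopingAlgebra.ι_apply] using hx x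
  | mul a b ha hb => rw [map_mul]; exact hmul _ _ ha hb
  | add a b ha hb => rw [map_add]; exact hadd _ _ ha hb

section Rep

variable {n : ℕ} {M : Type*} [AddCommGroup M] [Module ℂ M] (A : U n →ₐ[ℂ] Module.End ℂ M)

/-- The operator by which the matrix unit `E_{ij}` acts. -/
noncomputable def op (i j : Fin n) : Module.End ℂ M := A (iota n (E i j))

theorem iota_comm (i j k l : Fin n) :
    iota n (E i j) * iota n (E k l) = iota n (E k l) * iota n (E i j) +
      ((if j = k then iota n (E i l) else 0) - (if l = i then iota n (E k j) else 0)) := by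
  have h := congrArg (iota n) (lie_E i j k l)
  rw [LieHom.map_lie, LieRing.of_associative_ring_bracket] at h
  rw [← sub_eq_iff_eq_add', h, map_sub]
  split_ifs <;> simp

theorem op_mul_op (i j k l : Fin n) : op A i j * op A k l = op A k l * op A i j +
    ((if j = k then op A i l else 0) - (if l = i then op A k j else 0)) := by
  have h := congrArg A (iota_comm i j k l)
  simp only [map_mul, map_add, map_sub] at h
  unfold op
  rw [h]
  split_ifs <;> simp

theorem op_op (i j k l : Fin n) (m : M) : op A i j (op A k l m) = op A k l (op A i j m) +
    ((if j = k then op A i l m else 0) - (if l = i then op A k j m else 0)) := by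
  have h := LinearMap.congr_fun (op_mul_op A i j k l) m
  rw [Module.End.mul_apply] at h
  rw [h]
  split_ifs <;> simp

/-- Weight spaces of a representation. -/
noncomputable def wt (μ : Weight n) : Submodule ℂ M :=
  ⨅ i, Module.End.eigenspace (op A i i) (μ i)

theorem mem_wt {μ : Weight n} {m : M} : m ∈ wt A μ ↔ ∀ i, op A i i m = μ i • m := by
  simp [wt]

theorem root_apply (i j k : Fin n) :
    root i j k = (if k = i then (1 : ℂ) else 0) - (if k = j then 1 else 0) := by
  simp [root, Pi.single_apply]

theorem op_mem_wt (i j : Fin n) {μ : Weight n} {m : M} (hm : m ∈ wt A μ) :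
    op A i j m ∈ wt A (μ + root i j) := by
  rw [mem_wt] at *
  intro k
  rw [op_op, hm k, Pi.add_apply, root_apply]
  simp only [map_smul]
  by_cases h1 : k = i <;> by_cases h2 : k = j <;>
    simp [h1, h2, eq_comm, add_smul, sub_smul] <;> aesop

theorem commute_op (i j : Fin n) : Commute (op A i i) (op A j j) := by
  rw [Commute, SemiconjBy, op_mul_op]
  by_cases h : i = j
  · subst h; simp
  · simp [h, Ne.symm h]

/-- Weight spaces are joint eigenspaces of commuting operators, so they sit inside the joint
generalized eigenspaces, which are independent in any dimension. -/
theorem iSupIndep_wt : iSupIndep (wt A) := by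
  have h := Module.End.independent_iInf_maxGenEigenspace_of_forall_mapsTo
    (fun i : Fin n => op A i i) (fun i j φ =>
      Module.End.mapsTo_maxGenEigenspace_of_comm (commute_op A j i) φ)
  refine h.mono fun μ => ?_
  unfold wt
  refine iInf_mono fun i => ?_
  exact (Module.End.genEigenspace (op A i i) (μ i)).monotone le_top

/-- Used mostly with sum zero, where it says that every component vanishes. -/
theorem wt_component {f : Weight n →₀ M} (hf : ∀ ν, f ν ∈ wt A ν) {κ : Weight n}
    (hx : (f.sum fun _ m => m) ∈ wt A κ) : (f.sum fun _ m => m) = f κ := by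
  classical
  have hd := (iSupIndep_def.mp (iSupIndep_wt A)) κ
  rw [Submodule.disjoint_def] at hd
  have h := hd ((f.sum fun _ m => m) - f κ) (sub_mem hx (hf κ)) ?_
  · exact sub_eq_zero.mp h
  · have : (f.sum fun _ m => m) - f κ = ∑ ν ∈ f.support.erase κ, f ν := by
      rw [Finsupp.sum]
      by_cases hκ : κ ∈ f.support
      · rw [← Finset.add_sum_erase _ _ hκ]; abel
      · rw [Finset.erase_eq_of_notMem hκ, Finsupp.notMem_support_iff.mp hκ, sub_zero]
    rw [this]
    refine Submodule.sum_mem _ fun ν hν => ?_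
    exact Submodule.mem_iSup_of_mem ν (Submodule.mem_iSup_of_mem (Finset.ne_of_mem_erase hν) (hf ν))

theorem wt_unique {μ ν : Weight n} {m : M} (h : m ≠ 0) (h1 : m ∈ wt A μ) (h2 : m ∈ wt A ν) :
    μ = ν := by
  funext i
  rw [mem_wt] at h1 h2
  have : μ i • m = ν i • m := (h1 i).symm.trans (h2 i)
  exact smul_left_injective ℂ h this

theorem mem_span_wt {S : Set M} (hS : ∀ s ∈ S, ∃ ν, s ∈ wt A ν) {x : M} (hx : x ∈ Submodule.span ℂ S)
    {κ : Weight n} (hκ : x ∈ wt A κ) : x ∈ Submodule.span ℂ {s | s ∈ S ∧ s ∈ wt A κ} := by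
  have h1 : Submodule.span ℂ S ≤ ⨆ ν, Submodule.span ℂ {s | s ∈ S ∧ s ∈ wt A ν} := by
    refine Submodule.span_le.mpr fun s hs => ?_
    obtain ⟨ν, hν⟩ := hS s hs
    exact Submodule.mem_iSup_of_mem ν (Submodule.subset_span ⟨hs, hν⟩)
  obtain ⟨f, hf, rfl⟩ := (Submodule.mem_iSup_iff_exists_finsupp _ _).mp (h1 hx)
  have h2 : ∀ ν, f ν ∈ wt A ν := fun ν =>
    (Submodule.span_le.mpr fun s hs => hs.2 : Submodule.span ℂ {s | s ∈ S ∧ s ∈ wt A ν} ≤ _) (hf ν)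
  rw [wt_component A h2 hκ]
  exact hf κ

theorem map_mem_of_op_mem {N : Submodule ℂ M} (h : ∀ i j, ∀ m ∈ N, op A i j m ∈ N) (u : U n) :
    ∀ m ∈ N, A u m ∈ N := by
  induction u using U_induction with
  | hc c => intro m hm; simpa [Algebra.algebraMap_eq_smul_one] using N.smul_mem c hm
  | hι i j => exact h i j
  | hadd a b ha hb => intro m hm; simpa using N.add_mem (ha m hm) (hb m hm)
  | hmul a b ha hb => intro m hm; simpa using ha _ (hb m hm)

/-- `v` is a singular vector of weight `μ`. -/
def IsSing (μ : Weight n) (v : M) : Prop := v ∈ wt A μ ∧ ∀ i j : Fin n, i < j → op A i j v = 0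

/-- The vector obtained from `v` by applying a word in the matrix units. -/
noncomputable def word (l : List (Fin n × Fin n)) (v : M) : M :=
  l.foldr (fun p x => op A p.1 p.2 x) v

/-- A word is lowering if all its letters are negative root vectors. -/
def IsLowering (l : List (Fin n × Fin n)) : Prop := ∀ p ∈ l, p.2 < p.1

/-- The span of the lowering words applied to `v`. -/
noncomputable def lowerSpan (v : M) : Submodule ℂ M :=
  Submodule.span ℂ {x | ∃ l, IsLowering l ∧ x = word A l v}

variable {A}

theorem op_mem_lowerSpan_of_lt {v m : M} {i j : Fin n} (hij : j < i) (hm : m ∈ lowerSpan A v) :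
    op A i j m ∈ lowerSpan A v := by
  induction hm using Submodule.span_induction with
  | mem x hx =>
    obtain ⟨l, hl, rfl⟩ := hx
    refine Submodule.subset_span ⟨(i, j) :: l, ?_, rfl⟩
    intro p hp
    rcases List.mem_cons.mp hp with rfl | hp
    · exact hij
    · exact hl p hp
  | zero => simp
  | add x y _ _ hx hy => rw [map_add]; exact add_mem hx hy
  | smul c x _ hx => rw [map_smul]; exact Submodule.smul_mem _ _ hx

/-- Moving a matrix unit past the first letter leaves commutators, which are matrix units applied to
a shorter word. Hence a singular vector generates no more than its lowering words, and no basis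
theorem for the enveloping algebra is needed. -/
theorem op_word_mem_lowerSpan {μ : Weight n} {v : M} (hv : IsSing A μ v) :
    ∀ l, IsLowering l → ∀ i j, op A i j (word A l v) ∈ lowerSpan A v := by
  intro l
  induction l with
  | nil =>
    intro _ i j
    rcases lt_trichotomy i j with h | h | h
    · have : op A i j (word A [] v) = 0 := hv.2 i j h
      rw [this]; exact zero_mem _
    · subst h
      have : op A i i (word A [] v) = μ i • v := (mem_wt A).mp hv.1 i
      rw [this]
      exact Submodule.smul_mem _ _ (Submodule.subset_span ⟨[], by simp [IsLowering], rfl⟩)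
    · exact Submodule.subset_span ⟨[(i, j)], by simpa [IsLowering] using h, rfl⟩
  | cons p l ih =>
    intro hl i j
    have hl' : IsLowering l := fun q hq => hl q (List.mem_cons_of_mem _ hq)
    have hp : p.2 < p.1 := hl p List.mem_cons_self
    have e : word A (p :: l) v = op A p.1 p.2 (word A l v) := rfl
    rw [e, op_op]
    refine add_mem (op_mem_lowerSpan_of_lt hp (ih hl' i j)) (sub_mem ?_ ?_)
    · split_ifs
      exacts [ih hl' _ _, zero_mem _]
    · split_ifs
      exacts [ih hl' _ _, zero_mem _]

theorem map_mem_lowerSpan {μ : Weight n} {v : M} (hv : IsSing A μ v) (u : U n) :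
    A u v ∈ lowerSpan A v := by
  refine map_mem_of_op_mem A (N := lowerSpan A v) ?_ u v
    (Submodule.subset_span ⟨[], by simp [IsLowering], rfl⟩)
  intro i j m hm
  induction hm using Submodule.span_induction with
  | mem x hx =>
    obtain ⟨l, hl, rfl⟩ := hx
    exact op_word_mem_lowerSpan hv l hl i j
  | zero => simp
  | add x y _ _ hx hy => rw [map_add]; exact add_mem hx hy
  | smul c x _ hx => rw [map_smul]; exact Submodule.smul_mem _ _ hx

theorem word_mem_wt {μ : Weight n} {v : M} (hv : v ∈ wt A μ) (l : List (Fin n × Fin n)) :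
    word A l v ∈ wt A (μ + (l.map fun p => root p.1 p.2).sum) := by
  induction l with
  | nil => simpa [word] using hv
  | cons p l ih =>
    have := op_mem_wt A p.1 p.2 ih
    rw [List.map_cons, List.sum_cons, add_comm (root _ _), ← add_assoc]
    exact this

theorem exists_wt_of_mem_words {μ : Weight n} {v : M} (hv : v ∈ wt A μ) :
    ∀ s ∈ {x | ∃ l, IsLowering l ∧ x = word A l v}, ∃ ν, s ∈ wt A ν := by
  rintro _ ⟨l, _, rfl⟩
  exact ⟨_, word_mem_wt hv l⟩

/-- The height functional `ν ↦ ∑ i ν_i`, which increases by `i - j` under `E_{ij}`. -/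
noncomputable def hgt (ν : Weight n) : ℂ := ∑ i, (i.val : ℂ) * ν i

theorem hgt_add (μ ν : Weight n) : hgt (μ + ν) = hgt μ + hgt ν := by
  simp [hgt, mul_add, Finset.sum_add_distrib]

theorem hgt_root (i j : Fin n) : hgt (root i j) = (i.val : ℂ) - j.val := by
  simp [hgt, root_apply, mul_sub, Finset.sum_sub_distrib]

/-- Each lowering letter adds at least one to the height. So a weight bounds the length of the words
that reach it, which makes weight spaces finite-dimensional and the top one a line. -/
theorem hgt_word (l : List (Fin n × Fin n)) (hl : IsLowering l) :
    ∃ s : ℕ, l.length ≤ s ∧ hgt (l.map fun p => root p.1 p.2).sum = s := by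
  induction l with
  | nil => exact ⟨0, by simp, by simp [hgt]⟩
  | cons p l ih =>
    obtain ⟨s, h1, h2⟩ := ih fun q hq => hl q (List.mem_cons_of_mem _ hq)
    have hp : p.2 < p.1 := hl p List.mem_cons_self
    have hp' : p.2.val < p.1.val := hp
    refine ⟨s + (p.1.val - p.2.val), by simp; omega, ?_⟩
    rw [List.map_cons, List.sum_cons, hgt_add, h2, hgt_root]
    push_cast [Nat.cast_sub hp'.le]
    ring

/-- `v` is singular of weight `μ` and generates the representation. -/
structure IsHW (A : U n →ₐ[ℂ] Module.End ℂ M) (μ : Weight n) (v : M) : Prop where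
  sing : IsSing A μ v
  gen : ∀ m, ∃ u, A u v = m

namespace IsHW

variable {μ : Weight n} {v : M} (h : IsHW A μ v)
include h

theorem mem_span_words (x : M) : x ∈ Submodule.span ℂ {x | ∃ l, IsLowering l ∧ x = word A l v} := by
  obtain ⟨u, rfl⟩ := h.gen x
  exact map_mem_lowerSpan h.sing u

theorem iSup_wt : ⨆ ν, wt A ν = ⊤ := by
  rw [eq_top_iff]
  intro x _
  refine (Submodule.span_le.mpr ?_ : Submodule.span ℂ _ ≤ _) (h.mem_span_words x)
  intro s hs
  obtain ⟨ν, hν⟩ := exists_wt_of_mem_words h.sing.1 s hs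
  exact Submodule.mem_iSup_of_mem ν hν

theorem mem_span_words_wt {κ : Weight n} {x : M} (hx : x ∈ wt A κ) :
    x ∈ Submodule.span ℂ
      {s | (∃ l, IsLowering l ∧ s = word A l v) ∧ s ∈ wt A κ} :=
  mem_span_wt A (exists_wt_of_mem_words h.sing.1) (h.mem_span_words x) hx

/-- A nonzero weight space contains a lowering word. -/
theorem exists_word {κ : Weight n} {x : M} (hx : x ∈ wt A κ) (h0 : x ≠ 0) :
    ∃ l, IsLowering l ∧ word A l v ≠ 0 ∧ κ = μ + (l.map fun p => root p.1 p.2).sum := by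
  by_contra hcon
  push Not at hcon
  apply h0
  have h1 := h.mem_span_words_wt hx
  have h2 : {s | (∃ l, IsLowering l ∧ s = word A l v) ∧ s ∈ wt A κ} ⊆ {0} := by
    rintro _ ⟨⟨l, hl, rfl⟩, hs⟩
    by_contra hne
    exact hcon l hl hne (wt_unique A hne hs (word_mem_wt h.sing.1 l))
  have h3 := Submodule.span_mono h2 h1
  simpa using h3

theorem exists_hgt {κ : Weight n} {x : M} (hx : x ∈ wt A κ) (h0 : x ≠ 0) :
    ∃ s : ℕ, hgt κ = hgt μ + s := by
  obtain ⟨l, hl, _, rfl⟩ := h.exists_word hx h0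
  obtain ⟨s, _, hs⟩ := hgt_word l hl
  exact ⟨s, by rw [hgt_add, hs]⟩

theorem finiteDimensional_wt (κ : Weight n) : FiniteDimensional ℂ (wt A κ) := by
  set S := {s | (∃ l, IsLowering l ∧ s = word A l v) ∧ s ∈ wt A κ} with hS
  have hfin : S.Finite := by
    by_cases hne : ∃ s : ℕ, hgt κ = hgt μ + s
    · obtain ⟨N, hN⟩ := hne
      -- Only words of length at most `N` can reach the height of κ without vanishing.
      refine ((List.finite_length_le (Fin n × Fin n) N).image (fun l => word A l v)).union
        (Set.finite_singleton 0) |>.subset ?_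
      rintro _ ⟨⟨l, hl, rfl⟩, hs⟩
      by_cases h0 : word A l v = 0
      · right; exact h0
      · left
        refine ⟨l, ?_, rfl⟩
        have e := wt_unique A h0 hs (word_mem_wt h.sing.1 l)
        obtain ⟨s, h1, h2⟩ := hgt_word l hl
        rw [e, hgt_add, h2] at hN
        have : s = N := by exact_mod_cast add_left_cancel hN
        simpa [this] using h1
    · refine (Set.finite_singleton (0 : M)).subset ?_
      rintro x ⟨_, hs⟩
      by_contra h0
      exact hne (h.exists_hgt hs h0)
  have := FiniteDimensional.span_of_finite ℂ hfin
  exact Submodule.finiteDimensional_of_le (S₂ := Submodule.span ℂ S)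
    fun x hx => h.mem_span_words_wt hx

theorem wt_top_le : wt A μ ≤ Submodule.span ℂ {v} := by
  intro x hx
  have h1 := h.mem_span_words_wt hx
  have h2 : {s | (∃ l, IsLowering l ∧ s = word A l v) ∧ s ∈ wt A μ} ⊆
      (Submodule.span ℂ {v} : Set M) := by
    rintro _ ⟨⟨l, hl, rfl⟩, hs⟩
    by_cases h0 : word A l v = 0
    · rw [h0]; exact zero_mem _
    have e := wt_unique A h0 hs (word_mem_wt h.sing.1 l)
    obtain ⟨s, h1, h2⟩ := hgt_word l hl
    have h3 := congrArg hgt e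
    rw [hgt_add, h2] at h3
    have : s = 0 := by
      have : (s : ℂ) = 0 := by linear_combination -h3
      exact_mod_cast this
    have : l = [] := List.length_eq_zero_iff.mp (by omega)
    subst this
    exact Submodule.mem_span_singleton_self v
  exact Submodule.span_le.mpr h2 h1

end IsHW

end Rep

/-! ### Constructions of representations -/

section Construct

variable {n : ℕ} {M : Type*} [AddCommGroup M] [Module ℂ M]

/-- The linear extension of an assignment of operators to the matrix units. -/
noncomputable def repLin (R : Fin n → Fin n → Module.End ℂ M) : gl n →ₗ[ℂ] Module.End ℂ M where
  toFun x := ∑ i, ∑ j, x i j • R i j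
  map_add' x y := by simp [add_smul, Finset.sum_add_distrib]
  map_smul' c x := by simp [mul_smul, Finset.smul_sum]

theorem repLin_E (R : Fin n → Fin n → Module.End ℂ M) (i j : Fin n) : repLin R (E i j) = R i j := by
  change ∑ a, ∑ b, (E i j : gl n) a b • R a b = R i j
  rw [Finset.sum_eq_single i, Finset.sum_eq_single j]
  · simp [E]
  · intro b _ hb; simp [E, hb.symm]
  · simp
  · intro a _ ha
    exact Finset.sum_eq_zero fun b _ => by simp [E, ha.symm]
  · simp

/-- The representation given by operators that satisfy the relations of the matrix units. -/
noncomputable def repOf (R : Fin n → Fin n → Module.End ℂ M)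
    (h : ∀ i j k l, R i j * R k l = R k l * R i j +
      ((if j = k then R i l else 0) - (if l = i then R k j else 0))) :
    U n →ₐ[ℂ] Module.End ℂ M :=
  UniversalEnvelopingAlgebra.lift ℂ
    { repLin R with
      map_lie' := by
        intro x y
        change repLin R ⁅x, y⁆ = ⁅repLin R x, repLin R y⁆
        induction x using Matrix.induction_on' with
        | h_zero => simp
        | h_add p q hp hq => rw [add_lie, map_add, hp, hq, map_add, add_lie]
        | h_std_basis i j c =>
          have e1 : Matrix.single i j c = c • (E i j : gl n) := by simp [E]
          rw [e1]
          induction y using Matrix.induction_on' with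
          | h_zero => simp
          | h_add p q hp hq => rw [lie_add, map_add, hp, hq, map_add, lie_add]
          | h_std_basis k l d =>
            have e2 : Matrix.single k l d = d • (E k l : gl n) := by simp [E]
            rw [e2, smul_lie, lie_smul, lie_E, map_smul, map_smul, map_smul, map_smul, map_sub,
              smul_lie, lie_smul, repLin_E, repLin_E, LieRing.of_associative_ring_bracket, h,
              add_sub_cancel_left]
            congr 3
            · split_ifs
              exacts [repLin_E _ _ _, map_zero _]
            · split_ifs
              exacts [repLin_E _ _ _, map_zero _] }

theorem op_repOf (R : Fin n → Fin n → Module.End ℂ M) (h) (i j : Fin n) :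
    op (repOf R h) i j = R i j := by
  unfold op repOf
  rw [UniversalEnvelopingAlgebra.lift_ι_apply]
  exact repLin_E R i j

variable {V : Type*} [AddCommGroup V] [Module ℂ V]

open TensorProduct in
/-- The tensor product of two representations. -/
noncomputable def tensorRep (A : U n →ₐ[ℂ] Module.End ℂ M) (B : U n →ₐ[ℂ] Module.End ℂ V) :
    U n →ₐ[ℂ] Module.End ℂ (M ⊗[ℂ] V) :=
  repOf (fun i j => (op A i j).rTensor V + (op B i j).lTensor M) (by
    intro i j k l
    refine TensorProduct.ext' fun x y => ?_
    simp only [Module.End.mul_apply, LinearMap.add_apply, LinearMap.rTensor_tmul,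
      LinearMap.lTensor_tmul, map_add, LinearMap.sub_apply]
    rw [op_op A i j k l, op_op B i j k l]
    simp only [TensorProduct.add_tmul, TensorProduct.tmul_add, TensorProduct.sub_tmul,
      TensorProduct.tmul_sub]
    split_ifs <;> simp <;> abel)

open TensorProduct in
theorem op_tensorRep (A : U n →ₐ[ℂ] Module.End ℂ M) (B : U n →ₐ[ℂ] Module.End ℂ V) (i j : Fin n)
    (x : M) (y : V) :
    op (tensorRep A B) i j (x ⊗ₜ y) = op A i j x ⊗ₜ y + x ⊗ₜ op B i j y := by
  rw [tensorRep, op_repOf]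
  simp

open TensorProduct in
theorem IsSing.tmul {A : U n →ₐ[ℂ] Module.End ℂ M} {B : U n →ₐ[ℂ] Module.End ℂ V} {μ ν : Weight n}
    {x : M} {y : V} (hx : IsSing A μ x) (hy : IsSing B ν y) :
    IsSing (tensorRep A B) (μ + ν) (x ⊗ₜ y) := by
  refine ⟨(mem_wt _).mpr fun i => ?_, fun i j hij => ?_⟩
  · rw [op_tensorRep, (mem_wt A).mp hx.1 i, (mem_wt B).mp hy.1 i, Pi.add_apply, add_smul,
      TensorProduct.smul_tmul', TensorProduct.tmul_smul, TensorProduct.smul_tmul']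
  · rw [op_tensorRep, hx.2 i j hij, hy.2 i j hij]
    simp

end Construct

/-! ### The oscillator modules -/

section Osc

variable {n : ℕ}

/-- The underlying space of the oscillator modules, with a basis indexed by all exponents. -/
abbrev Osc (n : ℕ) : Type := Weight n →₀ ℂ

/-- Multiplication by `x_i`, rescaled for `i < p`. -/
noncomputable def oscX (p i : Fin n) : Module.End ℂ (Osc n) :=
  Finsupp.linearCombination ℂ fun m =>
    Finsupp.single (m + Pi.single i 1) (if i < p then m i + 1 else 1)

/-- The derivation `∂_i`, rescaled for `i < p`. -/
noncomputable def oscD (p i : Fin n) : Module.End ℂ (Osc n) :=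
  Finsupp.linearCombination ℂ fun m =>
    Finsupp.single (m - Pi.single i 1) (if i < p then 1 else m i)

theorem oscX_single (p i : Fin n) (m : Weight n) (c : ℂ) : oscX p i (Finsupp.single m c) =
    Finsupp.single (m + Pi.single i 1) (c * if i < p then m i + 1 else 1) := by
  simp [oscX, Finsupp.linearCombination_single]

theorem oscD_single (p i : Fin n) (m : Weight n) (c : ℂ) : oscD p i (Finsupp.single m c) =
    Finsupp.single (m - Pi.single i 1) (c * if i < p then 1 else m i) := by
  simp [oscD, Finsupp.linearCombination_single]

theorem oscX_comm (p i j : Fin n) : oscX p i * oscX p j = oscX p j * oscX p i := by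
  refine Finsupp.lhom_ext fun m c => ?_
  rcases eq_or_ne i j with rfl | h
  · rfl
  simp only [Module.End.mul_apply, oscX_single, Pi.add_apply, Pi.single_eq_of_ne h,
    Pi.single_eq_of_ne h.symm, add_zero]
  rw [add_right_comm, mul_right_comm]

theorem oscD_comm (p i j : Fin n) : oscD p i * oscD p j = oscD p j * oscD p i := by
  refine Finsupp.lhom_ext fun m c => ?_
  rcases eq_or_ne i j with rfl | h
  · rfl
  simp only [Module.End.mul_apply, oscD_single, Pi.sub_apply, Pi.single_eq_of_ne h,
    Pi.single_eq_of_ne h.symm, sub_zero]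
  rw [sub_right_comm, mul_right_comm]

theorem oscX_mul_oscD_single (p i : Fin n) (m : Weight n) (c : ℂ) :
    (oscX p i * oscD p i) (Finsupp.single m c) = m i • Finsupp.single m c := by
  simp only [Module.End.mul_apply, oscD_single, oscX_single, Pi.sub_apply, Pi.single_eq_same,
    sub_add_cancel]
  rw [Finsupp.smul_single, smul_eq_mul]
  split_ifs <;> simp [mul_comm]

theorem oscD_mul_oscX (p i j : Fin n) :
    oscD p i * oscX p j = oscX p j * oscD p i + if i = j then 1 else 0 := by
  refine Finsupp.lhom_ext fun m c => ?_
  rcases eq_or_ne i j with rfl | h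
  · rw [LinearMap.add_apply, oscX_mul_oscD_single]
    simp only [Module.End.mul_apply, oscD_single, oscX_single, Pi.add_apply, Pi.single_eq_same,
      add_sub_cancel_right, if_true, Module.End.one_apply, Finsupp.smul_single, smul_eq_mul]
    rw [← Finsupp.single_add]
    congr 1
    split_ifs <;> ring
  · simp only [if_neg h, add_zero, Module.End.mul_apply, oscD_single, oscX_single, Pi.add_apply,
      Pi.sub_apply, Pi.single_eq_of_ne h, Pi.single_eq_of_ne h.symm, add_zero, sub_zero]
    rw [mul_right_comm, add_sub_right_comm]

/-- The oscillator module: `E_{ij}` acts by `x_i ∂_j`. -/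
noncomputable def oscRep (p : Fin n) : U n →ₐ[ℂ] Module.End ℂ (Osc n) :=
  repOf (fun i j => oscX p i * oscD p j) (by
    intro i j k l
    have e1 : oscX p i * oscD p j * (oscX p k * oscD p l) =
        oscX p i * (oscD p j * oscX p k) * oscD p l := by simp only [mul_assoc]
    have e2 : oscX p k * oscD p l * (oscX p i * oscD p j) =
        oscX p k * (oscD p l * oscX p i) * oscD p j := by simp only [mul_assoc]
    have e3 : oscX p i * (oscX p k * oscD p j) * oscD p l =
        oscX p k * (oscX p i * oscD p l) * oscD p j := by
      rw [← mul_assoc, oscX_comm p i k, mul_assoc, mul_assoc, oscD_comm p j l]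
      simp only [mul_assoc]
    rw [e1, e2, oscD_mul_oscX, oscD_mul_oscX, mul_add, add_mul, mul_add, add_mul, e3]
    split_ifs <;> simp <;> abel)

theorem op_oscRep_single (p i j : Fin n) (m : Weight n) : op (oscRep p) i j (Finsupp.single m 1) =
    oscX p i (oscD p j (Finsupp.single m 1)) := by
  rw [oscRep, op_repOf, Module.End.mul_apply]

theorem op_oscRep_diag (p i : Fin n) (m : Weight n) (c : ℂ) :
    op (oscRep p) i i (Finsupp.single m c) = m i • Finsupp.single m c := by
  rw [oscRep, op_repOf, oscX_mul_oscD_single]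

/-- The exponent `(-1, …, -1, c, 0, …, 0)` with `c` at place `p`. -/
noncomputable def oscWeight (p : Fin n) (c : ℂ) : Weight n :=
  fun i => if i < p then -1 else if i = p then c else 0

/-- If i < p, the rescaled x_i has coefficient m_i + 1, which vanishes at exponent −1. If i ≥ p,
then j > p and ∂_j kills the exponent 0. The rescaling exists for the first case. -/
theorem isSing_osc (p : Fin n) (c : ℂ) :
    IsSing (oscRep p) (oscWeight p c) (Finsupp.single (oscWeight p c) 1) := by
  refine ⟨(mem_wt _).mpr fun i => op_oscRep_diag p i _ _, fun i j hij => ?_⟩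
  rw [op_oscRep_single, oscD_single, oscX_single, Finsupp.single_eq_zero]
  by_cases hi : i < p
  · simp [hi, oscWeight, Pi.single_eq_of_ne hij.ne]
  · have h1 : ¬ j < p := fun h => hi (hij.trans h)
    have h2 : j ≠ p := fun h => hi (h ▸ hij)
    simp [h1, h2, oscWeight]

/-- `μ` is the weight of a nonzero singular vector of some representation. -/
def HasSing (μ : Weight n) : Prop :=
  ∃ (M : Type) (_ : AddCommGroup M) (_ : Module ℂ M) (A : U n →ₐ[ℂ] Module.End ℂ M) (v : M),
    v ≠ 0 ∧ IsSing A μ v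

theorem HasSing.add {μ ν : Weight n} (h1 : HasSing μ) (h2 : HasSing ν) : HasSing (μ + ν) := by
  obtain ⟨M, _, _, A, v, hv, hA⟩ := h1
  obtain ⟨N, _, _, B, w, hw, hB⟩ := h2
  refine ⟨TensorProduct ℂ M N, inferInstance, inferInstance, tensorRep A B, v ⊗ₜ w, ?_, hA.tmul hB⟩
  intro h
  obtain ⟨f, hf⟩ : ∃ f : Module.Dual ℂ M, f v ≠ 0 := by
    by_contra hcon
    push Not at hcon
    exact hv ((Module.forall_dual_apply_eq_zero_iff ℂ v).mp hcon)
  have h2 := congrArg (fun t => TensorProduct.lid ℂ N (f.rTensor N t)) h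
  simp only [LinearMap.rTensor_tmul, TensorProduct.lid_tmul, map_zero, smul_eq_zero] at h2
  exact h2.elim hf hw

theorem hasSing_zero : HasSing (0 : Weight n) :=
  ⟨ℂ, inferInstance, inferInstance, repOf (fun _ _ => 0) (by simp), 1, one_ne_zero,
    (mem_wt _).mpr fun i => by simp [op_repOf], fun i j _ => by simp [op_repOf]⟩

/-- Place i receives −1 from the oscillator weight of each p > i; the parameters add the number of
these p back. This is what shows that Verma modules are nonzero. -/
theorem hasSing (μ : Weight n) : HasSing μ := by
  have h1 : ∀ p c, HasSing (oscWeight (n := n) p c) := fun p c =>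
    ⟨Osc n, inferInstance, inferInstance, oscRep p, _, by simp, isSing_osc p c⟩
  have h2 : HasSing (∑ p, oscWeight p (μ p + (Finset.univ.filter fun q => p < q).card)) :=
    Finset.sum_induction _ HasSing (fun _ _ => HasSing.add) hasSing_zero fun p _ => h1 p _
  convert h2 using 1
  funext i
  rw [Finset.sum_apply]
  have : ∀ p : Fin n, oscWeight p (μ p + (Finset.univ.filter fun q => p < q).card) i =
      (if i < p then (-1 : ℂ) else 0) +
        if i = p then μ p + (Finset.univ.filter fun q => p < q).card else 0 := by
    intro p
    unfold oscWeight
    rcases lt_trichotomy i p with h | h | h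
    · simp [h, h.ne]
    · simp [h]
    · simp [h.not_gt, h.ne']
  simp_rw [this]
  rw [Finset.sum_add_distrib, Finset.sum_ite_eq, ← Finset.sum_filter]
  simp

end Osc

/-! ### The simple highest weight modules -/

section UMod

variable {n : ℕ} (M : Type*) [AddCommGroup M] [Module ℂ M] [Module (U n) M]
  [IsScalarTower ℂ (U n) M]

/-- The representation attached to a module over the enveloping algebra. -/
noncomputable def rep : U n →ₐ[ℂ] Module.End ℂ M := Algebra.lsmul ℂ ℂ M

end UMod

section Simple

variable {n : ℕ} (lam : Weight n)

/-- The representation on the simple module of highest weight `lam`. -/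
noncomputable def repL : U n →ₐ[ℂ] Module.End ℂ (L lam) := rep (L lam)

theorem op_repL (i j : Fin n) (m : L lam) : op (repL lam) i j m = ⁅(E i j : gl n), m⁆ := rfl

/-- The highest weight vector of the Verma module. -/
noncomputable def vermaVec : Verma lam := Submodule.Quotient.mk 1

/-- The highest weight vector of the simple module. -/
noncomputable def hwv : L lam := Submodule.Quotient.mk (vermaVec lam)

theorem smul_vermaVec (u : U n) : u • vermaVec lam = Submodule.Quotient.mk u := by
  rw [vermaVec, ← Submodule.Quotient.mk_smul, smul_eq_mul, mul_one]

theorem smul_hwv (u : U n) :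
    u • hwv lam = (Submodule.Quotient.mk (Submodule.Quotient.mk u : Verma lam) : L lam) := by
  rw [← smul_vermaVec]; rfl

theorem diagonal_eq (d : Fin n → ℂ) :
    (Matrix.diagonal d : gl n) = ∑ i, d i • (E i i : gl n) := by
  rw [← Matrix.sum_single_eq_diagonal]
  simp [E]

variable {lam} in
theorem vermaIdeal_le_of_isSing {M : Type*} [AddCommGroup M] [Module ℂ M]
    {A : U n →ₐ[ℂ] Module.End ℂ M} {w : M} (hw : IsSing A lam w) {u : U n}
    (hu : u ∈ vermaIdeal lam) : A u w = 0 := by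
  induction hu using Submodule.span_induction with
  | mem x hx =>
    rcases hx with ⟨i, j, hij, rfl⟩ | ⟨d, rfl⟩
    · exact hw.2 i j hij
    · rw [diagonal_eq, map_sub, map_sum, map_sum, LinearMap.sub_apply, LinearMap.sum_apply,
        sub_eq_zero, AlgHom.commutes, Algebra.algebraMap_eq_smul_one, LinearMap.smul_apply,
        Module.End.one_apply, Finset.sum_smul]
      refine Finset.sum_congr rfl fun i _ => ?_
      rw [map_smul, map_smul, LinearMap.smul_apply]
      have : A (iota n (E i i)) w = lam i • w := (mem_wt A).mp hw.1 i
      rw [this, smul_smul, mul_comm]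
  | zero => simp
  | add x y _ _ hx hy => rw [map_add, LinearMap.add_apply, hx, hy, add_zero]
  | smul c x _ hx => rw [smul_eq_mul, map_mul, Module.End.mul_apply, hx, map_zero]

theorem vermaVec_ne_zero : vermaVec lam ≠ 0 := by
  intro h
  obtain ⟨M, _, _, A, v, hv, hA⟩ := hasSing lam
  have h1 : (1 : U n) ∈ vermaIdeal lam := (Submodule.Quotient.mk_eq_zero _).mp h
  have h2 := vermaIdeal_le_of_isSing hA h1
  rw [map_one] at h2
  exact hv h2

theorem isHW_verma : IsHW (rep (Verma lam)) lam (vermaVec lam) := by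
  refine ⟨⟨(mem_wt _).mpr fun i => ?_, fun i j hij => ?_⟩, fun m => ?_⟩
  · change iota n (E i i) • vermaVec lam = _
    rw [smul_vermaVec, vermaVec, ← Submodule.Quotient.mk_smul, Submodule.Quotient.eq]
    refine Submodule.subset_span (Or.inr ⟨Pi.single i 1, ?_⟩)
    rw [Matrix.diagonal_single]
    simp [E, Pi.single_apply, Algebra.algebraMap_eq_smul_one]
  · change iota n (E i j) • vermaVec lam = _
    rw [smul_vermaVec, Submodule.Quotient.mk_eq_zero]
    exact Submodule.subset_span (Or.inl ⟨i, j, hij, rfl⟩)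
  · obtain ⟨u, rfl⟩ := Submodule.Quotient.mk_surjective _ m
    exact ⟨u, smul_vermaVec lam u⟩

theorem isHW_hwv : IsHW (repL lam) lam (hwv lam) := by
  have h := isHW_verma lam
  refine ⟨⟨(mem_wt _).mpr fun i => ?_, fun i j hij => ?_⟩, fun m => ?_⟩
  · exact congrArg (Submodule.Quotient.mk (p := maxSubmodule lam)) ((mem_wt _).mp h.sing.1 i)
  · exact congrArg (Submodule.Quotient.mk (p := maxSubmodule lam)) (h.sing.2 i j hij)
  · obtain ⟨m, rfl⟩ := Submodule.Quotient.mk_surjective _ m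
    obtain ⟨u, rfl⟩ := h.gen m
    exact ⟨u, rfl⟩

/-- A proper submodule contains the weight components of its elements, and its top component must
vanish because the top weight space is the line of the generator. So all proper submodules, and
their sum, lie in the span `P` of the other weight spaces. -/
theorem not_mem_maxSubmodule : vermaVec lam ∉ maxSubmodule lam := by
  set A : U n →ₐ[ℂ] Module.End ℂ (Verma lam) := rep (Verma lam) with hA
  have hHW := isHW_verma lam
  set P : Submodule ℂ (Verma lam) := ⨆ (ν) (_ : ν ≠ lam), wt A ν with hP
  have key : ∀ N : Submodule (U n) (Verma lam), N ≠ ⊤ → ∀ x ∈ N, x ∈ P := by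
    intro N hN x hx
    have hx' : x ∈ ⨆ ν, wt A ν := by rw [hHW.iSup_wt]; trivial
    obtain ⟨f, hf, rfl⟩ := (Submodule.mem_iSup_iff_exists_finsupp _ _).mp hx'
    have hq : ∀ ν, Submodule.Quotient.mk (p := N) (f ν) ∈ wt (rep (Verma lam ⧸ N)) ν := fun ν =>
      (mem_wt _).mpr fun i =>
        congrArg (Submodule.Quotient.mk (p := N)) ((mem_wt A).mp (hf ν) i)
    have h0 : f lam ∈ N := by
      rw [← Submodule.Quotient.mk_eq_zero]
      -- In the quotient by `N` the components sum to zero, so each is zero, by independence of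
      -- weight spaces there.
      let g : Weight n →₀ (Verma lam ⧸ N) := f.mapRange N.mkQ (map_zero _)
      have hg : (g.sum fun _ m => m) = 0 := by
        rw [show g = f.mapRange N.mkQ (map_zero _) from rfl,
          Finsupp.sum_mapRange_index (fun _ => rfl)]
        have := (Submodule.Quotient.mk_eq_zero N).mpr hx
        rw [← this, Finsupp.sum, Finsupp.sum]
        exact (map_sum N.mkQ _ _).symm
      have := wt_component (rep (Verma lam ⧸ N)) (f := g) (κ := lam) hq (by rw [hg]; exact zero_mem _)
      rw [hg] at this
      exact this.symm
    have h1 : f lam = 0 := by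
      by_contra hne
      obtain ⟨c, hc⟩ := Submodule.mem_span_singleton.mp (hHW.wt_top_le (hf lam))
      have hc0 : c ≠ 0 := by rintro rfl; exact hne (by rw [← hc, zero_smul])
      have hv : vermaVec lam ∈ N := by
        have := N.smul_mem (algebraMap ℂ (U n) c⁻¹) h0
        rwa [← hc, algebraMap_smul, smul_smul, inv_mul_cancel₀ hc0, one_smul] at this
      apply hN
      rw [eq_top_iff]
      intro y _
      obtain ⟨u, rfl⟩ := hHW.gen y
      exact N.smul_mem u hv
    refine Submodule.sum_mem _ fun ν hν => ?_
    refine Submodule.mem_iSup_of_mem ν (Submodule.mem_iSup_of_mem ?_ (hf ν))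
    rintro rfl
    exact (Finsupp.mem_support_iff.mp hν) h1
  have hPU : ∀ u : U n, ∀ x ∈ maxSubmodule lam, x ∈ P := by
    intro _ x hx
    rw [maxSubmodule] at hx
    have : ∀ x ∈ sSup {N : Submodule (U n) (Verma lam) | N ≠ ⊤}, x ∈ P := by
      intro x hx
      rw [sSup_eq_iSup'] at hx
      induction hx using Submodule.iSup_induction' with
      | mem N x hx => exact key N.1 N.2 x hx
      | zero => exact zero_mem _
      | add x y _ _ hx hy => exact add_mem hx hy
    exact this x hx
  intro hmem
  have hd := (iSupIndep_def.mp (iSupIndep_wt A)) lam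
  rw [Submodule.disjoint_def] at hd
  exact vermaVec_ne_zero lam (hd _ hHW.sing.1 (hPU 1 _ hmem))

theorem hwv_ne_zero : hwv lam ≠ 0 := fun h =>
  not_mem_maxSubmodule lam ((Submodule.Quotient.mk_eq_zero _).mp h)

/-- The annihilator of a nonzero singular vector of weight `lam` kills the highest weight vector of
the simple module. -/
theorem smul_hwv_eq_zero {M : Type*} [AddCommGroup M] [Module ℂ M]
    {A : U n →ₐ[ℂ] Module.End ℂ M} {w : M} (hw : IsSing A lam w) (h0 : w ≠ 0) {u : U n}
    (hu : A u w = 0) : u • hwv lam = 0 := by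
  let J : Submodule (U n) (U n) :=
    { carrier := {u | A u w = 0}
      add_mem' := fun {a b} ha hb => by
        change A (a + b) w = 0
        rw [map_add, LinearMap.add_apply, show A a w = 0 from ha, show A b w = 0 from hb, add_zero]
      zero_mem' := by change A 0 w = 0; simp
      smul_mem' := fun c a ha => by
        change A (c * a) w = 0
        rw [map_mul, Module.End.mul_apply, show A a w = 0 from ha, map_zero] }
  -- The annihilator of `w` contains no element congruent to 1 modulo the Verma ideal, so its image
  -- in the Verma module is proper.
  have h1 : J.map (vermaIdeal lam).mkQ ≠ ⊤ := by
    intro h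
    have : vermaVec lam ∈ J.map (vermaIdeal lam).mkQ := by rw [h]; trivial
    obtain ⟨x, hx, hx1⟩ := this
    have h2 : x - 1 ∈ vermaIdeal lam := (Submodule.Quotient.eq _).mp hx1
    have h3 := vermaIdeal_le_of_isSing hw h2
    rw [map_sub, LinearMap.sub_apply, show A x w = 0 from hx, map_one, zero_sub, neg_eq_zero] at h3
    exact h0 h3
  rw [smul_hwv]
  refine (Submodule.Quotient.mk_eq_zero _).mpr ?_
  exact (le_sSup h1 : _ ≤ maxSubmodule lam) (Submodule.mem_map_of_mem hu)

variable {lam} in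
theorem exists_smul_eq {x : L lam} (hx : x ≠ 0) (y : L lam) : ∃ u : U n, u • x = y := by
  obtain ⟨x, rfl⟩ := Submodule.Quotient.mk_surjective _ x
  let N : Submodule (U n) (Verma lam) := Submodule.span (U n) {x} ⊔ maxSubmodule lam
  have hN : N = ⊤ := by
    by_contra h
    apply hx
    refine (Submodule.Quotient.mk_eq_zero _).mpr ?_
    exact (le_sSup h : N ≤ maxSubmodule lam)
      ((le_sup_left : _ ≤ N) (Submodule.mem_span_singleton_self x))
  obtain ⟨y, rfl⟩ := Submodule.Quotient.mk_surjective _ y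
  have hy : y ∈ N := by rw [hN]; trivial
  obtain ⟨a, ha, b, hb, rfl⟩ := Submodule.mem_sup.mp hy
  obtain ⟨u, rfl⟩ := Submodule.mem_span_singleton.mp ha
  refine ⟨u, ?_⟩
  change Submodule.Quotient.mk (p := maxSubmodule lam) (u • x) = _
  rw [Submodule.Quotient.eq]
  simpa using hb

variable {lam} in
theorem isHW_of_isSing {κ : Weight n} {w : L lam} (hw : IsSing (repL lam) κ w) (h0 : w ≠ 0) :
    IsHW (repL lam) κ w := ⟨hw, exists_smul_eq h0⟩

variable {lam} in
-- The singular vector lies s ≥ 0 in height above the highest weight vector. It also generates the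
-- module, so the highest weight vector lies t ≥ 0 above it; hence s + t = 0.
theorem weight_eq_of_isSing {κ : Weight n} {w : L lam} (hw : IsSing (repL lam) κ w) (h0 : w ≠ 0) :
    κ = lam := by
  obtain ⟨s, hs⟩ := (isHW_hwv lam).exists_hgt hw.1 h0
  obtain ⟨l, hl, _, h1⟩ := (isHW_of_isSing hw h0).exists_word (isHW_hwv lam).sing.1 (hwv_ne_zero lam)
  obtain ⟨t, ht, ht'⟩ := hgt_word l hl
  have h2 := congrArg hgt h1
  rw [hgt_add, ht', hs] at h2
  have h3 : ((s + t : ℕ) : ℂ) = 0 := by push_cast; linear_combination -h2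
  have h4 : s + t = 0 := by exact_mod_cast h3
  have : l = [] := List.length_eq_zero_iff.mp (by omega)
  subst this
  simpa using h1.symm

end Simple

/-! ### Bounded multiplicities and subquotients -/

section Mult

variable {n : ℕ}

/-- All weight multiplicities are finite and at most `C`. -/
def Mult {M : Type*} [AddCommGroup M] [Module ℂ M] (A : U n →ₐ[ℂ] Module.End ℂ M) (C : ℕ) : Prop :=
  ∀ κ, FiniteDimensional ℂ (wt A κ) ∧ Module.finrank ℂ (wt A κ) ≤ C

/-- The element of the enveloping algebra given by a word. -/
noncomputable def wordU (l : List (Fin n × Fin n)) : U n :=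
  (l.map fun p => iota n (E p.1 p.2)).prod

theorem map_wordU {M : Type*} [AddCommGroup M] [Module ℂ M] (A : U n →ₐ[ℂ] Module.End ℂ M)
    (l : List (Fin n × Fin n)) (v : M) : A (wordU l) v = word A l v := by
  induction l with
  | nil => simp [wordU, word]
  | cons p l ih =>
    rw [wordU, List.map_cons, List.prod_cons, map_mul, Module.End.mul_apply]
    exact congrArg (op A p.1 p.2) ih

/-- The simple module is a quotient of the submodule generated by `w`: u w ↦ u · `hwv lam` is well
defined by `smul_hwv_eq_zero`. On weight κ this is the map `γ` from a subspace of `wt A κ`, and its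
range contains the weight space of the simple module. -/
theorem mult_repL_of_isSing {lam : Weight n} {M : Type*} [AddCommGroup M] [Module ℂ M]
    {A : U n →ₐ[ℂ] Module.End ℂ M} {w : M} (hw : IsSing A lam w) (h0 : w ≠ 0) {C : ℕ}
    (hC : Mult A C) : Mult (repL lam) C := by
  intro κ
  obtain ⟨hfd, hle⟩ := hC κ
  let ev : U n →ₗ[ℂ] M := (LinearMap.applyₗ w).comp A.toLinearMap
  let α : (wt A κ).comap ev →ₗ[ℂ] wt A κ := ev.restrict fun _ h => h
  let β : (wt A κ).comap ev →ₗ[ℂ] L lam :=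
    ((LinearMap.applyₗ (hwv lam)).comp (repL lam).toLinearMap).comp (Submodule.subtype _)
  have hker : LinearMap.ker α ≤ LinearMap.ker β := by
    intro u hu
    have h1 : A u.1 w = 0 := congrArg Subtype.val (LinearMap.mem_ker.mp hu)
    exact smul_hwv_eq_zero lam hw h0 h1
  let γ : LinearMap.range α →ₗ[ℂ] L lam :=
    ((LinearMap.ker α).liftQ β hker).comp α.quotKerEquivRange.symm.toLinearMap
  have hγ : wt (repL lam) κ ≤ LinearMap.range γ := by
    intro x hx
    refine Submodule.span_le.mpr ?_ ((isHW_hwv lam).mem_span_words_wt hx)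
    rintro _ ⟨⟨l, hl, rfl⟩, hs⟩
    by_cases hz : word (repL lam) l (hwv lam) = 0
    · rw [hz]; exact zero_mem _
    have e := wt_unique _ hz hs (word_mem_wt (isHW_hwv lam).sing.1 l)
    have hmem : ev (wordU l) ∈ wt A κ := by
      have : ev (wordU l) = word A l w := map_wordU A l w
      rw [this, e]
      exact word_mem_wt hw.1 l
    refine ⟨α.quotKerEquivRange (Submodule.Quotient.mk ⟨wordU l, hmem⟩), ?_⟩
    simp only [γ, LinearMap.comp_apply, LinearEquiv.coe_coe, LinearEquiv.symm_apply_apply]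
    exact map_wordU (repL lam) l (hwv lam)
  refine ⟨Submodule.finiteDimensional_of_le hγ, ?_⟩
  calc Module.finrank ℂ (wt (repL lam) κ) ≤ Module.finrank ℂ (LinearMap.range γ) :=
        Submodule.finrank_mono hγ
    _ ≤ Module.finrank ℂ (LinearMap.range α) := LinearMap.finrank_range_le γ
    _ ≤ Module.finrank ℂ (wt A κ) := Submodule.finrank_le _
    _ ≤ C := hle

theorem wtSpace_eq (lam μ : Weight n) : wtSpace (L lam) μ = wt (repL lam) μ := by
  ext m
  rw [mem_wt]
  constructor
  · intro h i
    have := h (Pi.single i 1)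
    rw [Matrix.diagonal_single] at this
    rw [op_repL, E, this]
    simp [Pi.single_apply]
  · intro h d
    rw [diagonal_eq, sum_lie, Finset.sum_smul]
    refine Finset.sum_congr rfl fun i _ => ?_
    have h1 : ⁅(E i i : gl n), m⁆ = μ i • m := h i
    rw [smul_lie, h1, smul_smul, mul_comm]

theorem isWeightModule_L (lam : Weight n) : IsWeightModule (n := n) (L lam) := by
  have h : (fun μ => wtSpace (L lam) μ) = wt (repL lam) := funext fun μ => wtSpace_eq lam μ
  refine ⟨?_, fun μ => ?_⟩
  · rw [h]
    exact DirectSum.isInternal_submodule_of_iSupIndep_of_iSup_eq_top (iSupIndep_wt _)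
      (isHW_hwv lam).iSup_wt
  · rw [wtSpace_eq]
    exact (isHW_hwv lam).finiteDimensional_wt μ

theorem isBoundedWeight_iff (lam : Weight n) : IsBoundedWeight lam ↔ ∃ C, Mult (repL lam) C := by
  constructor
  · rintro ⟨_, C, hC⟩
    refine ⟨C, fun κ => ⟨(isHW_hwv lam).finiteDimensional_wt κ, ?_⟩⟩
    rw [← wtSpace_eq]
    exact (hC κ).le
  · rintro ⟨C, hC⟩
    refine ⟨isWeightModule_L lam, C + 1, fun μ => ?_⟩
    rw [wtSpace_eq]
    exact Nat.lt_succ_of_le (hC μ).2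

end Mult

/-! ### Local nilpotency of the adjoint action and its consequences -/

section Ad

variable {n : ℕ}

/-- The commutator with `f`. -/
noncomputable def adU (f : U n) : Module.End ℂ (U n) :=
  LinearMap.mulLeft ℂ f - LinearMap.mulRight ℂ f

theorem adU_apply (f x : U n) : adU f x = f * x - x * f := rfl

theorem adU_mul (f x y : U n) : adU f (x * y) = adU f x * y + x * adU f y := by
  simp only [adU_apply]; noncomm_ring

/-- The Leibniz rule: a commutator falls on one factor or the other and uses up one of its
exponents. -/
theorem adU_pow_mul_eq_zero (f : U n) (N : ℕ) : ∀ a b x y, a + b ≤ N →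
    (adU f ^ a) x = 0 → (adU f ^ b) y = 0 → (adU f ^ N) (x * y) = 0 := by
  induction N with
  | zero =>
    intro a b x y h hx _
    obtain rfl : a = 0 := by omega
    have : x = 0 := by simpa using hx
    simp [this]
  | succ N ih =>
    intro a b x y h hx hy
    rcases a with _ | a
    · have : x = 0 := by simpa using hx
      simp [this]
    rcases b with _ | b
    · have : y = 0 := by simpa using hy
      simp [this]
    rw [pow_succ, Module.End.mul_apply, adU_mul, map_add,
      ih a (b + 1) _ _ (by omega) (by rwa [pow_succ, Module.End.mul_apply] at hx) hy,
      ih (a + 1) b _ _ (by omega) hx (by rwa [pow_succ, Module.End.mul_apply] at hy), add_zero]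

theorem adU_iota (i j k l : Fin n) : adU (iota n (E i j)) (iota n (E k l)) =
    (if j = k then iota n (E i l) else 0) - (if l = i then iota n (E k j) else 0) := by
  rw [adU_apply, iota_comm, add_sub_cancel_left]

theorem exists_adU_pow_eq_zero {i j : Fin n} (hij : i ≠ j) (u : U n) :
    ∃ J, (adU (iota n (E i j)) ^ J) u = 0 := by
  induction u using U_induction with
  | hc c => exact ⟨1, by rw [pow_one, adU_apply, Algebra.commutes, sub_self]⟩
  | hι k l =>
    -- On gl_n itself ad E_ij has cube zero; the extreme case is E_ji ↦ E_ii − E_jj ↦ −2 E_ij ↦ 0.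
    refine ⟨3, ?_⟩
    have h0 : adU (iota n (E i j)) (iota n (E i j)) = 0 := by rw [adU_apply, sub_self]
    have h2 : adU (iota n (E i j)) (iota n (E i i)) = - iota n (E i j) := by
      rw [adU_iota]; simp [hij.symm]
    have h3 : adU (iota n (E i j)) (iota n (E j j)) = iota n (E i j) := by
      rw [adU_iota]; simp [hij.symm]
    simp only [pow_succ, pow_zero, one_mul, Module.End.mul_apply]
    rw [adU_iota i j k l]
    by_cases h1 : j = k <;> by_cases h4 : l = i
    · subst h1; subst h4
      rw [if_pos rfl, if_pos rfl, map_sub, h2, h3, map_sub, map_neg, h0]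
      simp
    · subst h1
      simp only [if_true, h4, if_false, sub_zero]
      rw [adU_iota]
      simp [h4, hij.symm]
    · subst h4
      simp only [if_true, h1, if_false, zero_sub, map_neg]
      rw [adU_iota]
      simp [h1, hij.symm]
    · simp [h1, h4]
  | hadd a b ha hb =>
    obtain ⟨J, hJ⟩ := ha
    obtain ⟨K, hK⟩ := hb
    refine ⟨J + K, ?_⟩
    rw [map_add]
    nth_rewrite 1 [add_comm J K]
    rw [pow_add, pow_add, Module.End.mul_apply, Module.End.mul_apply, hJ, hK, map_zero, map_zero,
      add_zero]
  | hmul a b ha hb =>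
    obtain ⟨J, hJ⟩ := ha
    obtain ⟨K, hK⟩ := hb
    exact ⟨J + K, adU_pow_mul_eq_zero _ _ J K a b le_rfl hJ hK⟩

/-- The Ore condition: from f u = u f + [f, u], where [f, u] has smaller nilpotency order under ad
f, a surplus of J left factors pays for moving f^t to the right. -/
theorem exists_pow_mul_eq (f : U n) (J : ℕ) : ∀ u, (adU f ^ J) u = 0 →
    ∀ t, ∃ u', f ^ (J + t) * u = u' * f ^ t := by
  induction J with
  | zero =>
    intro u hu t
    have : u = 0 := by simpa using hu
    exact ⟨0, by simp [this]⟩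
  | succ J ih =>
    intro u hu t
    rw [pow_succ, Module.End.mul_apply] at hu
    induction t with
    | zero => exact ⟨f ^ (J + 1) * u, by simp⟩
    | succ t iht =>
      obtain ⟨u1, h1⟩ := iht
      obtain ⟨u2, h2⟩ := ih _ hu (t + 1)
      refine ⟨u1 + u2, ?_⟩
      have e : f ^ (J + 1 + (t + 1)) * u =
          f ^ (J + 1 + t) * u * f + f ^ (J + (t + 1)) * adU f u := by
        rw [adU_apply, show J + 1 + (t + 1) = (J + 1 + t) + 1 by ring,
          show J + (t + 1) = J + 1 + t by ring, pow_succ]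
        noncomm_ring
      rw [e, h1, h2, add_mul, mul_assoc, ← pow_succ]

/-- The cancellation condition for an Ore set, proved without using that the algebra is a domain. By
induction some f^N kills [f, x], so further powers of f pass through x to the right until f^k
appears there. -/
theorem exists_pow_mul_eq_zero (f : U n) (J : ℕ) : ∀ x, (adU f ^ J) x = 0 →
    ∀ k, x * f ^ k = 0 → ∃ N, f ^ N * x = 0 := by
  induction J with
  | zero =>
    intro x hx k _
    have : x = 0 := by simpa using hx
    exact ⟨0, by simp [this]⟩
  | succ J ih =>
    intro x hx k hk
    rw [pow_succ, Module.End.mul_apply] at hx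
    obtain ⟨N, hN⟩ := ih _ hx k (by
      rw [adU_apply, sub_mul, mul_assoc, hk, mul_assoc, ← pow_succ', pow_succ, ← mul_assoc, hk]
      simp)
    have h1 : f ^ N * f * x = f ^ N * x * f := by
      rw [adU_apply, mul_sub, sub_eq_zero] at hN
      rw [mul_assoc, hN, mul_assoc]
    have h2 : ∀ j, f ^ (N + j) * x = f ^ N * x * f ^ j := by
      intro j
      induction j with
      | zero => simp
      | succ j ihj =>
        rw [← add_assoc, pow_succ', mul_assoc, ihj, pow_succ', ← mul_assoc, ← mul_assoc,
          ← mul_assoc, ← pow_succ', pow_succ, h1]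
    exact ⟨N + k, by rw [h2, mul_assoc, hk, mul_zero]⟩

end Ad

/-! ### Computations with sl_2-strings -/

section Sl2

variable {n : ℕ} {M : Type*} [AddCommGroup M] [Module ℂ M] (A : U n →ₐ[ℂ] Module.End ℂ M)

theorem op_pow_mem_wt (i j : Fin n) (t : ℕ) {μ : Weight n} {m : M} (hm : m ∈ wt A μ) :
    (op A i j ^ t) m ∈ wt A (μ + (t : ℂ) • root i j) := by
  induction t with
  | zero => simpa using hm
  | succ t ih =>
    rw [pow_succ', Module.End.mul_apply]
    have := op_mem_wt A i j ih
    rw [add_assoc] at this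
    convert this using 3
    rw [Nat.cast_succ, add_smul, one_smul]

theorem op_op_pow {i j : Fin n} (hij : i ≠ j) {ν : Weight n} {w : M} (hw : w ∈ wt A ν) (t : ℕ) :
    op A i j ((op A j i ^ (t + 1)) w) = (op A j i ^ (t + 1)) (op A i j w) +
      ((t + 1 : ℂ) * (ν i - ν j - t)) • (op A j i ^ t) w := by
  have hh : ∀ s : ℕ, op A i j ((op A j i ^ (s + 1)) w) = op A j i (op A i j ((op A j i ^ s) w)) +
      (ν i - ν j - 2 * s) • (op A j i ^ s) w := by
    intro s
    have h1 := op_pow_mem_wt A j i s hw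
    rw [mem_wt] at h1
    rw [pow_succ', Module.End.mul_apply, op_op, if_pos rfl, if_pos rfl, h1 i, h1 j, ← sub_smul]
    congr 2
    simp only [Pi.add_apply, Pi.smul_apply, root_apply, smul_eq_mul, hij, hij.symm, if_true,
      if_false]
    ring
  induction t with
  | zero => rw [hh 0]; simp
  | succ t ih =>
    rw [hh (t + 1), ih, map_add, map_smul, add_assoc]
    rw [← Module.End.mul_apply, ← Module.End.mul_apply (op A j i), ← pow_succ', ← pow_succ',
      ← add_smul]
    congr 2
    push_cast
    ring

theorem exists_pow_ne_zero_of_nilpotent {f : Module.End ℂ M} {w : M} (h0 : w ≠ 0) {N : ℕ}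
    (hN : (f ^ N) w = 0) : ∃ K, (∀ t ≤ K, (f ^ t) w ≠ 0) ∧ (f ^ (K + 1)) w = 0 := by
  classical
  have hex : ∃ N, (f ^ N) w = 0 := ⟨N, hN⟩
  obtain ⟨K, hK⟩ : ∃ K, Nat.find hex = K + 1 := by
    refine Nat.exists_eq_succ_of_ne_zero fun h => ?_
    have := Nat.find_spec hex
    rw [h] at this
    exact h0 (by simpa using this)
  refine ⟨K, fun t ht => Nat.find_min hex (by omega), ?_⟩
  rw [← hK]
  exact Nat.find_spec hex

theorem exists_nat_of_nilpotent {i j : Fin n} (hij : i ≠ j) {ν : Weight n} {w : M}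
    (hw : w ∈ wt A ν) (h0 : w ≠ 0) (he : op A i j w = 0) {N : ℕ} (hN : (op A j i ^ N) w = 0) :
    ∃ m : ℕ, ν i - ν j = m ∧ ∀ t ≤ m, (op A j i ^ t) w ≠ 0 := by
  obtain ⟨K, h1, h2⟩ := exists_pow_ne_zero_of_nilpotent h0 hN
  refine ⟨K, ?_, h1⟩
  have h3 := op_op_pow A hij hw K
  rw [h2, he, map_zero, map_zero, zero_add] at h3
  rcases smul_eq_zero.mp h3.symm with h | h
  · rcases mul_eq_zero.mp h with h | h
    · exact absurd h (by exact_mod_cast Nat.succ_ne_zero K)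
    · exact sub_eq_zero.mp h
  · exact absurd h (h1 K le_rfl)

/-- Raise `w` to the end of its string in `a` steps; the primitive vector found there has weight
`m`, and lowering it `m - a` times reaches the reflected weight. The condition `a ≤ m` says that
this number of steps is not negative. -/
theorem exists_reflected_aux {i j : Fin n} (hij : i ≠ j) {ν : Weight n} {w : M}
    (hw : w ∈ wt A ν) (h0 : w ≠ 0) (he : ∀ m, ∃ N, (op A i j ^ N) m = 0)
    (hf : ∀ m, ∃ N, (op A j i ^ N) m = 0) : ∃ a m : ℕ, ν i - ν j = m - 2 * a ∧
      (a ≤ m → ∃ w' ≠ 0, w' ∈ wt A (ν - (ν i - ν j) • root i j)) := by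
  obtain ⟨N, hN⟩ := he w
  obtain ⟨a, h1, h2⟩ := exists_pow_ne_zero_of_nilpotent h0 hN
  obtain ⟨N', hN'⟩ := hf ((op A i j ^ a) w)
  have hwa := op_pow_mem_wt A i j a hw
  obtain ⟨m, hm, hne⟩ := exists_nat_of_nilpotent A hij hwa (h1 a le_rfl)
    (by rw [← Module.End.mul_apply, ← pow_succ', h2]) hN'
  have hc : ν i - ν j = m - 2 * a := by
    rw [← hm]
    simp [root_apply, hij, hij.symm]
    ring
  refine ⟨a, m, hc, fun ham => ⟨_, hne (m - a) (by omega), ?_⟩⟩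
  have := op_pow_mem_wt A j i (m - a) hwa
  convert this using 2
  rw [hc, Nat.cast_sub ham]
  funext k
  simp only [Pi.sub_apply, Pi.add_apply, Pi.smul_apply, root_apply, smul_eq_mul]
  ring

/-- If both root vectors of a root act locally nilpotently, then the set of weights is stable under
the corresponding reflection. -/
theorem exists_reflected {i j : Fin n} (hij : i ≠ j) {ν : Weight n} {w : M}
    (hw : w ∈ wt A ν) (h0 : w ≠ 0) (he : ∀ m, ∃ N, (op A i j ^ N) m = 0)
    (hf : ∀ m, ∃ N, (op A j i ^ N) m = 0) :
    ∃ w' ≠ 0, w' ∈ wt A (ν - (ν i - ν j) • root i j) := by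
  obtain ⟨a, m, h1, h2⟩ := exists_reflected_aux A hij hw h0 he hf
  obtain ⟨b, k, h3, h4⟩ := exists_reflected_aux A hij.symm hw h0 hf he
  by_cases ha : a ≤ m
  · exact h2 ha
  -- Exchanging the two root vectors gives `b` and `k` with m + k = 2a + 2b, so a > m and b > k
  -- cannot both hold.
  · obtain ⟨w', hne, hw'⟩ := h4 (by
      have : ((m + k : ℕ) : ℂ) = ((2 * a + 2 * b : ℕ) : ℂ) := by
        push_cast; linear_combination -h1 - h3
      have : m + k = 2 * a + 2 * b := by exact_mod_cast this
      omega)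
    refine ⟨w', hne, ?_⟩
    convert hw' using 2
    funext k
    simp only [Pi.sub_apply, Pi.smul_apply, root_apply, smul_eq_mul]
    ring

theorem mul_pow_heis {R : Type*} [Ring R] {x y z : R} (h : y * x = x * y - z) (hz : z * x = x * z)
    (K : ℕ) : y * x ^ (K + 1) = x ^ (K + 1) * y - (K + 1 : ℕ) • (x ^ K * z) := by
  have hzK : ∀ K, z * x ^ K = x ^ K * z := fun K => (Commute.pow_right (show Commute z x from hz) K)
  induction K with
  | zero => simp [h]
  | succ K ih =>
    rw [pow_succ', ← mul_assoc, h, sub_mul, mul_assoc, ih, hzK, mul_sub, mul_smul_comm,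
      ← mul_assoc, ← mul_assoc, ← pow_succ', ← pow_succ', succ_nsmul _ (K + 1)]
    abel

/-- Every positive root vector is an iterated commutator of simple ones. -/
theorem sing_of_simple {v : M} {μ : Weight n} (hv : v ∈ wt A μ)
    (h : ∀ k : Fin (n - 1), op A (lo k) (hi k) v = 0) : IsSing A μ v := by
  refine ⟨hv, ?_⟩
  have : ∀ d : ℕ, ∀ i j : Fin n, i.val + d + 1 = j.val → op A i j v = 0 := by
    intro d
    induction d with
    | zero =>
      intro i j hij
      have h1 : j = hi ⟨i.val, by omega⟩ := Fin.ext (by simp [hi]; omega)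
      rw [h1]
      exact h ⟨i.val, by omega⟩
    | succ d ih =>
      intro i j hij
      have h1 := ih i ⟨i.val + d + 1, by omega⟩ rfl
      have h2 := h ⟨i.val + d + 1, by omega⟩
      have e1 : (lo ⟨i.val + d + 1, by omega⟩ : Fin n) = ⟨i.val + d + 1, by omega⟩ := rfl
      have e2 : (hi ⟨i.val + d + 1, by omega⟩ : Fin n) = j := Fin.ext (by simp [hi]; omega)
      rw [e1, e2] at h2
      have h3 := op_op A i ⟨i.val + d + 1, by omega⟩ ⟨i.val + d + 1, by omega⟩ j v
      rw [h1, h2, map_zero, map_zero, if_pos rfl, if_neg (by intro h; subst h; omega)] at h3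
      simpa using h3.symm
  intro i j hij
  have hij' : i.val < j.val := hij
  exact this (j.val - i.val - 1) i j (by omega)

end Sl2

/-! ### Locally nilpotent and injective root vectors on simple modules -/

section FinInj

variable {n : ℕ} {lam : Weight n}

/-- `E_{ij}` acts locally nilpotently on the simple module of highest weight `lam`. -/
def ActsFin (lam : Weight n) (i j : Fin n) : Prop :=
  ∀ m : L lam, ∃ N : ℕ, (op (repL lam) i j ^ N) m = 0

/-- Any nonzero `m` generates, and the Ore relation f^(J+N) u = u' f^N moves the killing power onto
`m`. Thus a root vector that is not locally nilpotent is injective. -/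
theorem actsFin_of_pow {i j : Fin n} (hij : i ≠ j) {m : L lam} (hm : m ≠ 0) {N : ℕ}
    (hN : (op (repL lam) i j ^ N) m = 0) : ActsFin lam i j := by
  intro y
  obtain ⟨u, rfl⟩ := exists_smul_eq hm y
  obtain ⟨J, hJ⟩ := exists_adU_pow_eq_zero hij u
  obtain ⟨u', hu'⟩ := exists_pow_mul_eq _ J u hJ N
  refine ⟨J + N, ?_⟩
  have h1 := congrArg (repL lam) hu'
  rw [map_mul, map_mul, map_pow, map_pow] at h1
  have h2 := LinearMap.congr_fun h1 m
  rw [Module.End.mul_apply, Module.End.mul_apply] at h2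
  exact h2.trans ((congrArg (repL lam u') hN).trans (map_zero _))

theorem actsFin_of_eq_zero {i j : Fin n} (hij : i ≠ j) {m : L lam} (hm : m ≠ 0)
    (h : op (repL lam) i j m = 0) : ActsFin lam i j :=
  actsFin_of_pow hij hm (N := 1) (by simpa using h)

theorem actsFin_of_lt {i j : Fin n} (hij : i < j) : ActsFin lam i j :=
  actsFin_of_eq_zero hij.ne (hwv_ne_zero lam) ((isHW_hwv lam).sing.2 i j hij)

/-- Let x = E_ij, y = E_jk, z = E_ik, so that y x = x y − z and z commutes with x. Take w ≠ 0 with y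
w = 0 and the last nonzero x^K w. Applying y to x^(K+1) w = 0 leaves (K+1) x^K z w = 0, so z kills
the nonzero vector x^K w. -/
theorem ActsFin.add {i j k : Fin n} (hij : i ≠ j) (hik : i ≠ k)
    (h1 : ActsFin lam i j) (h2 : ActsFin lam j k) : ActsFin lam i k := by
  obtain ⟨N, hN⟩ := h2 (hwv lam)
  obtain ⟨b, hb1, hb2⟩ := exists_pow_ne_zero_of_nilpotent (hwv_ne_zero lam) hN
  set w := (op (repL lam) j k ^ b) (hwv lam) with hw
  have hyw : op (repL lam) j k w = 0 := by
    rw [hw, ← Module.End.mul_apply, ← pow_succ', hb2]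
  obtain ⟨N', hN'⟩ := h1 w
  obtain ⟨K, hK1, hK2⟩ := exists_pow_ne_zero_of_nilpotent (hb1 b le_rfl) hN'
  refine actsFin_of_eq_zero hik (hK1 K le_rfl) ?_
  have e1 : op (repL lam) j k * op (repL lam) i j =
      op (repL lam) i j * op (repL lam) j k - op (repL lam) i k := by
    rw [op_mul_op (repL lam) i j j k]; simp [hik.symm]
  have e2 : op (repL lam) i k * op (repL lam) i j = op (repL lam) i j * op (repL lam) i k := by
    rw [op_mul_op (repL lam) i k i j]; simp [hik.symm, hij.symm]
  have h3 := LinearMap.congr_fun (mul_pow_heis e1 e2 K) w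
  rw [Module.End.mul_apply, hK2, map_zero, LinearMap.sub_apply, Module.End.mul_apply, hyw,
    map_zero, zero_sub, LinearMap.smul_apply, eq_comm, neg_eq_zero] at h3
  have h4 : (op (repL lam) i j ^ K * op (repL lam) i k) w = 0 := by
    rw [← Nat.cast_smul_eq_nsmul ℂ] at h3
    exact (smul_eq_zero.mp h3).resolve_left (by exact_mod_cast Nat.succ_ne_zero K)
  have e3 : op (repL lam) i k * op (repL lam) i j ^ K = op (repL lam) i j ^ K * op (repL lam) i k :=
    Commute.pow_right (show Commute _ _ from e2) K
  rw [← e3] at h4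
  exact h4

theorem commute_simple {M : Type*} [AddCommGroup M] [Module ℂ M] (A : U n →ₐ[ℂ] Module.End ℂ M)
    {k l : Fin (n - 1)} (h : l ≠ k) : Commute (op A (lo l) (hi l)) (op A (hi k) (lo k)) := by
  have h1 : l.val ≠ k.val := fun h' => h (Fin.ext h')
  rw [Commute, SemiconjBy, op_mul_op, if_neg, if_neg]
  · simp
  · intro h'; exact h1 (by simpa [lo] using (congrArg Fin.val h').symm)
  · intro h'; exact h1 (by simpa [hi] using congrArg Fin.val h')

theorem lo_ne_hi (k : Fin (n - 1)) : (lo k : Fin n) ≠ hi k := by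
  intro h; simpa [lo, hi] using congrArg Fin.val h

/-- Conversely, if the difference is m, then f^(m+1) applied to the highest weight vector is killed
by all simple root vectors. Being singular of a weight other than `lam`, it is zero. -/
theorem actsFin_simple_iff (k : Fin (n - 1)) :
    ActsFin lam (hi k) (lo k) ↔ ∃ m : ℕ, lam (lo k) - lam (hi k) = m := by
  have hs := (isHW_hwv lam).sing
  constructor
  · intro h
    obtain ⟨N, hN⟩ := h (hwv lam)
    obtain ⟨m, hm, _⟩ := exists_nat_of_nilpotent _ (lo_ne_hi k) hs.1 (hwv_ne_zero lam)
      (hs.2 _ _ (by simp [lo, hi])) hN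
    exact ⟨m, hm⟩
  · rintro ⟨m, hm⟩
    refine actsFin_of_pow (lo_ne_hi k).symm (hwv_ne_zero lam) (N := m + 1) ?_
    by_contra hne
    have hwt := op_pow_mem_wt (repL lam) (hi k) (lo k) (m + 1) hs.1
    have hsing : IsSing (repL lam) _ _ := sing_of_simple (repL lam) hwt fun l => by
      by_cases hl : l = k
      · subst hl
        rw [op_op_pow _ (lo_ne_hi l) hs.1, hs.2 _ _ (by simp [lo, hi]), hm]
        simp
      · rw [← Module.End.mul_apply, ((commute_simple (repL lam) hl).pow_right (m + 1)).eq,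
          Module.End.mul_apply, hs.2 _ _ (by simp [lo, hi]), map_zero]
    have h1 := congrFun (weight_eq_of_isSing hsing hne) (lo k)
    simp [root_apply, lo_ne_hi k] at h1
    have h2 : ((m + 1 : ℕ) : ℂ) = 0 := by push_cast; linear_combination -h1
    exact absurd h2 (by exact_mod_cast Nat.succ_ne_zero m)

theorem actsFin_of_forall_simple {p q : Fin n} (hpq : p < q)
    (h : ∀ k : Fin (n - 1), p ≤ lo k → hi k ≤ q → ActsFin lam (hi k) (lo k)) :
    ActsFin lam q p := by
  have : ∀ d : ℕ, ∀ r : Fin n, r.val = p.val + d + 1 → r ≤ q → ActsFin lam r p := by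
    intro d
    induction d with
    | zero =>
      intro r hr hrq
      have := h ⟨p.val, by omega⟩ le_rfl (by rw [Fin.le_def] at *; simp [hi]; omega)
      have e : r = hi ⟨p.val, by omega⟩ := Fin.ext hr
      rw [e]
      exact this
    | succ d ih =>
      intro r hr hrq
      have h1 := ih ⟨p.val + d + 1, by omega⟩ rfl (by rw [Fin.le_def] at *; simp; omega)
      have h2 := h ⟨p.val + d + 1, by omega⟩ (by rw [Fin.le_def]; simp [lo]; omega)
        (by rw [Fin.le_def] at *; simp [hi]; omega)
      have e1 : (lo ⟨p.val + d + 1, by omega⟩ : Fin n) = ⟨p.val + d + 1, by omega⟩ := rfl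
      have e2 : (hi ⟨p.val + d + 1, by omega⟩ : Fin n) = r := Fin.ext (by simp [hi]; omega)
      rw [e1, e2] at h2
      refine h2.add ?_ ?_ h1 <;>
      · intro h'
        have := congrArg Fin.val h'
        try dsimp only at this
        omega
  have hpq' : p.val < q.val := hpq
  exact this (q.val - p.val - 1) q (by omega) le_rfl

/-- Positive roots are always locally nilpotent, so adding them strips both ends of a negative root:
(hi k, q) + (q, p) + (p, lo k) gives (hi k, lo k). -/
theorem ActsFin.simple_of_le {p q : Fin n} {k : Fin (n - 1)} (h1 : p ≤ lo k) (h2 : hi k ≤ q)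
    (h : ActsFin lam q p) : ActsFin lam (hi k) (lo k) := by
  rw [Fin.le_def] at h1 h2
  simp only [lo, hi] at h1 h2
  have h3 : ActsFin lam (hi k) p := by
    rcases eq_or_ne (hi k) q with e | e
    · rwa [e]
    · have hlt : hi k < q := by
        rw [Fin.lt_def]; have : (hi k).val ≠ q.val := fun h => e (Fin.ext h)
        simp only [hi] at *; omega
      refine (actsFin_of_lt hlt).add e ?_ h
      rintro rfl; simp only [hi] at *; omega
  rcases eq_or_ne p (lo k) with e | e
  · rwa [e] at h3
  · have hlt : p < lo k := by
      rw [Fin.lt_def]; have : p.val ≠ (lo k).val := fun h => e (Fin.ext h)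
      simp only [lo] at *; omega
    refine h3.add ?_ (lo_ne_hi k).symm (actsFin_of_lt hlt)
    rintro rfl; simp only [hi] at *; omega

theorem op_injective_of_not_actsFin {i j : Fin n} (hij : i ≠ j) (h : ¬ ActsFin lam i j) (m : L lam)
    (hm : op (repL lam) i j m = 0) : m = 0 := by
  by_contra h0
  exact h (actsFin_of_eq_zero hij h0 hm)

end FinInj

/-! ### Finite-dimensional simple modules -/

section FiniteDim

variable {n : ℕ} {lam : Weight n}

theorem sum_root (i j : Fin n) : ∑ k, root i j k = 0 := by
  simp [root_apply, Finset.sum_sub_distrib]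

theorem sum_word (l : List (Fin n × Fin n)) :
    ∑ k, (l.map fun p => (root p.1 p.2 : Weight n)).sum k = 0 := by
  induction l with
  | nil => simp
  | cons p l ih => simp [Finset.sum_add_distrib, sum_root, ih]

theorem word_zero_apply (h0 : 0 < n) (l : List (Fin n × Fin n)) (hl : IsLowering l) :
    ∃ g : ℕ, (l.map fun p => (root p.1 p.2 : Weight n)).sum ⟨0, h0⟩ = -g := by
  induction l with
  | nil => exact ⟨0, by simp⟩
  | cons p l ih =>
    obtain ⟨g, hg⟩ := ih fun q hq => hl q (List.mem_cons_of_mem _ hq)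
    have hp : p.2.val < p.1.val := hl p List.mem_cons_self
    have h1 : (⟨0, h0⟩ : Fin n) ≠ p.1 := fun h => by rw [← h] at hp; simp at hp
    rw [List.map_cons, List.sum_cons, Pi.add_apply, hg, root_apply, if_neg h1]
    by_cases h2 : (⟨0, h0⟩ : Fin n) = p.2
    · exact ⟨g + 1, by rw [if_pos h2]; push_cast; ring⟩
    · exact ⟨g, by rw [if_neg h2]; ring⟩

/-- Lowering words can only decrease the first coordinate of a weight. The set of weights is stable
under reflections, so every coordinate is `lam z` minus a natural number. The coordinate sum is
fixed, hence these numbers have the fixed sum `K`, and only finitely many weights occur. -/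
theorem finiteDimensional_of_actsFin (h0 : 0 < n)
    (h : ∀ k : Fin (n - 1), ActsFin lam (hi k) (lo k)) : FiniteDimensional ℂ (L lam) := by
  have hall : ∀ i j : Fin n, i ≠ j → ActsFin lam i j := by
    intro i j hij
    rcases lt_or_gt_of_ne hij with h1 | h1
    · exact actsFin_of_lt h1
    · exact actsFin_of_forall_simple h1 fun k _ _ => h k
  have hHW := isHW_hwv lam
  set z : Fin n := ⟨0, h0⟩ with hz
  have hfirst : ∀ ν : Weight n, ∀ w ∈ wt (repL lam) ν, w ≠ 0 → ∃ g : ℕ, ν z = lam z - g := by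
    intro ν w hw hne
    obtain ⟨l, hl, _, rfl⟩ := hHW.exists_word hw hne
    obtain ⟨g, hg⟩ := word_zero_apply h0 l hl
    exact ⟨g, by rw [Pi.add_apply, hg, sub_eq_add_neg]⟩
  have hcoord : ∀ ν : Weight n, ∀ w ∈ wt (repL lam) ν, w ≠ 0 → ∀ i, ∃ g : ℕ, ν i = lam z - g := by
    intro ν w hw hne i
    rcases eq_or_ne z i with rfl | hi
    · exact hfirst ν w hw hne
    · obtain ⟨w', hne', hw'⟩ := exists_reflected _ hi hw hne (hall _ _ hi) (hall _ _ hi.symm)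
      obtain ⟨g, hg⟩ := hfirst _ w' hw' hne'
      refine ⟨g, ?_⟩
      rw [← hg]
      simp [root_apply, hi]
  have hsum : ∀ ν : Weight n, ∀ w ∈ wt (repL lam) ν, w ≠ 0 → ∑ i, ν i = ∑ i, lam i := by
    intro ν w hw hne
    obtain ⟨l, hl, _, rfl⟩ := hHW.exists_word hw hne
    simp only [Pi.add_apply, Finset.sum_add_distrib]
    rw [sum_word, add_zero]
  obtain ⟨K, hK⟩ : ∃ K : ℕ, ∑ i, (lam z - lam i) = K := by
    choose g hg using hcoord lam _ hHW.sing.1 (hwv_ne_zero lam)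
    refine ⟨∑ i, g i, ?_⟩
    push_cast
    refine Finset.sum_congr rfl fun i _ => ?_
    rw [hg i]; ring
  set S : Set (Weight n) := {ν | wt (repL lam) ν ≠ ⊥} with hS
  have hSfin : S.Finite := by
    refine ((Set.Finite.pi' (fun _ : Fin n => Set.finite_Iic K)).image
      (fun g : Fin n → ℕ => fun i => lam z - g i)).subset ?_
    intro ν hν
    obtain ⟨w, hw, hne⟩ := Submodule.exists_mem_ne_zero_of_ne_bot hν
    choose g hg using hcoord ν w hw hne
    refine ⟨g, fun i => ?_, funext fun i => (hg i).symm⟩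
    have h1 : ∑ i, g i = K := by
      have : ((∑ i, g i : ℕ) : ℂ) = K := by
        rw [← hK, Finset.sum_sub_distrib, ← hsum ν w hw hne, ← Finset.sum_sub_distrib]
        push_cast
        refine Finset.sum_congr rfl fun i _ => ?_
        rw [hg i]; ring
      exact_mod_cast this
    exact h1 ▸ Finset.single_le_sum (fun _ _ => Nat.zero_le _) (Finset.mem_univ i)
  have htop : (⊤ : Submodule ℂ (L lam)) = hSfin.toFinset.sup (wt (repL lam)) := by
    rw [eq_comm, eq_top_iff, ← hHW.iSup_wt]
    refine iSup_le fun ν => ?_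
    by_cases hν : ν ∈ S
    · exact Finset.le_sup (f := wt (repL lam)) (hSfin.mem_toFinset.mpr hν)
    · rw [not_not.mp hν]; exact bot_le
  have hfd := hHW.finiteDimensional_wt
  have : FiniteDimensional ℂ (⊤ : Submodule ℂ (L lam)) := by
    rw [htop]
    exact Submodule.finiteDimensional_finset_sup _ _
  exact Module.finite_def.mpr (Module.Finite.iff_fg.mp this)

/-- Powers of an injective root vector would give E_ii infinitely many eigenvalues. -/
theorem actsFin_of_finiteDimensional [FiniteDimensional ℂ (L lam)] {i j : Fin n} (hij : i ≠ j) :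
    ActsFin lam i j := by
  by_contra hcon
  have hs := (isHW_hwv lam).sing
  have hinj := op_injective_of_not_actsFin hij hcon
  have hne : ∀ t : ℕ, (op (repL lam) i j ^ t) (hwv lam) ≠ 0 := by
    intro t
    induction t with
    | zero => simpa using hwv_ne_zero lam
    | succ t ih =>
      rw [pow_succ', Module.End.mul_apply]
      exact fun h => ih (hinj _ h)
  have hev : ∀ t : ℕ, Module.End.HasEigenvalue (op (repL lam) i i) (lam i + t) := by
    intro t
    refine Module.End.hasEigenvalue_of_hasEigenvector (x := (op (repL lam) i j ^ t) (hwv lam))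
      ⟨Module.End.mem_eigenspace_iff.mpr ?_, hne t⟩
    have := (mem_wt _).mp (op_pow_mem_wt (repL lam) i j t hs.1) i
    rw [this]
    simp [root_apply, hij]
  have hfin := Module.End.finite_hasEigenvalue (op (repL lam) i i)
  have hinf : (Set.range fun t : ℕ => lam i + (t : ℂ)).Infinite :=
    Set.infinite_range_of_injective fun a b hab => by simpa using hab
  exact hinf (hfin.subset (by rintro _ ⟨t, rfl⟩; exact hev t))

theorem finiteDimensional_iff (h0 : 0 < n) : FiniteDimensional ℂ (L lam) ↔
    ∀ k : Fin (n - 1), ∃ m : ℕ, lam (lo k) - lam (hi k) = m := by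
  constructor
  · intro h k
    exact (actsFin_simple_iff k).mp (actsFin_of_finiteDimensional (lo_ne_hi k).symm)
  · intro h
    exact finiteDimensional_of_actsFin h0 fun k => (actsFin_simple_iff k).mpr (h k)

end FiniteDim

/-! ### Bounded modules from the oscillator modules -/

section OscBounded

variable {n : ℕ} {V : Type*} [AddCommGroup V] [Module ℂ V]

open TensorProduct in
theorem finsuppScalarLeft_op (p : Fin n) (B : U n →ₐ[ℂ] Module.End ℂ V) (i : Fin n)
    (x : Osc n ⊗[ℂ] V) (m : Weight n) :
    TensorProduct.finsuppScalarLeft ℂ V (Weight n) (op (tensorRep (oscRep p) B) i i x) m =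
      m i • TensorProduct.finsuppScalarLeft ℂ V (Weight n) x m +
        op B i i (TensorProduct.finsuppScalarLeft ℂ V (Weight n) x m) := by
  induction x using TensorProduct.induction_on with
  | zero => simp
  | add x y hx hy =>
    simp only [map_add, Finsupp.add_apply, hx, hy, smul_add]
    abel
  | tmul f v =>
    induction f using Finsupp.induction_linear with
    | zero => simp
    | add f g hf hg =>
      simp only [TensorProduct.add_tmul, map_add, Finsupp.add_apply, hf, hg, smul_add]
      abel
    | single a c =>
      rw [op_tensorRep, op_oscRep_diag]
      simp only [map_add, Finsupp.add_apply, TensorProduct.finsuppScalarLeft_apply_tmul_apply,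
        Finsupp.smul_apply, Finsupp.single_apply]
      split_ifs with h
      · subst h; simp [mul_smul]
      · simp

theorem mult_of_injective_on_wt {M : Type*} [AddCommGroup M] [Module ℂ M]
    {A : U n →ₐ[ℂ] Module.End ℂ M} [FiniteDimensional ℂ V] (f : M →ₗ[ℂ] V)
    (h : ∀ κ, ∀ x ∈ wt A κ, f x = 0 → x = 0) : Mult A (Module.finrank ℂ V) := by
  intro κ
  let ε : wt A κ →ₗ[ℂ] V := f.comp (Submodule.subtype _)
  have hinj : Function.Injective ε := by
    rw [← LinearMap.ker_eq_bot, LinearMap.ker_eq_bot']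
    exact fun x hx => Subtype.ext (h κ x.1 x.2 hx)
  exact ⟨FiniteDimensional.of_injective ε hinj, LinearMap.finrank_le_finrank_of_injective hinj⟩

/-- A vector of weight κ is a finite family of x_m in V with x_m of weight κ − m. These weights are
distinct, so the sum of the x_m in V determines the family. -/
theorem mult_tensorRep_osc (p : Fin n) [FiniteDimensional ℂ V] (B : U n →ₐ[ℂ] Module.End ℂ V) :
    Mult (tensorRep (oscRep p) B) (Module.finrank ℂ V) := by
  let e := TensorProduct.finsuppScalarLeft ℂ V (Weight n)
  refine mult_of_injective_on_wt
    ((Finsupp.lsum ℂ fun _ : Weight n => (LinearMap.id : V →ₗ[ℂ] V)).comp e.toLinearMap) ?_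
  · intro κ x hx h0
    have hmem : ∀ m, e x m ∈ wt B (κ - m) := by
      intro m
      refine (mem_wt B).mpr fun i => ?_
      have h1 := finsuppScalarLeft_op p B i x m
      rw [(mem_wt _).mp hx i, map_smul, Finsupp.smul_apply] at h1
      rw [Pi.sub_apply, sub_smul]
      exact (sub_eq_iff_eq_add'.mpr h1).symm
    let f : Weight n →₀ V := (e x).equivMapDomain (Equiv.subLeft κ)
    have hf : ∀ ν, f ν = e x (κ - ν) := fun ν => by
      simp [f, Finsupp.equivMapDomain_apply, Equiv.subLeft]
      congr 1; abel
    have hf' : ∀ ν, f ν ∈ wt B ν := fun ν => by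
      have := hmem (κ - ν)
      rwa [sub_sub_cancel, ← hf] at this
    have hsum : (f.sum fun _ m => m) = 0 := by
      rw [Finsupp.sum_equivMapDomain]
      exact h0
    have hz : e x = 0 := by
      ext m
      have := wt_component B hf' (κ := κ - m) (by rw [hsum]; exact zero_mem _)
      rw [hsum, hf, sub_sub_cancel] at this
      exact this.symm
    exact (LinearEquiv.map_eq_zero_iff e).mp hz

theorem isBoundedWeight_osc_add (h0 : 0 < n) (p : Fin n) (c : ℂ) {ν : Weight n}
    (hν : ∀ k : Fin (n - 1), ∃ m : ℕ, ν (lo k) - ν (hi k) = m) :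
    IsBoundedWeight (oscWeight p c + ν) := by
  have := (finiteDimensional_iff h0).mpr hν
  rw [isBoundedWeight_iff]
  refine ⟨_, mult_repL_of_isSing ((isSing_osc p c).tmul (isHW_hwv ν).sing) ?_
    (mult_tensorRep_osc p (repL ν))⟩
  intro h
  have h1 := congrArg (fun t => TensorProduct.finsuppScalarLeft ℂ (L ν) (Weight n) t
    (oscWeight p c)) h
  simp [TensorProduct.finsuppScalarLeft_apply_tmul_apply] at h1
  exact hwv_ne_zero ν h1

end OscBounded

/-! ### Unbounded multiplicities -/

section Unbounded

variable {n : ℕ} {M : Type*} [AddCommGroup M] [Module ℂ M]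

theorem mul_pow_central {R : Type*} [Ring R] {x z g : R} (h : x * z = z * x + g)
    (hg : g * z = z * g) (k : ℕ) : x * z ^ k = z ^ k * x + k • (g * z ^ (k - 1)) := by
  induction k with
  | zero => simp
  | succ k ih =>
    have hgk : g * z ^ k = z ^ k * g := (Commute.pow_right (show Commute g z from hg) k)
    rw [pow_succ, ← mul_assoc, ih, add_mul, mul_assoc, h, mul_add, ← mul_assoc, ← pow_succ,
      smul_mul_assoc, mul_assoc g, succ_nsmul, Nat.add_sub_cancel, hgk]
    rcases k with _ | k
    · simp
    · rw [Nat.add_sub_cancel, ← pow_succ, hgk]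
      abel

/-- Comparison of coefficients after applying an operator that acts on a family of vectors by a
two-term recursion. -/
theorem coeff_recursion {e : Module.End ℂ M} {T W : ℕ → M} {α : ℕ → ℂ} {β : ℂ} {K N : ℕ}
    (hK : K ≤ N + 1) (hα : α (N + 1) = 0)
    (hT : ∀ k ≤ K, e (T k) = α k • W k + (β * k) • W (k - 1)) {c : ℕ → ℂ}
    (h0 : ∑ k ∈ Finset.range (K + 1), c k • T k = 0)
    (hW : ∀ K' ≤ K, K' ≤ N → ∀ d : ℕ → ℂ, ∑ k ∈ Finset.range (K' + 1), d k • W k = 0 →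
      ∀ k ≤ K', d k = 0) :
    ∀ j ≤ K, j ≤ N → c j * α j + (if j < K then β * (j + 1) * c (j + 1) else 0) = 0 := by
  set d : ℕ → ℂ := fun j => c j * α j + (if j < K then β * (j + 1) * c (j + 1) else 0) with hd
  have h1 : ∑ k ∈ Finset.range (K + 1), d k • W k = 0 := by
    have h2 := congrArg e h0
    rw [map_zero, map_sum] at h2
    rw [← h2]
    have h3 : ∀ k ∈ Finset.range (K + 1), e (c k • T k) =
        (c k * α k) • W k + (c k * (β * k)) • W (k - 1) := by
      intro k hk
      rw [map_smul, hT k (Nat.lt_succ_iff.mp (Finset.mem_range.mp hk)), smul_add, smul_smul,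
        smul_smul]
    rw [Finset.sum_congr rfl h3, Finset.sum_add_distrib]
    simp only [hd, add_smul, Finset.sum_add_distrib]
    congr 1
    rw [Finset.sum_range_succ, if_neg (lt_irrefl K), zero_smul, add_zero,
      Finset.sum_range_succ' _ K]
    simp only [Nat.cast_zero, mul_zero, zero_smul, add_zero, Nat.add_sub_cancel]
    refine Finset.sum_congr rfl fun k hk => ?_
    rw [if_pos (Finset.mem_range.mp hk)]
    congr 1
    push_cast
    ring
  intro j hj hjN
  -- For K = N + 1 the vector `W (N + 1)` belongs to no independent family; its coefficient vanishes
  -- by `hα`.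
  rcases Nat.lt_or_ge N K with hlt | hge
  · obtain rfl : K = N + 1 := by omega
    rw [Finset.sum_range_succ] at h1
    have h2 : d (N + 1) = 0 := by simp [hd, hα]
    rw [h2, zero_smul, add_zero] at h1
    exact hW N (by omega) le_rfl d h1 j hjN
  · exact hW K le_rfl hge d h1 j hj

variable (A : U n →ₐ[ℂ] Module.End ℂ M) {p q r : Fin n}

/-- The vector `E_{qp}^x E_{rp}^k E_{rq}^y u`. -/
noncomputable def monom (p q r : Fin n) (x k y : ℕ) (u : M) : M :=
  (op A q p ^ x) ((op A r p ^ k) ((op A r q ^ y) u))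

variable {A}

/-- The sl_2 formula treats E_qp^x, and [E_pq, E_rp] = −E_rq treats E_rp^k. The truncated exponents
x − 1 and k − 1 are harmless, since their coefficients carry the factors x and k. -/
theorem raise_left_monom (hpq : p ≠ q) (hqr : q ≠ r) (hpr : p ≠ r) {κ : Weight n} {u : M}
    (hu : u ∈ wt A κ) (h1 : op A p q u = 0) (x k y : ℕ) :
    op A p q (monom A p q r x k y u) =
      ((x : ℂ) * (κ p - κ q - k + y - x + 1)) • monom A p q r (x - 1) k y u -
        (k : ℂ) • monom A p q r x (k - 1) (y + 1) u := by
  set m := (op A r p ^ k) ((op A r q ^ y) u) with hm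
  have hmw : m ∈ wt A (κ + (y : ℂ) • root r q + (k : ℂ) • root r p) :=
    op_pow_mem_wt A _ _ _ (op_pow_mem_wt A _ _ _ hu)
  have hc : (κ + (y : ℂ) • root r q + (k : ℂ) • root r p) p -
      (κ + (y : ℂ) • root r q + (k : ℂ) • root r p) q = κ p - κ q - k + y := by
    simp [root_apply, hpq, hqr, hpr, hpq.symm]
    ring
  have e1 : op A p q m = -((k : ℂ) • (op A r p ^ (k - 1)) ((op A r q ^ (y + 1)) u)) := by
    have c1 : op A p q * op A r p = op A r p * op A p q + -op A r q := by
      rw [op_mul_op]; simp [hqr]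
    have c2 : -op A r q * op A r p = op A r p * -op A r q := by
      rw [neg_mul, mul_neg, op_mul_op]; simp [hqr, hpr]
    have c3 : Commute (op A p q) (op A r q) := by
      rw [Commute, SemiconjBy, op_mul_op]; simp [hqr, hpq.symm]
    have c4 := LinearMap.congr_fun (mul_pow_central c1 c2 k) ((op A r q ^ y) u)
    have c6 : op A p q ((op A r q ^ y) u) = 0 := by
      rw [← Module.End.mul_apply, (c3.pow_right y).eq, Module.End.mul_apply, h1, map_zero]
    rw [Module.End.mul_apply, LinearMap.add_apply, Module.End.mul_apply, c6, map_zero,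
      zero_add] at c4
    have c5 : Commute (op A r q) (op A r p) := by
      rw [Commute, SemiconjBy, op_mul_op]; simp [hqr, hpr]
    rw [hm, c4, neg_mul, (c5.pow_right (k - 1)).eq, LinearMap.smul_apply, LinearMap.neg_apply,
      Module.End.mul_apply, ← Module.End.mul_apply (op A r q), ← pow_succ', smul_neg,
      Nat.cast_smul_eq_nsmul]
  rcases x with _ | x
  · have : op A p q (monom A p q r 0 k y u) = op A p q m := rfl
    rw [this, e1]
    simp [monom]
  · have : monom A p q r (x + 1) k y u = (op A q p ^ (x + 1)) m := rfl
    have hx : (x + 1 : ℂ) * (κ p - κ q - k + y - x) =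
        ((x + 1 : ℕ) : ℂ) * (κ p - κ q - k + y - (x + 1 : ℕ) + 1) := by push_cast; ring
    rw [this, op_op_pow A hpq hmw, e1, hc, map_neg, map_smul, hx, Nat.add_sub_cancel, add_comm,
      ← sub_eq_add_neg]
    rfl

theorem raise_right_monom (hpq : p ≠ q) (hqr : q ≠ r) (hpr : p ≠ r) {κ : Weight n} {u : M}
    (hu : u ∈ wt A κ) (h2 : op A q r u = 0) (x k y : ℕ) :
    op A q r (monom A p q r x k y u) =
      ((y : ℂ) * (κ q - κ r - y + 1)) • monom A p q r x k (y - 1) u +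
        (k : ℂ) • monom A p q r (x + 1) (k - 1) y u := by
  have c1 : Commute (op A q r) (op A q p) := by
    rw [Commute, SemiconjBy, op_mul_op]; simp [hpq, hqr.symm]
  have c2 : op A q r * op A r p = op A r p * op A q r + op A q p := by
    rw [op_mul_op]; simp [hpq]
  have c3 : op A q p * op A r p = op A r p * op A q p := by
    rw [op_mul_op]; simp [hpq, hpr]
  have e1 : op A q r ((op A r q ^ y) u) = ((y : ℂ) * (κ q - κ r - y + 1)) • (op A r q ^ (y - 1)) u := by
    rcases y with _ | y
    · simp [h2]
    · rw [op_op_pow A hqr hu, h2, map_zero, zero_add, Nat.add_sub_cancel]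
      congr 1
      push_cast
      ring
  have e2 := LinearMap.congr_fun (mul_pow_central c2 c3 k) ((op A r q ^ y) u)
  rw [Module.End.mul_apply, LinearMap.add_apply, Module.End.mul_apply, e1, map_smul] at e2
  unfold monom
  rw [← Module.End.mul_apply (op A q r), (c1.pow_right x).eq, Module.End.mul_apply, e2, map_add,
    map_smul, LinearMap.smul_apply, map_nsmul, Module.End.mul_apply, ← Nat.cast_smul_eq_nsmul ℂ,
    pow_succ, Module.End.mul_apply]

/-- Induction on the degree a + b. Applying E_pq or E_qr to a relation lowers the degree, so each
yields a recursion linking c_j and c_(j+1). The terms in c_(j+1) have opposite signs; adding the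
recursions leaves c_j times an integer that antidominance makes positive. -/
theorem monom_independent (hpq : p ≠ q) (hqr : q ≠ r) (hpr : p ≠ r) {κ : Weight n} {u : M}
    (h0 : u ≠ 0) (hu : u ∈ wt A κ) (h1 : op A p q u = 0) (h2 : op A q r u = 0) {P Q : ℕ}
    (hP : κ p - κ q = -P - 1) (hQ : κ q - κ r = -Q - 1) (s : ℕ) : ∀ a b, a + b = s →
    ∀ K ≤ a, K ≤ b → ∀ c : ℕ → ℂ,
      ∑ k ∈ Finset.range (K + 1), c k • monom A p q r (a - k) k (b - k) u = 0 →
      ∀ k ≤ K, c k = 0 := by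
  induction s with
  | zero =>
    intro a b hab K hKa hKb c hc k hk
    obtain rfl : a = 0 := by omega
    obtain rfl : b = 0 := by omega
    obtain rfl : K = 0 := by omega
    obtain rfl : k = 0 := by omega
    have : c 0 • u = 0 := by simpa [monom] using hc
    exact (smul_eq_zero.mp this).resolve_right h0
  | succ s ih =>
    intro a b hab K hKa hKb c hc
    have fact1 : ∀ j ≤ K, j + 1 ≤ a →
        c j * (((a - j : ℕ) : ℂ) * (-P - 1 - j + (b - j : ℕ) - (a - j : ℕ) + 1)) +
          (if j < K then (-1) * (j + 1) * c (j + 1) else 0) = 0 := by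
      rcases a with _ | a
      · intro j _ hj; omega
      have := coeff_recursion (e := op A p q) (T := fun k => monom A p q r (a + 1 - k) k (b - k) u)
        (W := fun k => monom A p q r (a - k) k (b - k) u)
        (α := fun j => ((a + 1 - j : ℕ) : ℂ) * (-P - 1 - j + (b - j : ℕ) - (a + 1 - j : ℕ) + 1))
        (β := -1) (K := K) (N := a) hKa (by simp) ?_ hc
        (fun K' h h' d hd => ih a b (by omega) K' h' (by omega) d hd)
      · intro j hj hja
        exact this j hj (by omega)
      · intro k hk
        rw [raise_left_monom hpq hqr hpr hu h1, hP, sub_eq_add_neg, ← neg_smul, neg_one_mul]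
        rcases k with _ | k
        · simp
        · have x1 : a + 1 - (k + 1) - 1 = a - (k + 1) := by omega
          have x2 : a + 1 - (k + 1) = a - k := by omega
          have x3 : b - (k + 1) + 1 = b - k := by omega
          rw [x1, x3, Nat.add_sub_cancel, x2]
    have fact2 : ∀ j ≤ K, j + 1 ≤ b →
        c j * (((b - j : ℕ) : ℂ) * (-Q - 1 - (b - j : ℕ) + 1)) +
          (if j < K then 1 * (j + 1) * c (j + 1) else 0) = 0 := by
      rcases b with _ | b
      · intro j _ hj; omega
      have := coeff_recursion (e := op A q r) (T := fun k => monom A p q r (a - k) k (b + 1 - k) u)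
        (W := fun k => monom A p q r (a - k) k (b - k) u)
        (α := fun j => ((b + 1 - j : ℕ) : ℂ) * (-Q - 1 - (b + 1 - j : ℕ) + 1))
        (β := 1) (K := K) (N := b) hKb (by simp) ?_ hc
        (fun K' h h' d hd => ih a b (by omega) K' (by omega) h' d hd)
      · intro j hj hja
        exact this j hj (by omega)
      · intro k hk
        rw [raise_right_monom hpq hqr hpr hu h2, hQ, one_mul]
        rcases k with _ | k
        · simp
        · have x1 : b + 1 - (k + 1) - 1 = b - (k + 1) := by omega
          have x2 : b + 1 - (k + 1) = b - k := by omega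
          have x3 : a - (k + 1) + 1 = a - k := by omega
          rw [x1, x3, Nat.add_sub_cancel, x2]
    have low : ∀ j ≤ K, j < a → j < b → c j = 0 := by
      intro j hj hja hjb
      have f1 := fact1 j hj hja
      have f2 := fact2 j hj hjb
      obtain ⟨X, hX⟩ : ∃ X, a = j + X + 1 := ⟨a - j - 1, by omega⟩
      obtain ⟨Y, hY⟩ : ∃ Y, b = j + Y + 1 := ⟨b - j - 1, by omega⟩
      have x1 : a - j = X + 1 := by omega
      have x2 : b - j = Y + 1 := by omega
      rw [x1, x2] at f1
      rw [x2] at f2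
      have f3 : c j * (((X + 1) * ((X : ℤ) + 1 + j + P) + (Y + 1) * (Y + 1 + Q) -
          (X + 1) * (Y + 1) : ℤ) : ℂ) = 0 := by
        push_cast at f1 f2 ⊢
        split_ifs at f1 f2 <;> linear_combination -f1 - f2
      refine (mul_eq_zero.mp f3).resolve_right ?_
      have : ((X + 1) * ((X : ℤ) + 1 + j + P) + (Y + 1) * (Y + 1 + Q) - (X + 1) * (Y + 1) : ℤ) > 0 := by
        have p1 : (0 : ℤ) ≤ (X + 1) * (j + P) := by positivity
        have p2 : (0 : ℤ) ≤ (Y + 1) * Q := by positivity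
        have p3 : (0 : ℤ) ≤ X := by positivity
        have p4 : (0 : ℤ) ≤ Y := by positivity
        -- Without the nonnegative terms in P, Q and j, this is S² − ST + T² with S = X + 1 and T =
        -- Y + 1.
        nlinarith [sq_nonneg ((X : ℤ) - Y)]
      exact_mod_cast this.ne'
    intro j hj
    by_cases hlow : j < a ∧ j < b
    · exact low j hj hlow.1 hlow.2
    -- Now j equals a or b, where only one recursion may survive. For j = 0 that one has a nonzero
    -- coefficient; otherwise the recursion one index lower, whose own coefficient is already zero,
    -- gives the claim.
    rcases j with _ | j
    · by_cases ha : a = 0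
      · have f2 := fact2 0 hj (by omega)
        rw [if_neg (by omega), add_zero] at f2
        refine (mul_eq_zero.mp f2).resolve_right ?_
        rw [Nat.sub_zero]
        have hb : (b : ℂ) ≠ 0 := by exact_mod_cast (by omega : b ≠ 0)
        refine mul_ne_zero hb ?_
        have : ((Q + b : ℕ) : ℂ) ≠ 0 := by exact_mod_cast (by omega : Q + b ≠ 0)
        intro h
        apply this
        push_cast
        linear_combination -h
      · have hb : b = 0 := by omega
        have f1 := fact1 0 hj (by omega)
        rw [if_neg (by omega), add_zero] at f1
        refine (mul_eq_zero.mp f1).resolve_right ?_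
        subst hb
        rw [Nat.sub_zero, Nat.sub_zero]
        have ha' : (a : ℂ) ≠ 0 := by exact_mod_cast ha
        refine mul_ne_zero ha' ?_
        have : ((P + a : ℕ) : ℂ) ≠ 0 := by exact_mod_cast (by omega : P + a ≠ 0)
        intro h
        apply this
        push_cast at h ⊢
        linear_combination -h
    · have hprev := low j (by omega) (by omega) (by omega)
      have f2 := fact2 j (by omega) (by omega)
      rw [hprev, zero_mul, zero_add, if_pos (by omega), one_mul] at f2
      exact (mul_eq_zero.mp f2).resolve_left (by exact_mod_cast Nat.succ_ne_zero j)

theorem monom_mem_wt {κ : Weight n} {u : M} (hu : u ∈ wt A κ) {C k : ℕ} (hk : k ≤ C) :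
    monom A p q r (C - k) k (C - k) u ∈ wt A (κ + (C : ℂ) • root r p) := by
  have := op_pow_mem_wt A q p (C - k) (op_pow_mem_wt A r p k (op_pow_mem_wt A r q (C - k) hu))
  unfold monom
  convert this using 2
  rw [Nat.cast_sub hk]
  funext i
  simp only [Pi.add_apply, Pi.smul_apply, root_apply, smul_eq_mul]
  ring

/-- With equal outer exponents C − k the weight does not depend on k, so one weight space contains C
+ 1 independent vectors. -/
theorem not_mult_of_antidominant (hpq : p ≠ q) (hqr : q ≠ r) (hpr : p ≠ r) {κ : Weight n} {u : M}
    (h0 : u ≠ 0) (hu : u ∈ wt A κ) (h1 : op A p q u = 0) (h2 : op A q r u = 0) {P Q : ℕ}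
    (hP : κ p - κ q = -P - 1) (hQ : κ q - κ r = -Q - 1) (C : ℕ) : ¬ Mult A C := by
  intro hC
  obtain ⟨hfd, hle⟩ := hC (κ + (C : ℂ) • root r p)
  let v : Fin (C + 1) → wt A (κ + (C : ℂ) • root r p) := fun k =>
    ⟨monom A p q r (C - k) k (C - k) u, monom_mem_wt hu (Nat.lt_succ_iff.mp k.2)⟩
  have hv : LinearIndependent ℂ v := by
    rw [Fintype.linearIndependent_iff]
    intro g hg k
    let c : ℕ → ℂ := fun k => if h : k < C + 1 then g ⟨k, h⟩ else 0
    have hc : ∑ k ∈ Finset.range (C + 1), c k • monom A p q r (C - k) k (C - k) u = 0 := by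
      rw [Finset.sum_range]
      have := congrArg Subtype.val hg
      simp only [Submodule.coe_sum, Submodule.coe_smul] at this
      rw [← Submodule.coe_zero (p := wt A (κ + (C : ℂ) • root r p)), ← this]
      refine Finset.sum_congr rfl fun k _ => ?_
      rw [show c k = g k from dif_pos k.2]
    have := monom_independent hpq hqr hpr h0 hu h1 h2 hP hQ (C + C) C C rfl C le_rfl le_rfl c hc k
      (Nat.lt_succ_iff.mp k.2)
    rwa [show c k = g k from dif_pos k.2] at this
  have := hv.fintype_card_le_finrank
  rw [Fintype.card_fin] at this
  omega

/-- The existence of a singular vector for `gl_3` with shifted weight differences `P` and `Q`. -/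
def HasSing₃ (A : U n →ₐ[ℂ] Module.End ℂ M) (p q r : Fin n) (P Q : ℤ) : Prop :=
  ∃ (κ : Weight n) (u : M), u ≠ 0 ∧ u ∈ wt A κ ∧ op A p q u = 0 ∧ op A q r u = 0 ∧
    κ p - κ q = P - 1 ∧ κ q - κ r = Q - 1

theorem pow_ne_zero_of_injective {f : Module.End ℂ M} (hf : ∀ m, f m = 0 → m = 0) {u : M}
    (h0 : u ≠ 0) (t : ℕ) : (f ^ t) u ≠ 0 := by
  induction t with
  | zero => simpa using h0
  | succ t ih =>
    rw [pow_succ', Module.End.mul_apply]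
    exact fun h => ih (hf _ h)

/-- The power P of E_qp sends the singular vector to a singular vector of reflected weight, and
injectivity keeps it nonzero. -/
theorem HasSing₃.swap_left (hpq : p ≠ q) (hqr : q ≠ r) (hpr : p ≠ r)
    (hf : ∀ m, op A q p m = 0 → m = 0) {P Q : ℤ} (hP : 0 < P) (h : HasSing₃ A p q r P Q) :
    HasSing₃ A p q r (-P) (P + Q) := by
  obtain ⟨κ, u, h0, hu, h1, h2, hκ1, hκ2⟩ := h
  obtain ⟨t, rfl⟩ : ∃ t : ℕ, P = t + 1 := ⟨(P - 1).toNat, by omega⟩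
  refine ⟨_, (op A q p ^ (t + 1)) u, pow_ne_zero_of_injective hf h0 _, op_pow_mem_wt A _ _ _ hu,
    ?_, ?_, ?_, ?_⟩
  · rw [op_op_pow A hpq hu, h1, hκ1]
    simp
  · have c1 : Commute (op A q r) (op A q p) := by
      rw [Commute, SemiconjBy, op_mul_op]; simp [hpq, hqr.symm]
    rw [← Module.End.mul_apply, (c1.pow_right _).eq, Module.End.mul_apply, h2, map_zero]
  · simp [root_apply, hpq, hpq.symm]
    push_cast at hκ1
    linear_combination hκ1
  · simp [root_apply, hpq.symm, hqr.symm, hpr.symm]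
    linear_combination hκ2

theorem HasSing₃.swap_right (hpq : p ≠ q) (hqr : q ≠ r) (hpr : p ≠ r)
    (hf : ∀ m, op A r q m = 0 → m = 0) {P Q : ℤ} (hQ : 0 < Q) (h : HasSing₃ A p q r P Q) :
    HasSing₃ A p q r (P + Q) (-Q) := by
  obtain ⟨κ, u, h0, hu, h1, h2, hκ1, hκ2⟩ := h
  obtain ⟨t, rfl⟩ : ∃ t : ℕ, Q = t + 1 := ⟨(Q - 1).toNat, by omega⟩
  refine ⟨_, (op A r q ^ (t + 1)) u, pow_ne_zero_of_injective hf h0 _, op_pow_mem_wt A _ _ _ hu,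
    ?_, ?_, ?_, ?_⟩
  · have c1 : Commute (op A p q) (op A r q) := by
      rw [Commute, SemiconjBy, op_mul_op]; simp [hqr, hpq.symm]
    rw [← Module.End.mul_apply, (c1.pow_right _).eq, Module.End.mul_apply, h1, map_zero]
  · rw [op_op_pow A hqr hu, h2, hκ2]
    simp
  · simp [root_apply, hpq, hqr, hpr]
    linear_combination hκ1
  · simp [root_apply, hqr, hqr.symm]
    push_cast at hκ2
    linear_combination hκ2

/-- At most three reflections make both shifted differences nonpositive; the longest route from P ≤
0 < Q is (P, Q) → (P+Q, −Q) → (−P−Q, P). -/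
theorem not_mult_of_hasSing₃ (hpq : p ≠ q) (hqr : q ≠ r) (hpr : p ≠ r)
    (hf1 : ∀ m, op A q p m = 0 → m = 0) (hf2 : ∀ m, op A r q m = 0 → m = 0) {P Q : ℤ}
    (h : HasSing₃ A p q r P Q) (C : ℕ) : ¬ Mult A C := by
  have anti : ∀ P Q : ℤ, P ≤ 0 → Q ≤ 0 → HasSing₃ A p q r P Q → ¬ Mult A C := by
    rintro P Q hP hQ ⟨κ, u, h0, hu, h1, h2, hκ1, hκ2⟩
    obtain ⟨P', rfl⟩ : ∃ P' : ℕ, P = -P' := ⟨(-P).toNat, by omega⟩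
    obtain ⟨Q', rfl⟩ : ∃ Q' : ℕ, Q = -Q' := ⟨(-Q).toNat, by omega⟩
    refine not_mult_of_antidominant hpq hqr hpr h0 hu h1 h2 (P := P') (Q := Q') ?_ ?_ C
    · rw [hκ1]; push_cast; ring
    · rw [hκ2]; push_cast; ring
  have half : ∀ P Q : ℤ, P ≤ 0 → HasSing₃ A p q r P Q → ¬ Mult A C := by
    intro P Q hP h
    rcases le_or_gt Q 0 with hQ | hQ
    · exact anti P Q hP hQ h
    have h' := h.swap_right hpq hqr hpr hf2 hQ
    rcases le_or_gt (P + Q) 0 with hPQ | hPQ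
    · exact anti _ _ hPQ (by omega) h'
    · exact anti _ _ (by omega) (by omega) (h'.swap_left hpq hqr hpr hf1 hPQ)
  rcases le_or_gt P 0 with hP | hP
  · exact half P Q hP h
  · exact half _ _ (by omega) (h.swap_left hpq hqr hpr hf1 hP)

theorem not_isBoundedWeight_of_two {lam : Weight n}
    (hint : ∀ i j : Fin n, ∃ z : ℤ, lam i - lam j = z) {k l : Fin (n - 1)} (hkl : k < l)
    (hk : ¬ ActsFin lam (hi k) (lo k)) (hl : ¬ ActsFin lam (hi l) (lo l)) :
    ¬ IsBoundedWeight lam := by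
  rw [isBoundedWeight_iff]
  rintro ⟨C, hC⟩
  have hkl' : k.val < l.val := hkl
  have hqr : (hi k : Fin n) ≠ hi l := fun h => by
    have := congrArg Fin.val h; simp only [hi] at this; omega
  have hpr : (lo k : Fin n) ≠ hi l := fun h => by
    have := congrArg Fin.val h; simp only [hi, lo] at this; omega
  obtain ⟨P, hP⟩ := hint (lo k) (hi k)
  obtain ⟨Q, hQ⟩ := hint (hi k) (hi l)
  have hs := (isHW_hwv lam).sing
  refine not_mult_of_hasSing₃ (A := repL lam) (P := P + 1) (Q := Q + 1) (lo_ne_hi k) hqr hpr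
    (op_injective_of_not_actsFin (lo_ne_hi k).symm hk)
    (op_injective_of_not_actsFin hqr.symm fun h => hl ?_)
    ⟨lam, hwv lam, hwv_ne_zero lam, hs.1, hs.2 _ _ ?_, hs.2 _ _ ?_, ?_, ?_⟩ C hC
  -- The triple is lo k, hi k, hi l. Its second lowering root need not be simple, but its local
  -- nilpotency would pass to the simple root at l.
  · exact h.simple_of_le (by rw [Fin.le_def]; simp only [hi, lo]; omega) le_rfl
  · rw [Fin.lt_def]; simp only [hi, lo]; omega
  · rw [Fin.lt_def]; simp only [hi]; omega
  · rw [hP]; push_cast; ring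
  · rw [hQ]; push_cast; ring

end Unbounded

/-! ### Localization at a root vector -/

section Localize

variable {n : ℕ}

/-- The powers of a root vector in the enveloping algebra. -/
noncomputable def rootPowers (i j : Fin n) : Submonoid (U n) := Submonoid.powers (iota n (E i j))

theorem exists_ore {i j : Fin n} (hij : i ≠ j) (u : U n) (s : rootPowers i j) :
    ∃ (u' : U n) (s' : rootPowers i j), (s' : U n) * u = u' * s := by
  obtain ⟨_, t, rfl⟩ := s
  obtain ⟨J, hJ⟩ := exists_adU_pow_eq_zero hij u
  obtain ⟨u', hu'⟩ := exists_pow_mul_eq _ J u hJ t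
  exact ⟨u', ⟨_, J + t, rfl⟩, hu'⟩

/-- The powers of a root vector form an Ore set. -/
@[reducible]
noncomputable def oreSetRoot {i j : Fin n} (hij : i ≠ j) :
    OreLocalization.OreSet (rootPowers i j) where
  ore_right_cancel r₁ r₂ s h := by
    obtain ⟨_, t, rfl⟩ := s
    obtain ⟨J, hJ⟩ := exists_adU_pow_eq_zero hij (r₁ - r₂)
    obtain ⟨N, hN⟩ := exists_pow_mul_eq_zero _ J _ hJ t (by
      rw [sub_mul, sub_eq_zero]; exact h)
    refine ⟨⟨_, N, rfl⟩, ?_⟩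
    rw [mul_sub, sub_eq_zero] at hN
    exact hN
  oreNum u s := (exists_ore hij u s).choose
  oreDenom u s := (exists_ore hij u s).choose_spec.choose
  ore_eq u s := (exists_ore hij u s).choose_spec.choose_spec

variable {lam : Weight n} {i j : Fin n}

section Basic

variable [OreLocalization.OreSet (rootPowers i j)]

/-- The representation on the localization of the simple module at a root vector. -/
noncomputable def locRep (lam : Weight n) (i j : Fin n) [OreLocalization.OreSet (rootPowers i j)] :
    U n →ₐ[ℂ] Module.End ℂ (OreLocalization (rootPowers i j) (L lam)) :=
  rep (OreLocalization (rootPowers i j) (L lam))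

/-- The map to the localization. -/
noncomputable def toLoc (lam : Weight n) (i j : Fin n) [OreLocalization.OreSet (rootPowers i j)] :
    L lam →ₗ[ℂ] OreLocalization (rootPowers i j) (L lam) where
  toFun m := OreLocalization.oreDiv m 1
  map_add' _ _ := (OreLocalization.add_oreDiv).symm
  map_smul' c a := (OreLocalization.smul_oreDiv_one c a).symm

theorem locRep_toLoc (u : U n) (m : L lam) :
    locRep lam i j u (toLoc lam i j m) = toLoc lam i j (repL lam u m) :=
  OreLocalization.smul_oreDiv_one u m

theorem op_toLoc (k l : Fin n) (m : L lam) :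
    op (locRep lam i j) k l (toLoc lam i j m) = toLoc lam i j (op (repL lam) k l m) :=
  locRep_toLoc _ m

theorem pow_smul_oreDiv (t : ℕ) (m : L lam) : (op (locRep lam i j) i j ^ t)
    (OreLocalization.oreDiv m (⟨_, t, rfl⟩ : rootPowers i j)) = toLoc lam i j m := by
  have h1 : op (locRep lam i j) i j ^ t = locRep lam i j (iota n (E i j) ^ t) := (map_pow _ _ _).symm
  rw [h1]
  change (iota n (E i j) ^ t) • (OreLocalization.oreDiv m (⟨_, t, rfl⟩ : rootPowers i j)) = _
  rw [← OreLocalization.oreDiv_one_smul]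
  exact OreLocalization.smul_cancel (s := (⟨_, t, rfl⟩ : rootPowers i j)) (t := 1)

theorem exists_pow_eq_toLoc (x : OreLocalization (rootPowers i j) (L lam)) :
    ∃ t m, (op (locRep lam i j) i j ^ t) x = toLoc lam i j m := by
  induction x using OreLocalization.ind with
  | _ m s =>
    obtain ⟨_, t, rfl⟩ := s
    exact ⟨t, m, pow_smul_oreDiv t m⟩

theorem op_loc_injective (x : OreLocalization (rootPowers i j) (L lam))
    (h : op (locRep lam i j) i j x = 0) : x = 0 := by
  have h1 : (OreLocalization.oreDiv (iota n (E i j)) (1 : rootPowers i j)) • x = 0 := by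
    rw [OreLocalization.oreDiv_one_smul]; exact h
  have h2 := OreLocalization.mul_inv (1 : rootPowers i j)
    (⟨iota n (E i j), 1, pow_one _⟩ : rootPowers i j)
  have h3 := congrArg (fun y => y • x) h2
  simp only [OreLocalization.one_smul] at h3
  rw [← h3, mul_smul]
  have h4 := congrArg (fun y => (OreLocalization.oreDiv (1 : U n)
    (⟨iota n (E i j), 1, pow_one _⟩ : rootPowers i j)) • y) h1
  simpa using h4

theorem toLoc_injective (hinj : ∀ m : L lam, op (repL lam) i j m = 0 → m = 0) (m : L lam)
    (h : toLoc lam i j m = 0) : m = 0 := by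
  have h1 : OreLocalization.oreDiv 0 (1 : rootPowers i j) = OreLocalization.oreDiv m 1 := by
    rw [← OreLocalization.zero_def]; exact h.symm
  obtain ⟨⟨_, t, rfl⟩, v, h2, _⟩ := OreLocalization.oreDiv_eq_iff.mp h1
  by_contra hm
  refine pow_ne_zero_of_injective hinj hm t ?_
  have h4 : op (repL lam) i j ^ t = repL lam (iota n (E i j) ^ t) := (map_pow _ _ _).symm
  rw [h4]
  rw [smul_zero] at h2
  exact h2

theorem pow_op_loc_injective (t : ℕ) (x : OreLocalization (rootPowers i j) (L lam))
    (h : (op (locRep lam i j) i j ^ t) x = 0) : x = 0 := by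
  by_contra hx
  exact pow_ne_zero_of_injective op_loc_injective hx t h

/-- A common power of the root vector moves any finite set of weight vectors of the localization
into the image of L(λ). That power is injective and shifts all weights equally, so independent sets
keep their size. -/
theorem mult_locRep (hinj : ∀ m : L lam, op (repL lam) i j m = 0 → m = 0) {C : ℕ}
    (hC : Mult (repL lam) C) : Mult (locRep lam i j) C := by
  intro κ
  have hrank : Module.rank ℂ (wt (locRep lam i j) κ) ≤ C := by
    refine rank_le fun s hs => ?_
    obtain ⟨N, hN⟩ : ∃ N : ℕ, ∀ x ∈ s, ∃ m, (op (locRep lam i j) i j ^ N) x.1 = toLoc lam i j m := by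
      choose t m htm using fun x : OreLocalization (rootPowers i j) (L lam) => exists_pow_eq_toLoc x
      refine ⟨∑ x ∈ s, t x.1, fun x hx => ?_⟩
      obtain ⟨d, hd⟩ := Nat.exists_eq_add_of_le
        (Finset.single_le_sum (f := fun x : wt (locRep lam i j) κ => t x.1)
          (fun _ _ => Nat.zero_le _) hx)
      refine ⟨(op (repL lam) i j ^ d) (m x.1), ?_⟩
      rw [hd, add_comm, pow_add, Module.End.mul_apply, htm]
      have h1 : ∀ d : ℕ, ∀ y, (op (locRep lam i j) i j ^ d) (toLoc lam i j y) =
          toLoc lam i j ((op (repL lam) i j ^ d) y) := by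
        intro d y
        induction d with
        | zero => rfl
        | succ d ih => rw [pow_succ', pow_succ', Module.End.mul_apply, Module.End.mul_apply, ih, op_toLoc]
      exact h1 d _
    choose! m hm using hN
    have hmem : ∀ x ∈ s, m x ∈ wt (repL lam) (κ + (N : ℂ) • root i j) := by
      intro x hx
      refine (mem_wt _).mpr fun a => ?_
      have h1 := (mem_wt _).mp (op_pow_mem_wt (locRep lam i j) i j N x.2) a
      rw [hm x hx, op_toLoc, ← map_smul] at h1
      exact sub_eq_zero.mp (toLoc_injective hinj _ (by rw [map_sub, h1, sub_self]))
    let y : s → wt (repL lam) (κ + (N : ℂ) • root i j) := fun x => ⟨m x.1, hmem x.1 x.2⟩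
    have hy : LinearIndependent ℂ y := by
      refine LinearIndependent.of_comp ((toLoc lam i j).comp (Submodule.subtype _)) ?_
      have e : ((toLoc lam i j).comp (Submodule.subtype _)) ∘ y =
          ((op (locRep lam i j) i j ^ N).comp (Submodule.subtype _)) ∘ fun x : s => x.1 :=
        funext fun x => (hm x.1 x.2).symm
      rw [e]
      refine hs.map' _ ?_
      rw [LinearMap.ker_eq_bot']
      exact fun x hx => Subtype.ext (pow_op_loc_injective N x.1 hx)
    obtain ⟨hfd, hle⟩ := hC (κ + (N : ℂ) • root i j)
    have := hy.fintype_card_le_finrank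
    rw [Fintype.card_coe] at this
    exact this.trans hle
  have hfd : FiniteDimensional ℂ (wt (locRep lam i j) κ) :=
    Module.rank_lt_aleph0_iff.mp (hrank.trans_lt Cardinal.natCast_lt_aleph0)
  exact ⟨hfd, Module.finrank_le_of_rank_le hrank⟩

end Basic

theorem op_diag_pow {M : Type*} [AddCommGroup M] [Module ℂ M] (A : U n →ₐ[ℂ] Module.End ℂ M)
    (i j k : Fin n) (t : ℕ) (m : M) : op A k k ((op A i j ^ t) m) =
      (op A i j ^ t) (op A k k m) + ((t : ℂ) * root i j k) • (op A i j ^ t) m := by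
  induction t with
  | zero => simp
  | succ t ih =>
    rw [pow_succ', Module.End.mul_apply, Module.End.mul_apply, op_op, ih, map_add, map_smul]
    have : ((if k = i then op A k j ((op A i j ^ t) m) else 0) -
        (if j = k then op A i k ((op A i j ^ t) m) else 0)) =
        root i j k • op A i j ((op A i j ^ t) m) := by
      rw [root_apply, sub_smul]
      by_cases h1 : k = i <;> by_cases h2 : k = j <;> simp [h1, h2, eq_comm] <;> aesop
    rw [this, add_assoc, ← add_smul]
    congr 2
    push_cast
    ring

/-- In the localization at f = E_(hi k, lo k), the vector f^(−t−1) v is singular of weight s_k · λ.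
Localization preserves the multiplicity bound, and L(s_k · λ) is a subquotient. -/
theorem mult_reflect {lam : Weight n} {k : Fin (n - 1)} {t : ℕ}
    (ht : lam (lo k) - lam (hi k) = -(t + 1 : ℕ) - 1) {C : ℕ} (hC : Mult (repL lam) C) :
    Mult (repL (lam + ((t + 1 : ℕ) : ℂ) • root (lo k) (hi k))) C := by
  have hk := lo_ne_hi k
  let := oreSetRoot hk.symm
  have hnf : ¬ ActsFin lam (hi k) (lo k) := by
    rw [actsFin_simple_iff]
    rintro ⟨m, hm⟩
    rw [ht] at hm
    have : ((t + m + 2 : ℕ) : ℂ) = 0 := by push_cast at hm ⊢; linear_combination -hm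
    exact absurd this (by exact_mod_cast (by omega : t + m + 2 ≠ 0))
  have hinj := op_injective_of_not_actsFin hk.symm hnf
  set A := locRep lam (hi k) (lo k) with hA
  set w : OreLocalization (rootPowers (hi k) (lo k)) (L lam) :=
    OreLocalization.oreDiv (hwv lam) (⟨_, t + 1, rfl⟩ : rootPowers (hi k) (lo k)) with hw
  have hfw : (op A (hi k) (lo k) ^ (t + 1)) w = toLoc lam (hi k) (lo k) (hwv lam) :=
    pow_smul_oreDiv (t + 1) (hwv lam)
  have hs := (isHW_hwv lam).sing
  have hwt : w ∈ wt A (lam + ((t + 1 : ℕ) : ℂ) • root (lo k) (hi k)) := by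
    refine (mem_wt _).mpr fun a => sub_eq_zero.mp (pow_op_loc_injective (t + 1) _ ?_)
    have h1 := op_diag_pow A (hi k) (lo k) a (t + 1) w
    rw [hfw, op_toLoc, (mem_wt _).mp hs.1 a, map_smul, ← hfw] at h1
    rw [map_sub, map_smul, ← sub_eq_iff_eq_add.mpr h1, ← sub_smul, ← sub_smul]
    convert zero_smul ℂ _ using 2
    simp only [Pi.add_apply, Pi.smul_apply, root_apply, smul_eq_mul]
    ring
  refine mult_repL_of_isSing (A := A) (w := w) (sing_of_simple A hwt fun l => ?_) ?_
    (mult_locRep hinj hC)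
  -- Vanishing may be tested after applying f^(t+1). For l ≠ k that power commutes with the simple
  -- root vector; for l = k the sl_2 formula has coefficient zero.
  · refine pow_op_loc_injective (t + 1) _ ?_
    by_cases hl : l = k
    · subst hl
      have h1 := op_op_pow A hk hwt t
      rw [hfw, op_toLoc, hs.2 _ _ (by simp [lo, hi]), map_zero] at h1
      have hc : (lam + ((t + 1 : ℕ) : ℂ) • root (lo l) (hi l)) (lo l) -
          (lam + ((t + 1 : ℕ) : ℂ) • root (lo l) (hi l)) (hi l) - t = 0 := by
        simp only [Pi.add_apply, Pi.smul_apply, root_apply, smul_eq_mul, hk, hk.symm, if_true,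
          if_false]
        push_cast at ht ⊢
        linear_combination ht
      rw [hc, mul_zero, zero_smul, add_zero] at h1
      exact h1.symm
    · rw [← Module.End.mul_apply, ← ((commute_simple A hl).pow_right (t + 1)).eq,
        Module.End.mul_apply, hfw, op_toLoc, hs.2 _ _ (by simp [lo, hi]), map_zero]
  · intro h0
    rw [h0, map_zero] at hfw
    exact hwv_ne_zero lam (toLoc_injective hinj _ hfw.symm)

end Localize

/-! ### Shifted coordinates of integral weights -/

section Shift

variable {n : ℕ}

theorem rho_apply (i : Fin n) : rho n i = ((n : ℂ) - 1) / 2 - i.val := by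
  have h1 : (∑ p ∈ Finset.univ.filter (fun p : Fin n × Fin n => p.1 < p.2), root p.1 p.2) i =
      ((Finset.Ioi i).card : ℂ) - ((Finset.Iio i).card : ℂ) := by
    rw [Finset.sum_apply, Finset.sum_filter, Fintype.sum_prod_type]
    simp only [root_apply]
    have h2 : ∀ a b : Fin n, (if a < b then (if i = a then (1 : ℂ) else 0) - (if i = b then 1 else 0)
        else 0) = (if i = a then (if i < b then 1 else 0) else 0) -
          (if i = b then (if a < i then 1 else 0) else 0) := by
      intro a b
      by_cases h1 : i = a <;> by_cases h2 : i = b <;> by_cases h3 : a < b <;>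
        (simp_all; try (split_ifs <;> simp_all))
    simp_rw [h2, Finset.sum_sub_distrib]
    congr 1
    · rw [Finset.sum_comm]
      simp [Finset.filter_lt_eq_Ioi]
    · simp [Finset.filter_gt_eq_Iio]
  have hn := i.2
  rw [rho, Pi.smul_apply, h1, Fin.card_Ioi, Fin.card_Iio, smul_eq_mul,
    Nat.cast_sub (by omega), Nat.cast_sub (by omega)]
  push_cast
  ring

/-- The shifted weight `lam + ρ` has coordinates `c + a_i` with integers `a_i`. -/
def IsShift (lam : Weight n) (c : ℂ) (a : Fin n → ℤ) : Prop := ∀ i, lam i + rho n i = c + a i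

theorem dot_apply (w : Equiv.Perm (Fin n)) (lam : Weight n) (i : Fin n) :
    dot w lam i + rho n i = lam (w⁻¹ i) + rho n (w⁻¹ i) := by
  simp [dot, weylAct]

theorem IsShift.dot_shift {lam : Weight n} {c : ℂ} {a : Fin n → ℤ} (h : IsShift lam c a)
    (w : Equiv.Perm (Fin n)) : IsShift (dot w lam) c (fun i => a (w⁻¹ i)) := fun i => by
  rw [dot_apply, h]

theorem IsShift.eq_iff {lam mu : Weight n} {c : ℂ} {a b : Fin n → ℤ} (h : IsShift lam c a)
    (h' : IsShift mu c b) : lam = mu ↔ a = b := by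
  constructor
  · rintro rfl
    funext i
    have := (h i).symm.trans (h' i)
    exact_mod_cast add_left_cancel this
  · rintro rfl
    funext i
    exact add_right_cancel ((h i).trans (h' i).symm)

theorem IsShift.sub_eq {lam : Weight n} {c : ℂ} {a : Fin n → ℤ} (h : IsShift lam c a)
    (i j : Fin n) : lam i - lam j = ((a i - a j + i.val - j.val : ℤ) : ℂ) := by
  have h1 := h i
  have h2 := h j
  rw [rho_apply] at h1 h2
  push_cast
  linear_combination h1 - h2

theorem dot_swap_sub (lam : Weight n) {i j : Fin n} (hij : i ≠ j) :
    lam - dot (Equiv.swap i j) lam = ((lam i + rho n i) - (lam j + rho n j)) • root i j := by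
  funext k
  have h := dot_apply (Equiv.swap i j) lam k
  rw [Equiv.swap_inv] at h
  rw [Pi.sub_apply, Pi.smul_apply, root_apply, smul_eq_mul, eq_sub_of_add_eq h]
  by_cases h1 : k = i
  · subst h1; simp [hij]; ring
  by_cases h2 : k = j
  · subst h2; simp [hij.symm]; ring
  rw [Equiv.swap_apply_of_ne_of_ne h1 h2]
  simp [h1, h2]

theorem root_mem_posCone {i j : Fin n} (hij : i < j) : root i j ∈ posCone n := by
  have : ∀ d : ℕ, ∀ r : Fin n, r.val = i.val + d + 1 → root i r ∈ posCone n := by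
    intro d
    induction d with
    | zero =>
      intro r hr
      have e : root i r = simpleRoot (⟨i.val, by omega⟩ : Fin (n - 1)) := by
        unfold simpleRoot
        congr 1
        exact Fin.ext hr
      rw [e]
      exact AddSubmonoid.subset_closure ⟨_, rfl⟩
    | succ d ih =>
      intro r hr
      have h1 := ih ⟨i.val + d + 1, by omega⟩ rfl
      have e : root i r = root i ⟨i.val + d + 1, by omega⟩ +
          simpleRoot (⟨i.val + d + 1, by omega⟩ : Fin (n - 1)) := by
        have e2 : (hi ⟨i.val + d + 1, by omega⟩ : Fin n) = r := Fin.ext (by simp only [hi]; omega)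
        unfold simpleRoot
        rw [e2]
        unfold root lo
        abel
      rw [e]
      exact add_mem h1 (AddSubmonoid.subset_closure ⟨_, rfl⟩)
  have hij' : i.val < j.val := hij
  exact this (j.val - i.val - 1) j (by omega)

theorem partialSum_root {i j k : Fin n} :
    ∑ x ∈ Finset.univ.filter (· ≤ k), root i j x =
      (if i ≤ k then (1 : ℂ) else 0) - (if j ≤ k then 1 else 0) := by
  simp [root_apply, Finset.sum_sub_distrib]

/-- Partial sums detect the cone: at the left end of a positive root they recover the multiple of
that root. -/
theorem partialSum_posCone (k : Fin n) {x : Weight n} (hx : x ∈ posCone n) :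
    ∃ m : ℕ, ∑ y ∈ Finset.univ.filter (· ≤ k), x y = m := by
  induction hx using AddSubmonoid.closure_induction with
  | mem x hx =>
    obtain ⟨l, rfl⟩ := hx
    rw [simpleRoot, partialSum_root]
    by_cases h1 : lo l ≤ k <;> by_cases h2 : hi l ≤ k
    · exact ⟨0, by simp [h1, h2]⟩
    · exact ⟨1, by simp [h1, h2]⟩
    · rw [Fin.le_def] at h1 h2
      simp only [lo, hi] at h1 h2
      omega
    · exact ⟨0, by simp [h1, h2]⟩
  | zero => exact ⟨0, by simp⟩
  | add x y _ _ hx hy =>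
    obtain ⟨p, hp⟩ := hx
    obtain ⟨q, hq⟩ := hy
    exact ⟨p + q, by simp only [Pi.add_apply, Finset.sum_add_distrib]; rw [hp, hq]; push_cast; rfl⟩

theorem smul_root_mem_posCone {i j : Fin n} (hij : i < j) (z : ℂ) :
    z • root i j ∈ posCone n ↔ ∃ m : ℕ, z = m := by
  constructor
  · intro h
    obtain ⟨m, hm⟩ := partialSum_posCone i h
    refine ⟨m, ?_⟩
    simp only [Pi.smul_apply] at hm
    rw [← Finset.smul_sum, partialSum_root] at hm
    simpa [hij.not_ge] using hm
  · rintro ⟨m, rfl⟩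
    rw [Nat.cast_smul_eq_nsmul]
    exact AddSubmonoid.nsmul_mem _ (root_mem_posCone hij) m

theorem lo_lt_hi (k : Fin (n - 1)) : (lo k : Fin n) < hi k := by
  rw [Fin.lt_def]; simp [lo, hi]

theorem wle_iff {lam : Weight n} {c : ℂ} {a : Fin n → ℤ} (h : IsShift lam c a) {i j : Fin n}
    (hij : i < j) : WLe lam (dot (Equiv.swap i j) lam) ↔ a i ≤ a j := by
  unfold WLe
  rw [← neg_sub, dot_swap_sub _ hij.ne, h i, h j, ← neg_smul, smul_root_mem_posCone hij]
  constructor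
  · rintro ⟨m, hm⟩
    have : ((a j - a i : ℤ) : ℂ) = ((m : ℤ) : ℂ) := by push_cast; rw [← hm]; ring
    have : a j - a i = m := by exact_mod_cast this
    omega
  · intro hle
    obtain ⟨m, hm⟩ := Int.eq_ofNat_of_zero_le (sub_nonneg.mpr hle)
    refine ⟨m, ?_⟩
    have : ((a j - a i : ℤ) : ℂ) = ((m : ℤ) : ℂ) := by rw [hm]
    push_cast at this
    rw [← this]; ring

theorem wle_iff' {lam : Weight n} {c : ℂ} {a : Fin n → ℤ} (h : IsShift lam c a) {i j : Fin n}
    (hij : i < j) : WLe (dot (Equiv.swap i j) lam) lam ↔ a j ≤ a i := by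
  unfold WLe
  rw [dot_swap_sub _ hij.ne, h i, h j, smul_root_mem_posCone hij]
  constructor
  · rintro ⟨m, hm⟩
    have : ((a i - a j : ℤ) : ℂ) = ((m : ℤ) : ℂ) := by push_cast; rw [← hm]; ring
    have : a i - a j = m := by exact_mod_cast this
    omega
  · intro hle
    obtain ⟨m, hm⟩ := Int.eq_ofNat_of_zero_le (sub_nonneg.mpr hle)
    refine ⟨m, ?_⟩
    have : ((a i - a j : ℤ) : ℂ) = ((m : ℤ) : ℂ) := by rw [hm]
    push_cast at this
    rw [← this]; ring

theorem IsShift.isIntegralWeight {lam : Weight n} {c : ℂ} {a : Fin n → ℤ} (h : IsShift lam c a) :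
    IsIntegralWeight lam := by
  intro k
  unfold s
  rw [wle_iff h (lo_lt_hi k), wle_iff' h (lo_lt_hi k)]
  exact le_total _ _

theorem exists_isShift (h0 : 0 < n) {lam : Weight n}
    (h : ∀ k : Fin (n - 1), ∃ z : ℤ, (lam (lo k) + rho n (lo k)) - (lam (hi k) + rho n (hi k)) = z) :
    ∃ c a, IsShift lam c a := by
  have : ∀ d : ℕ, ∀ hd : d < n, ∃ z : ℤ, lam ⟨d, hd⟩ + rho n ⟨d, hd⟩ =
      lam ⟨0, h0⟩ + rho n ⟨0, h0⟩ + z := by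
    intro d
    induction d with
    | zero => intro hd; exact ⟨0, by simp⟩
    | succ d ih =>
      intro hd
      obtain ⟨z, hz⟩ := ih (by omega)
      obtain ⟨y, hy⟩ := h ⟨d, by omega⟩
      refine ⟨z - y, ?_⟩
      have e1 : (lo ⟨d, by omega⟩ : Fin n) = ⟨d, by omega⟩ := rfl
      have e2 : (hi ⟨d, by omega⟩ : Fin n) = ⟨d + 1, hd⟩ := rfl
      rw [e1, e2] at hy
      push_cast
      linear_combination hz - hy
  choose a ha using this
  exact ⟨_, fun i => a i.1 i.2, fun i => ha i.1 i.2⟩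

theorem IsIntegralWeight.exists_isShift (h0 : 0 < n) {lam : Weight n} (h : IsIntegralWeight lam) :
    ∃ c a, IsShift lam c a := by
  refine GlBounded.exists_isShift h0 fun k => ?_
  have hk := lo_lt_hi k
  rcases h k with h1 | h1 <;> unfold WLe s at h1
  · rw [dot_swap_sub _ hk.ne, smul_root_mem_posCone hk] at h1
    obtain ⟨m, hm⟩ := h1
    exact ⟨m, by rw [hm]; simp⟩
  · rw [← neg_sub, dot_swap_sub _ hk.ne, ← neg_smul, smul_root_mem_posCone hk] at h1
    obtain ⟨m, hm⟩ := h1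
    exact ⟨-m, by push_cast; rw [← hm]; ring⟩

theorem IsShift.isWMaximal_iff {lam : Weight n} {c : ℂ} {a : Fin n → ℤ} (h : IsShift lam c a) :
    IsWMaximal lam ↔ Antitone a := by
  have key : ∀ i j : Fin n, i < j → (¬ WLt lam (dot (Equiv.swap i j) lam) ↔ a j ≤ a i) := by
    intro i j hij
    unfold WLt
    rw [wle_iff h hij, ne_eq, h.eq_iff (h.dot_shift _), not_and_or, not_not, not_le]
    constructor
    · rintro (h1 | h1)
      · exact h1.le
      · have := congrFun h1 i
        simp at this
        exact this.ge
    · intro h1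
      rcases h1.lt_or_eq with h2 | h2
      · exact Or.inl h2
      · right
        funext k
        rw [Equiv.swap_inv, Equiv.swap_apply_def]
        split_ifs with e1 e2
        · rw [e1, h2]
        · rw [e2, h2]
        · rfl
  constructor
  · intro hw i j hij
    rcases hij.lt_or_eq with h1 | h1
    · exact (key i j h1).mp (hw i j h1.ne)
    · rw [h1]
  · intro ha i j hij
    rcases lt_or_gt_of_ne hij with h1 | h1
    · exact (key i j h1).mpr (ha h1.le)
    · rw [Equiv.swap_comm]
      exact (key j i h1).mpr (ha h1.le)

theorem IsShift.mem_stab_iff {lam : Weight n} {c : ℂ} {a : Fin n → ℤ} (h : IsShift lam c a)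
    (w : Equiv.Perm (Fin n)) : w ∈ stab lam ↔ ∀ i, a (w⁻¹ i) = a i := by
  change dot w lam = lam ↔ _
  rw [(h.dot_shift w).eq_iff h, funext_iff]

theorem IsShift.isRegularWeight_iff {lam : Weight n} {c : ℂ} {a : Fin n → ℤ} (h : IsShift lam c a) :
    IsRegularWeight lam ↔ Function.Injective a := by
  unfold IsRegularWeight
  constructor
  · intro hs i j hij
    have h1 : Equiv.swap i j ∈ stab lam := by
      rw [h.mem_stab_iff]
      intro k
      rw [Equiv.swap_inv, Equiv.swap_apply_def]
      split_ifs with e1 e2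
      · rw [e1, hij]
      · rw [e2, hij]
      · rfl
    rw [hs, Set.mem_singleton_iff] at h1
    exact Equiv.swap_eq_one_iff.mp h1
  · intro ha
    ext w
    rw [h.mem_stab_iff, Set.mem_singleton_iff]
    constructor
    · intro hw
      rw [← inv_eq_one]
      exact Equiv.ext fun i => ha (hw i)
    · rintro rfl; simp

/-- Neighbouring entries of ρ differ by one, which turns the weak inequality for `lam` into a strict
one for `a`. -/
theorem IsShift.actsFin_iff {lam : Weight n} {c : ℂ} {a : Fin n → ℤ} (h : IsShift lam c a)
    (k : Fin (n - 1)) : ActsFin lam (hi k) (lo k) ↔ a (hi k) < a (lo k) := by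
  rw [actsFin_simple_iff, h.sub_eq]
  constructor
  · rintro ⟨m, hm⟩
    have : a (lo k) - a (hi k) + (lo k).val - (hi k).val = m := by exact_mod_cast hm
    simp only [lo, hi] at this ⊢
    push_cast at this
    omega
  · intro hlt
    refine ⟨(a (lo k) - a (hi k) - 1).toNat, ?_⟩
    have : a (lo k) - a (hi k) + (lo k).val - (hi k).val = (a (lo k) - a (hi k) - 1).toNat := by
      simp only [lo, hi] at hlt ⊢
      push_cast
      omega
    exact_mod_cast congrArg (Int.cast : ℤ → ℂ) this

theorem IsShift.strictAnti_of_simple {a : Fin n → ℤ} {i j : Fin n} (hij : i < j)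
    (h : ∀ k : Fin (n - 1), i ≤ lo k → hi k ≤ j → a (hi k) < a (lo k)) : a j < a i := by
  have : ∀ d : ℕ, ∀ r : Fin n, r.val = i.val + d + 1 → r ≤ j → a r < a i := by
    intro d
    induction d with
    | zero =>
      intro r hr hrj
      have e : r = hi (⟨i.val, by omega⟩ : Fin (n - 1)) := Fin.ext hr
      have := h ⟨i.val, by omega⟩ le_rfl (e ▸ hrj)
      rw [e]
      exact this
    | succ d ih =>
      intro r hr hrj
      rw [Fin.le_def] at hrj
      have h1 := ih ⟨i.val + d + 1, by omega⟩ rfl (by rw [Fin.le_def]; simp only; omega)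
      have e : r = hi (⟨i.val + d + 1, by omega⟩ : Fin (n - 1)) := Fin.ext (by simp only [hi]; omega)
      have h2 := h ⟨i.val + d + 1, by omega⟩ (by rw [Fin.le_def]; simp only [lo]; omega)
        (by rw [← e]; exact hrj)
      rw [e]
      exact h2.trans h1
  have hij' : i.val < j.val := hij
  exact this (j.val - i.val - 1) j (by omega) le_rfl

theorem IsShift.finiteDimensional_iff (h0 : 0 < n) {lam : Weight n} {c : ℂ} {a : Fin n → ℤ}
    (h : IsShift lam c a) : FiniteDimensional ℂ (L lam) ↔ StrictAnti a := by
  rw [GlBounded.finiteDimensional_iff h0]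
  constructor
  · intro hk i j hij
    exact IsShift.strictAnti_of_simple hij fun k _ _ =>
      (h.actsFin_iff k).mp ((actsFin_simple_iff k).mpr (hk k))
  · intro ha k
    exact (actsFin_simple_iff k).mp ((h.actsFin_iff k).mpr (ha (lo_lt_hi k)))

/-- A weight is regular, `W`-maximal and integral iff its simple module is finite-dimensional. -/
theorem regular_maximal_integral_iff (h0 : 0 < n) (lam : Weight n) :
    (IsRegularWeight lam ∧ IsWMaximal lam ∧ IsIntegralWeight lam) ↔
      FiniteDimensional ℂ (L lam) := by
  constructor
  · rintro ⟨h1, h2, h3⟩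
    obtain ⟨c, a, h⟩ := h3.exists_isShift h0
    rw [h.finiteDimensional_iff h0]
    exact (h.isWMaximal_iff.mp h2).strictAnti_of_injective (h.isRegularWeight_iff.mp h1)
  · intro hfd
    obtain ⟨c, a, h⟩ : ∃ c a, IsShift lam c a := by
      refine GlBounded.exists_isShift h0 fun k => ?_
      obtain ⟨m, hm⟩ := (GlBounded.finiteDimensional_iff h0).mp hfd k
      refine ⟨m + 1, ?_⟩
      rw [rho_apply, rho_apply]
      simp only [lo, hi] at hm ⊢
      push_cast
      linear_combination hm
    rw [h.finiteDimensional_iff h0] at hfd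
    exact ⟨h.isRegularWeight_iff.mpr hfd.injective, h.isWMaximal_iff.mpr hfd.antitone,
      h.isIntegralWeight⟩

/-! ### Boundedness in shifted coordinates -/

/-- Strictly decreasing after the deletion of one entry. -/
def AlmostAnti (a : Fin n → ℤ) : Prop := ∃ p, ∀ i j, i ≠ p → j ≠ p → i < j → a j < a i

theorem IsShift.isBoundedWeight_of_almostAnti (h0 : 0 < n) {lam : Weight n} {c : ℂ}
    {a : Fin n → ℤ} (h : IsShift lam c a) (ha : AlmostAnti a) : IsBoundedWeight lam := by
  obtain ⟨p, hp⟩ := ha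
  -- The entry of ν at p is arbitrary, because the oscillator parameter `lam p - X` is free. Copying
  -- a neighbouring entry of ν keeps ν dominant; for n = 1 there is no neighbour and 0 serves.
  let X : ℂ := if hp0 : 0 < p.val then lam ⟨p.val - 1, by omega⟩ + 1 else
    if h1 : 1 < n then lam ⟨1, h1⟩ else 0
  let ν : Weight n := fun i => if i < p then lam i + 1 else if i = p then X else lam i
  have e : lam = oscWeight p (lam p - X) + ν := by
    funext i
    simp only [Pi.add_apply, oscWeight, ν]
    rcases lt_trichotomy i p with hi | hi | hi
    · simp [hi]
    · simp [hi]
    · simp [hi.not_gt, hi.ne']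
  rw [e]
  refine isBoundedWeight_osc_add h0 p _ fun k => ?_
  have step : ∀ i j : Fin n, i ≠ p → j ≠ p → i < j → ∃ m : ℕ, lam i - lam j = (m : ℂ) + 1 + i.val - j.val := by
    intro i j hi hj hij
    have h1 := hp i j hi hj hij
    refine ⟨(a i - a j - 1).toNat, ?_⟩
    have h2 : a i - a j = ((a i - a j - 1).toNat : ℤ) + 1 := by omega
    have h3 : ((a i - a j : ℤ) : ℂ) = ((a i - a j - 1).toNat : ℂ) + 1 := by
      exact_mod_cast congrArg (Int.cast : ℤ → ℂ) h2
    rw [h.sub_eq]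
    push_cast at h3 ⊢
    linear_combination h3
  have hlh := lo_lt_hi k
  have hlv : (lo k : Fin n).val = k.val := rfl
  have hhv : (hi k : Fin n).val = k.val + 1 := rfl
  rcases lt_trichotomy (hi k) p with h1 | h1 | h1
  · obtain ⟨m, hm⟩ := step (lo k) (hi k) (hlh.trans h1).ne h1.ne hlh
    refine ⟨m, ?_⟩
    simp only [ν, if_pos (hlh.trans h1), if_pos h1]
    rw [hlv, hhv] at hm
    push_cast at hm
    linear_combination hm
  · refine ⟨0, ?_⟩
    have h2 : lo k < p := h1 ▸ hlh
    have h3 : 0 < p.val := by rw [← h1, hhv]; omega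
    have h4 : (⟨p.val - 1, by omega⟩ : Fin n) = lo k := Fin.ext (by
      have : p.val = k.val + 1 := by rw [← h1, hhv]
      simp only [lo]; omega)
    simp only [ν, if_pos h2, h1, lt_irrefl, if_false, if_true, X, dif_pos h3, h4]
    simp
  · rcases eq_or_ne (lo k) p with h2 | h2
    · by_cases h3 : 0 < p.val
      · have h5 : (⟨p.val - 1, by omega⟩ : Fin n) < p := by rw [Fin.lt_def]; simp only; omega
        obtain ⟨m, hm⟩ := step ⟨p.val - 1, by omega⟩ (hi k) h5.ne h1.ne' (h5.trans h1)
        refine ⟨m, ?_⟩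
        simp only [ν, h2, lt_irrefl, if_false, if_true, X, dif_pos h3, h1.not_gt, h1.ne']
        rw [hhv] at hm
        have h6 : p.val = k.val := by rw [← h2]; rfl
        simp only [Nat.cast_sub h3, ← h6] at hm
        push_cast [Nat.cast_sub (show 1 ≤ p.val from h3)] at hm
        linear_combination hm
      · have h6 : p.val = k.val := by rw [← h2]; rfl
        have hn1 : 1 < n := by have := k.2; omega
        have h7 : (⟨1, hn1⟩ : Fin n) = hi k := Fin.ext (by rw [hhv]; simp only; omega)
        refine ⟨0, ?_⟩
        simp only [ν, h2, lt_irrefl, if_false, if_true, X, dif_neg h3, dif_pos hn1, h1.not_gt,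
          h1.ne', h7]
        simp
    · have h3 : p < lo k := by
        rw [Fin.lt_def] at h1 ⊢
        have : (lo k : Fin n).val ≠ p.val := fun h => h2 (Fin.ext h)
        rw [hhv] at h1
        rw [hlv] at this ⊢
        omega
      obtain ⟨m, hm⟩ := step (lo k) (hi k) h3.ne' h1.ne' hlh
      refine ⟨m, ?_⟩
      simp only [ν, h3.not_gt, h1.not_gt, h3.ne', h1.ne', if_false]
      rw [hlv, hhv] at hm
      push_cast at hm
      linear_combination hm

theorem IsShift.eq_of_not_lt {lam : Weight n} {c : ℂ} {a : Fin n → ℤ} (h : IsShift lam c a)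
    (hb : IsBoundedWeight lam) {k l : Fin (n - 1)} (hk : a (lo k) ≤ a (hi k))
    (hl : a (lo l) ≤ a (hi l)) : k = l := by
  have key : ∀ k l : Fin (n - 1), a (lo k) ≤ a (hi k) → a (lo l) ≤ a (hi l) → ¬ k < l := by
    intro k l hk hl hkl
    refine not_isBoundedWeight_of_two (fun i j => ⟨_, h.sub_eq i j⟩) hkl ?_ ?_ hb
    · rw [h.actsFin_iff]; exact hk.not_gt
    · rw [h.actsFin_iff]; exact hl.not_gt
  rcases lt_trichotomy k l with h1 | h1 | h1
  · exact absurd h1 (key k l hk hl)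
  · exact h1
  · exact absurd h1 (key l k hl hk)

/-- At most one position k fails to descend. Deleting `lo k` or `hi k` works unless both deletions
leave a gap that does not descend; in that case the weight reflected at k is bounded too but has two
non-descents. -/
theorem IsShift.almostAnti_of_isBoundedWeight (h0 : 0 < n) {lam : Weight n} {c : ℂ}
    {a : Fin n → ℤ} (h : IsShift lam c a) (hb : IsBoundedWeight lam) : AlmostAnti a := by
  by_cases hall : ∀ k : Fin (n - 1), a (hi k) < a (lo k)
  · exact ⟨⟨0, h0⟩, fun i j _ _ hij => IsShift.strictAnti_of_simple hij fun k _ _ => hall k⟩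
  push Not at hall
  obtain ⟨k, hk⟩ := hall
  have hdesc : ∀ l : Fin (n - 1), l ≠ k → a (hi l) < a (lo l) := by
    intro l hl
    by_contra hcon
    exact hl (h.eq_of_not_lt hb (not_lt.mp hcon) hk)
  have hkn := k.2
  have chain : ∀ i j : Fin n, i < j → (j.val ≤ k.val ∨ k.val + 1 ≤ i.val) → a j < a i := by
    intro i j hij hor
    refine IsShift.strictAnti_of_simple hij fun l h1 h2 => hdesc l ?_
    rintro rfl
    rw [Fin.le_def] at h1 h2
    simp only [lo, hi] at h1 h2
    omega
  have chain' : ∀ i j : Fin n, i ≤ j → (j.val ≤ k.val ∨ k.val + 1 ≤ i.val) → a j ≤ a i := by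
    intro i j hij hor
    rcases hij.lt_or_eq with h1 | h1
    · exact (chain i j h1 hor).le
    · rw [h1]
  -- Quantifying over x makes the condition vacuous at an end of the sequence, where nothing has to
  -- be checked.
  have hor : (∀ x : Fin n, x.val + 1 = k.val → a (hi k) < a x) ∨
      (∀ x : Fin n, x.val = k.val + 2 → a x < a (lo k)) := by
    by_contra hcon
    push Not at hcon
    obtain ⟨⟨x, hx1, hx2⟩, ⟨y, hy1, hy2⟩⟩ := hcon
    have hlt : a (lo k) < a (hi k) := by
      refine lt_of_lt_of_le (chain x (lo k) ?_ (Or.inl le_rfl)) hx2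
      rw [Fin.lt_def]; simp only [lo]; omega
    obtain ⟨t, ht⟩ : ∃ t : ℕ, a (hi k) = a (lo k) + t + 1 := ⟨(a (hi k) - a (lo k) - 1).toNat, by omega⟩
    obtain ⟨C, hC⟩ := (isBoundedWeight_iff lam).mp hb
    have hC' := mult_reflect (k := k) (t := t) (by
      rw [h.sub_eq, ht]
      simp only [lo, hi]
      push_cast
      ring) hC
    have hb' := (isBoundedWeight_iff _).mpr ⟨C, hC'⟩
    set a' : Fin n → ℤ := fun i => if i = lo k then a (hi k) else if i = hi k then a (lo k) else a i
      with ha'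
    have h' : IsShift (lam + ((t + 1 : ℕ) : ℂ) • root (lo k) (hi k)) c a' := by
      intro i
      have := h i
      simp only [Pi.add_apply, Pi.smul_apply, root_apply, smul_eq_mul, ha']
      by_cases h1 : i = lo k
      · subst h1
        simp only [if_true, lo_ne_hi k, if_false, ht]
        push_cast
        linear_combination this
      · by_cases h2 : i = hi k
        · subst h2
          simp only [if_true, h1, if_false]
          rw [ht] at this
          push_cast at this ⊢
          linear_combination this
        · simp only [h1, h2, if_false]
          linear_combination this
    have hx : a' x = a x := by
      simp only [ha']
      rw [if_neg, if_neg] <;> rintro rfl <;> simp only [lo, hi] at hx1 <;> omega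
    have hy : a' y = a y := by
      simp only [ha']
      rw [if_neg, if_neg] <;> rintro rfl <;> simp only [lo, hi] at hy1 <;> omega
    have hlo : a' (lo k) = a (hi k) := by simp [ha']
    have hhi : a' (hi k) = a (lo k) := by simp [ha', (lo_ne_hi k).symm]
    have hyn := y.2
    have e1 : (lo ⟨k.val - 1, by omega⟩ : Fin n) = x := Fin.ext (by simp only [lo]; omega)
    have e2 : (hi ⟨k.val - 1, by omega⟩ : Fin n) = lo k := Fin.ext (by simp only [lo, hi]; omega)
    have e3 : (lo ⟨k.val + 1, by omega⟩ : Fin n) = hi k := Fin.ext (by simp only [lo, hi])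
    have e4 : (hi ⟨k.val + 1, by omega⟩ : Fin n) = y := Fin.ext (by simp only [hi]; omega)
    -- After the swap, the pairs on either side of position k both fail to descend.
    have := h'.eq_of_not_lt hb' (k := ⟨k.val - 1, by omega⟩) (l := ⟨k.val + 1, by omega⟩)
      (by rw [e1, e2, hx, hlo]; exact hx2) (by rw [e3, e4, hy, hhi]; exact hy2)
    have := congrArg Fin.val this
    simp only at this
    omega
  rcases hor with hor | hor
  · refine ⟨lo k, fun i j hi' hj' hij => ?_⟩
    have h1 : i.val ≠ k.val := fun h => hi' (Fin.ext h)
    have h2 : j.val ≠ k.val := fun h => hj' (Fin.ext h)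
    rw [Fin.lt_def] at hij
    by_cases h3 : j.val ≤ k.val ∨ k.val + 1 ≤ i.val
    · exact chain i j hij h3
    · have h4 := hor ⟨k.val - 1, by omega⟩ (by simp only; omega)
      have h5 := chain' i ⟨k.val - 1, by omega⟩ (by rw [Fin.le_def]; simp only; omega)
        (Or.inl (by simp only; omega))
      have h6 := chain' (hi k) j (by rw [Fin.le_def]; simp only [hi]; omega)
        (Or.inr (by simp only [hi]; omega))
      omega
  · refine ⟨hi k, fun i j hi' hj' hij => ?_⟩
    have h1 : i.val ≠ k.val + 1 := fun h => hi' (Fin.ext h)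
    have h2 : j.val ≠ k.val + 1 := fun h => hj' (Fin.ext h)
    rw [Fin.lt_def] at hij
    by_cases h3 : j.val ≤ k.val ∨ k.val + 1 ≤ i.val
    · exact chain i j hij h3
    · have h4 := hor ⟨k.val + 2, by omega⟩ rfl
      have h5 := chain' i (lo k) (by rw [Fin.le_def]; simp only [lo]; omega)
        (Or.inl (by simp only [lo]; omega))
      have h6 := chain' ⟨k.val + 2, by omega⟩ j (by rw [Fin.le_def]; simp only; omega)
        (Or.inr (by simp only; omega))
      omega

theorem mem_injRoots_iff (lam : Weight n) (p : Fin n × Fin n) :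
    p ∈ injRoots (n := n) (L lam) ↔ p.1 ≠ p.2 ∧ ¬ ActsFin lam p.1 p.2 := by
  refine and_congr_right fun hne => ?_
  constructor
  · intro h hf
    obtain ⟨N, hN⟩ := hf (hwv lam)
    refine pow_ne_zero_of_injective (fun m hm => ?_) (hwv_ne_zero lam) N hN
    by_contra h0
    exact h m h0 hm
  · intro h m hm h0
    exact hm (op_injective_of_not_actsFin hne h m h0)

theorem mem_finRoots_iff (lam : Weight n) (p : Fin n × Fin n) :
    p ∈ finRoots (n := n) (L lam) ↔ p.1 ≠ p.2 ∧ ActsFin lam p.1 p.2 := by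
  have key : ∀ (N : ℕ) (m : L lam), (fun x : L lam => ⁅(E p.1 p.2 : gl n), x⁆)^[N] m =
      (op (repL lam) p.1 p.2 ^ N) m := by
    intro N m
    rw [Module.End.pow_apply]
    rfl
  refine and_congr_right fun _ => forall_congr' fun m => ?_
  simp only [key]
  constructor
  · rintro ⟨N, _, hN⟩; exact ⟨N, hN⟩
  · rintro ⟨N, hN⟩
    exact ⟨N + 1, by omega, by rw [pow_succ', Module.End.mul_apply, hN, map_zero]⟩

/-- Boundedness leaves k as the only non-descent. A negative root vector is then locally nilpotent
iff its interval of simple roots avoids k. -/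
theorem IsShift.isBoundedOfType_iff {lam : Weight n} {c : ℂ} {a : Fin n → ℤ} (h : IsShift lam c a)
    (k : Fin (n - 1)) : IsBoundedOfType k lam ↔ IsBoundedWeight lam ∧ a (lo k) ≤ a (hi k) := by
  constructor
  · rintro ⟨_, hb, hinj, _⟩
    refine ⟨hb, ?_⟩
    have h1 : ((hi k, lo k) : Fin n × Fin n) ∈ injRoots (n := n) (L lam) := by
      rw [hinj]
      change (lo k).val ≤ k.val ∧ k.val < (hi k).val
      simp [lo, hi]
    have h2 := ((mem_injRoots_iff lam _).mp h1).2
    rw [h.actsFin_iff] at h2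
    exact not_lt.mp h2
  · rintro ⟨hb, hk⟩
    have key : ∀ i j : Fin n, i ≠ j → (ActsFin lam i j ↔ ¬ (j.val ≤ k.val ∧ k.val < i.val)) := by
      intro i j hij
      constructor
      · rintro hf ⟨h1, h2⟩
        have := hf.simple_of_le (k := k) (by rw [Fin.le_def]; exact h1) (by rw [Fin.le_def]; exact h2)
        rw [h.actsFin_iff] at this
        exact absurd this hk.not_gt
      · intro hn
        rcases lt_or_gt_of_ne hij with h1 | h1
        · exact actsFin_of_lt h1
        · refine actsFin_of_forall_simple h1 fun l h2 h3 => ?_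
          rw [h.actsFin_iff]
          by_contra hcon
          have := h.eq_of_not_lt hb (not_lt.mp hcon) hk
          subst this
          exact hn ⟨h2, h3⟩
    refine ⟨h.isIntegralWeight, hb, ?_, ?_⟩
    · ext ⟨i, j⟩
      rw [mem_injRoots_iff]
      change i ≠ j ∧ ¬ ActsFin lam i j ↔ j.val ≤ k.val ∧ k.val < i.val
      constructor
      · rintro ⟨h1, h2⟩
        rw [key i j h1, not_not] at h2
        exact h2
      · intro h1
        have hij : i ≠ j := by rintro rfl; omega
        exact ⟨hij, by rw [key i j hij, not_not]; exact h1⟩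
    · ext ⟨i, j⟩
      rw [mem_finRoots_iff]
      change i ≠ j ∧ ActsFin lam i j ↔
        (i ≠ j ∧ ((i.val ≤ k.val ∧ j.val ≤ k.val) ∨ (k.val < i.val ∧ k.val < j.val))) ∨
          (i.val ≤ k.val ∧ k.val < j.val)
      constructor
      · rintro ⟨h1, h2⟩
        rw [key i j h1] at h2
        by_cases h3 : i.val ≤ k.val ∧ k.val < j.val
        · exact Or.inr h3
        · exact Or.inl ⟨h1, by omega⟩
      · intro h1
        have hij : i ≠ j := by
          rcases h1 with h1 | h1
          · exact h1.1
          · rintro rfl; omega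
        refine ⟨hij, ?_⟩
        rw [key i j hij]
        omega

end Shift

/-! ### Permutations moving one point -/

section Moves

variable {n : ℕ}

/-- `σ` preserves the order of all points other than `p`. -/
def MonoOff (σ : Equiv.Perm (Fin n)) (p : Fin n) : Prop :=
  ∀ x y, x ≠ p → y ≠ p → x < y → σ x < σ y

/-- Off p both permutations are strictly monotone with the same range, hence equal. -/
theorem MonoOff.unique {σ τ : Equiv.Perm (Fin n)} {p : Fin n} (hσ : MonoOff σ p)
    (hτ : MonoOff τ p) (h : σ p = τ p) : σ = τ := by
  have range_eq : ∀ σ : Equiv.Perm (Fin n),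
      Set.range (fun x : {x // x ≠ p} => σ x.1) = {y | y ≠ σ p} := by
    intro σ
    ext y
    constructor
    · rintro ⟨x, rfl⟩
      exact fun h => x.2 (σ.injective h)
    · intro hy
      exact ⟨⟨σ.symm y, fun h => hy (by rw [← h, σ.apply_symm_apply])⟩, σ.apply_symm_apply y⟩
  have h1 : StrictMono (fun x : {x // x ≠ p} => σ x.1) := fun x y hxy => hσ x y x.2 y.2 hxy
  have h2 : StrictMono (fun x : {x // x ≠ p} => τ x.1) := fun x y hxy => hτ x y x.2 y.2 hxy
  have h3 := (h1.range_inj h2).mp (by rw [range_eq, range_eq, h])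
  ext x
  by_cases hx : x = p
  · rw [hx, h]
  · exact congrArg Fin.val (congrFun h3 ⟨x, hx⟩)

/-- The map that moves `p` to `q` and preserves the order of the other numbers. -/
def moveVal (p q x : ℕ) : ℕ :=
  if x = p then q else if p < x ∧ x ≤ q then x - 1 else if q ≤ x ∧ x < p then x + 1 else x

theorem s_apply_val (k : Fin (n - 1)) (x : Fin n) : (s k x).val = if x.val = k.val then k.val + 1
    else if x.val = k.val + 1 then k.val else x.val := by
  unfold s
  rw [Equiv.swap_apply_def]
  simp only [Fin.ext_iff, lo, hi]
  split_ifs <;> simp_all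

theorem s_inv (k : Fin (n - 1)) : (s k : Equiv.Perm (Fin n))⁻¹ = s k := Equiv.swap_inv _ _

theorem filter_finRange_self (i : Fin (n - 1)) :
    (List.finRange (n - 1)).filter (fun j => i ≤ j ∧ j ≤ i) = [i] := by
  refine (List.Pairwise.filter _ (List.pairwise_lt_finRange _)).eq_of_mem_iff
    (List.pairwise_singleton _ _) fun x => ?_
  simp only [List.mem_filter, decide_eq_true_eq, List.mem_singleton, Fin.le_def,
    List.mem_finRange, Fin.ext_iff, true_and]
  omega

theorem prodS_self (i : Fin (n - 1)) : prodS i i = s i := by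
  rw [prodS, if_pos le_rfl, filter_finRange_self]
  simp

theorem prodS_succ {i k l : Fin (n - 1)} (hik : i ≤ k) (hl : l.val = k.val + 1) :
    prodS i l = prodS i k * s l := by
  have h : (List.finRange (n - 1)).filter (fun j => i ≤ j ∧ j ≤ l) =
      (List.finRange (n - 1)).filter (fun j => i ≤ j ∧ j ≤ k) ++ [l] := by
    refine (List.Pairwise.filter _ (List.pairwise_lt_finRange _)).eq_of_mem_iff
      (List.pairwise_append.mpr ⟨List.Pairwise.filter _ (List.pairwise_lt_finRange _),
        List.pairwise_singleton _ _, fun x hx y hy => ?_⟩) fun x => ?_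
    · simp only [List.mem_filter, decide_eq_true_eq, List.mem_singleton, Fin.le_def] at hx hy
      rw [hy, Fin.lt_def]
      omega
    · simp only [List.mem_filter, decide_eq_true_eq, List.mem_singleton, Fin.le_def,
        List.mem_finRange, List.mem_append, Fin.ext_iff, true_and]
      rw [Fin.le_def] at hik
      omega
  rw [prodS, prodS, if_pos hik, if_pos (hik.trans (by rw [Fin.le_def]; omega)), h]
  simp

theorem prodS_pred {i k l : Fin (n - 1)} (hik : k ≤ i) (hl : k.val = l.val + 1) :
    prodS i l = prodS i k * s l := by
  have h : (List.finRange (n - 1)).filter (fun j => l ≤ j ∧ j ≤ i) =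
      l :: (List.finRange (n - 1)).filter (fun j => k ≤ j ∧ j ≤ i) := by
    refine (List.Pairwise.filter _ (List.pairwise_lt_finRange _)).eq_of_mem_iff
      (List.pairwise_cons.mpr ⟨fun x hx => ?_,
        List.Pairwise.filter _ (List.pairwise_lt_finRange _)⟩) fun x => ?_
    · simp only [List.mem_filter, decide_eq_true_eq, Fin.le_def] at hx
      rw [Fin.lt_def]
      omega
    · simp only [List.mem_filter, decide_eq_true_eq, Fin.le_def,
        List.mem_finRange, List.mem_cons, Fin.ext_iff, true_and]
      rw [Fin.le_def] at hik
      omega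
  have hli : ¬ i ≤ l := by rw [Fin.le_def] at hik ⊢; omega
  rcases hik.lt_or_eq with h1 | rfl
  · rw [prodS, prodS, if_neg h1.not_ge, if_neg hli, h]
    simp
  · rw [prodS_self, prodS, if_neg hli, h, filter_finRange_self]
    simp

theorem prodS_inv_val_of_le {i k : Fin (n - 1)} (hik : i ≤ k) (x : Fin n) :
    ((prodS i k)⁻¹ x).val = moveVal i.val (k.val + 1) x.val := by
  have : ∀ d : ℕ, ∀ l : Fin (n - 1), l.val = i.val + d →
      ((prodS i l)⁻¹ x).val = moveVal i.val (l.val + 1) x.val := by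
    intro d
    induction d with
    | zero =>
      intro l hl
      rw [show l = i from Fin.ext hl, prodS_self, s_inv, s_apply_val]
      unfold moveVal
      split_ifs <;> omega
    | succ d ih =>
      intro l hl
      have h1 := ih ⟨i.val + d, by omega⟩ rfl
      rw [prodS_succ (k := ⟨i.val + d, by omega⟩) (by rw [Fin.le_def]; simp) hl, mul_inv_rev, s_inv,
        Equiv.Perm.mul_apply, s_apply_val, h1]
      unfold moveVal
      simp only
      split_ifs <;> omega
  exact this (k.val - i.val) k (by rw [Fin.le_def] at hik; omega)

theorem prodS_inv_val_of_ge {i k : Fin (n - 1)} (hik : k ≤ i) (x : Fin n) :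
    ((prodS i k)⁻¹ x).val = moveVal (i.val + 1) k.val x.val := by
  have : ∀ d : ℕ, ∀ l : Fin (n - 1), l.val + d = i.val →
      ((prodS i l)⁻¹ x).val = moveVal (i.val + 1) l.val x.val := by
    intro d
    induction d with
    | zero =>
      intro l hl
      rw [show l = i from Fin.ext hl, prodS_self, s_inv, s_apply_val]
      unfold moveVal
      split_ifs <;> omega
    | succ d ih =>
      intro l hl
      have hi := i.2
      have h1 := ih ⟨l.val + 1, by omega⟩ (by simp only; omega)
      rw [prodS_pred (k := ⟨l.val + 1, by omega⟩) (by rw [Fin.le_def]; simp only; omega) rfl,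
        mul_inv_rev, s_inv, Equiv.Perm.mul_apply, s_apply_val, h1]
      unfold moveVal
      simp only
      split_ifs <;> omega
  exact this (i.val - k.val) k (by rw [Fin.le_def] at hik; omega)

theorem prodS_inv_lo {i k : Fin (n - 1)} (hik : i ≤ k) : (prodS i k)⁻¹ (lo i) = hi k := by
  apply Fin.ext
  rw [prodS_inv_val_of_le hik]
  simp [moveVal, lo, hi]

theorem prodS_inv_hi {i k : Fin (n - 1)} (hik : k ≤ i) : (prodS i k)⁻¹ (hi i) = lo k := by
  apply Fin.ext
  rw [prodS_inv_val_of_ge hik]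
  simp [moveVal, lo, hi]

theorem prodS_inv_hi_of_le {i k : Fin (n - 1)} (hik : i ≤ k) : (prodS i k)⁻¹ (hi i) = lo i := by
  apply Fin.ext
  rw [prodS_inv_val_of_le hik]
  rw [Fin.le_def] at hik
  simp [moveVal, lo, hi, hik]

theorem prodS_inv_lo_of_ge {i k : Fin (n - 1)} (hik : k ≤ i) : (prodS i k)⁻¹ (lo i) = hi i := by
  apply Fin.ext
  rw [prodS_inv_val_of_ge hik]
  rw [Fin.le_def] at hik
  simp [moveVal, lo, hi, hik]

theorem monoOff_prodS_inv_lo {i k : Fin (n - 1)} (hik : i ≤ k) :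
    MonoOff (prodS i k)⁻¹ (lo i) := by
  intro x y hx hy hxy
  rw [Fin.lt_def] at hxy ⊢
  rw [prodS_inv_val_of_le hik, prodS_inv_val_of_le hik]
  simp only [ne_eq, Fin.ext_iff, lo] at hx hy
  unfold moveVal
  split_ifs <;> omega

theorem monoOff_prodS_inv_hi {i k : Fin (n - 1)} (hik : k ≤ i) :
    MonoOff (prodS i k)⁻¹ (hi i) := by
  intro x y hx hy hxy
  rw [Fin.lt_def] at hxy ⊢
  rw [prodS_inv_val_of_ge hik, prodS_inv_val_of_ge hik]
  simp only [ne_eq, Fin.ext_iff, hi] at hx hy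
  unfold moveVal
  split_ifs <;> omega

/-- The inverse of `prodS i k` reverses the order of the adjacent points `lo i` and `hi i`. This
places the non-descent, and therefore the type, at i. -/
theorem antitone_prodS_ascent {a : Fin n → ℤ} (ha : Antitone a) (i k : Fin (n - 1)) :
    a ((prodS i k)⁻¹ (lo i)) ≤ a ((prodS i k)⁻¹ (hi i)) := by
  apply ha
  rcases le_total i k with hik | hik
  · rw [prodS_inv_lo hik, prodS_inv_hi_of_le hik, Fin.le_def]
    rw [Fin.le_def] at hik
    simp only [lo, hi]
    omega
  · rw [prodS_inv_hi hik, prodS_inv_lo_of_ge hik, Fin.le_def]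
    rw [Fin.le_def] at hik
    simp only [lo, hi]
    omega

theorem prodS_right_injective (i : Fin (n - 1)) :
    Function.Injective (fun k : Fin (n - 1) => (prodS i k : Equiv.Perm (Fin n))) := by
  intro k l h
  have h1 : ∀ x, (prodS i k)⁻¹ x = (prodS i l)⁻¹ x := fun x => by
    rw [show prodS i k = prodS i l from h]
  have h2 := h1 (lo i)
  have h3 := h1 (hi i)
  apply Fin.ext
  rcases le_total i k with hk | hk <;> rcases le_total i l with hl | hl
  · rw [prodS_inv_lo hk, prodS_inv_lo hl] at h2
    simpa only [hi, Fin.mk.injEq, add_left_inj] using h2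
  · rw [prodS_inv_lo hk, prodS_inv_lo_of_ge hl] at h2
    rw [prodS_inv_hi_of_le hk, prodS_inv_hi hl] at h3
    simp only [lo, hi, Fin.mk.injEq] at h2 h3
    omega
  · rw [prodS_inv_lo hl, prodS_inv_lo_of_ge hk] at h2
    rw [prodS_inv_hi_of_le hl, prodS_inv_hi hk] at h3
    simp only [lo, hi, Fin.mk.injEq] at h2 h3
    omega
  · rw [prodS_inv_hi hk, prodS_inv_hi hl] at h3
    simpa only [lo, Fin.mk.injEq] using h3

theorem MonoOff.eq_prodS_inv {σ : Equiv.Perm (Fin n)} {p : Fin n} (h : MonoOff σ p)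
    (hp : σ p ≠ p) : ∃ i k, σ = (prodS i k)⁻¹ := by
  rcases lt_or_gt_of_ne hp with h1 | h1 <;> rw [Fin.lt_def] at h1
  · have hp' : p = hi ⟨p.val - 1, by omega⟩ := Fin.ext (by simp only [hi]; omega)
    rw [hp'] at h
    have hle : (⟨(σ p).val, by omega⟩ : Fin (n - 1)) ≤ ⟨p.val - 1, by omega⟩ := by
      rw [Fin.le_def]; simp only; omega
    refine ⟨⟨p.val - 1, by omega⟩, ⟨(σ p).val, by omega⟩,
      h.unique (monoOff_prodS_inv_hi hle) ?_⟩
    rw [prodS_inv_hi hle, ← hp']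
    rfl
  · have hp' : p = lo ⟨p.val, by omega⟩ := rfl
    rw [hp'] at h
    have hle : (⟨p.val, by omega⟩ : Fin (n - 1)) ≤ ⟨(σ p).val - 1, by omega⟩ := by
      rw [Fin.le_def]; simp only; omega
    refine ⟨⟨p.val, by omega⟩, ⟨(σ p).val - 1, by omega⟩,
      h.unique (monoOff_prodS_inv_lo hle) ?_⟩
    rw [prodS_inv_lo hle, ← hp']
    exact Fin.ext (by simp only [hi]; omega)

theorem MonoOff.eq_one {σ : Equiv.Perm (Fin n)} {p : Fin n} (h : MonoOff σ p) (hp : σ p = p) :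
    σ = 1 :=
  h.unique (τ := 1) (fun _ _ _ _ hxy => hxy) hp

end Moves

/-! ### Bounded weights in the orbit of a regular maximal weight -/

section Orbits

variable {n : ℕ} {lam : Weight n} {c : ℂ} {a : Fin n → ℤ}

theorem IsShift.isBoundedOfType_prodS_iff (h : IsShift lam c a) (ha : Antitone a)
    {i k l : Fin (n - 1)} (hb : IsBoundedWeight (dot (prodS i k) lam)) :
    IsBoundedOfType l (dot (prodS i k) lam) ↔ l = i := by
  have h1 := h.dot_shift (prodS i k)
  rw [h1.isBoundedOfType_iff l]
  constructor
  · rintro ⟨_, h2⟩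
    exact h1.eq_of_not_lt hb h2 (antitone_prodS_ascent ha i k)
  · rintro rfl
    exact ⟨hb, antitone_prodS_ascent ha l k⟩

theorem IsShift.isBoundedWeight_prodS (h0 : 0 < n) (h : IsShift lam c a) (ha : StrictAnti a)
    (i k : Fin (n - 1)) : IsBoundedWeight (dot (prodS i k) lam) := by
  refine (h.dot_shift (prodS i k)).isBoundedWeight_of_almostAnti h0 ?_
  rcases le_total i k with hik | hik
  · exact ⟨lo i, fun x y hx hy hxy => ha (monoOff_prodS_inv_lo hik x y hx hy hxy)⟩
  · exact ⟨hi i, fun x y hx hy hxy => ha (monoOff_prodS_inv_hi hik x y hx hy hxy)⟩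

theorem IsShift.dot_prodS_ne (h : IsShift lam c a) (ha : StrictAnti a) (i k : Fin (n - 1)) :
    dot (prodS i k) lam ≠ lam := by
  rw [ne_eq, (h.dot_shift (prodS i k)).eq_iff h]
  intro h1
  have h2 := antitone_prodS_ascent ha.antitone i k
  rw [show a ((prodS i k)⁻¹ (lo i)) = a (lo i) from congrFun h1 _,
    show a ((prodS i k)⁻¹ (hi i)) = a (hi i) from congrFun h1 _] at h2
  exact h2.not_gt (ha (lo_lt_hi i))

/-- Here p is the deleted position. Two equal entries cannot both survive in a strictly decreasing
sequence, so the deleted one belongs to every equal pair. -/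
theorem IsShift.exists_of_isBoundedWeight (h0 : 0 < n) (h : IsShift lam c a)
    {w : Equiv.Perm (Fin n)} (hb : IsBoundedWeight (dot w lam)) :
    ∃ p, (Antitone a → MonoOff w⁻¹ p) ∧ ∀ x y, x < y → a x = a y → w⁻¹ p = x ∨ w⁻¹ p = y := by
  obtain ⟨p, hp⟩ := (h.dot_shift w).almostAnti_of_isBoundedWeight h0 hb
  have inv : ∀ x, w⁻¹ (w x) = x := w.symm_apply_apply
  refine ⟨p, fun ha x y hx hy hxy => ?_, fun x y hxy hax => ?_⟩
  · exact lt_of_not_ge fun hle => (hp x y hx hy hxy).not_ge (ha hle)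
  · by_contra hcon
    push Not at hcon
    have hx : w x ≠ p := fun e => hcon.1 (by rw [← e, inv])
    have hy : w y ≠ p := fun e => hcon.2 (by rw [← e, inv])
    rcases lt_or_gt_of_ne (fun e => hxy.ne (w.injective e)) with h1 | h1
    · have := hp _ _ hx hy h1
      simp only [inv] at this
      omega
    · have := hp _ _ hy hx h1
      simp only [inv] at this
      omega

theorem IsShift.regular_orbit (h0 : 0 < n) (h : IsShift lam c a) (ha : StrictAnti a) :
    {μ | μ ∈ orbit lam ∧ μ ≠ lam ∧ IsBoundedWeight μ} =
      {μ | ∃ i k : Fin (n - 1), μ = dot (prodS i k) lam} := by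
  ext μ
  constructor
  · rintro ⟨⟨w, rfl⟩, hne, hb⟩
    obtain ⟨p, hp, -⟩ := h.exists_of_isBoundedWeight h0 hb
    replace hp := hp ha.antitone
    have hpp : w⁻¹ p ≠ p := fun e => hne (by
      rw [inv_eq_one.mp (hp.eq_one e)]
      change dot 1 lam = lam
      rw [(h.dot_shift 1).eq_iff h]
      rfl)
    obtain ⟨i, k, hw⟩ := hp.eq_prodS_inv hpp
    exact ⟨i, k, by rw [inv_inj.mp hw]⟩
  · rintro ⟨i, k, rfl⟩
    exact ⟨⟨_, rfl⟩, h.dot_prodS_ne ha i k, h.isBoundedWeight_prodS h0 ha i k⟩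

theorem IsShift.regular_ncard (h0 : 0 < n) (h : IsShift lam c a) (ha : StrictAnti a) :
    {μ | ∃ i k : Fin (n - 1), μ = dot (prodS i k) lam}.ncard = (n - 1) ^ 2 := by
  have e : {μ | ∃ i k : Fin (n - 1), μ = dot (prodS i k) lam} =
      (fun q : Fin (n - 1) × Fin (n - 1) => dot (prodS q.1 q.2) lam) '' Set.univ := by
    ext μ
    simp [eq_comm]
  rw [e, Set.ncard_image_of_injective, Set.ncard_univ]
  · simp [sq]
  · rintro ⟨i, k⟩ ⟨j, l⟩ hq
    simp only at hq
    have hb := h.isBoundedWeight_prodS h0 ha i k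
    -- The type recovers the first index; regularity then recovers the permutation, and with it the
    -- second.
    have h1 := (h.isBoundedOfType_prodS_iff ha.antitone (l := i) hb).mpr rfl
    rw [hq, h.isBoundedOfType_prodS_iff ha.antitone (hq ▸ hb)] at h1
    subst h1
    rw [(h.dot_shift _).eq_iff (h.dot_shift _)] at hq
    have h2 : (prodS i k)⁻¹ = (prodS i l)⁻¹ := Equiv.ext fun x => ha.injective (congrFun hq x)
    rw [prodS_right_injective i (inv_inj.mp h2)]

theorem IsShift.regular_type (h0 : 0 < n) (h : IsShift lam c a) (ha : StrictAnti a)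
    (i : Fin (n - 1)) :
    {μ | μ ∈ orbit lam ∧ IsBoundedOfType i μ} =
      {μ | ∃ k : Fin (n - 1), μ = dot (prodS i k) lam} := by
  ext μ
  constructor
  · rintro ⟨ho, ht⟩
    have hne : μ ≠ lam := by
      rintro rfl
      exact ((h.isBoundedOfType_iff i).mp ht).2.not_gt (ha (lo_lt_hi i))
    obtain ⟨j, k, rfl⟩ := (h.regular_orbit h0 ha).subset ⟨ho, hne, ht.2.1⟩
    rw [h.isBoundedOfType_prodS_iff ha.antitone ht.2.1] at ht
    subst ht
    exact ⟨k, rfl⟩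
  · rintro ⟨k, rfl⟩
    exact ⟨⟨_, rfl⟩,
      (h.isBoundedOfType_prodS_iff ha.antitone (h.isBoundedWeight_prodS h0 ha i k)).mpr rfl⟩

/-! ### Bounded weights in singular orbits -/

theorem IsShift.eq_of_stab (h : IsShift lam c a) {m : Fin (n - 1)}
    (hs : stab lam = {1, s m}) {x y : Fin n} (hxy : x < y) : a x = a y ↔ x = lo m ∧ y = hi m := by
  have hmem : ∀ {x y : Fin n}, a x = a y → Equiv.swap x y ∈ stab lam := by
    intro x y hxy
    rw [h.mem_stab_iff]
    intro k
    rw [Equiv.swap_inv, Equiv.swap_apply_def]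
    split_ifs with e1 e2
    · rw [e1, hxy]
    · rw [e2, hxy]
    · rfl
  constructor
  · intro hax
    have h1 := hmem hax
    rw [hs] at h1
    rcases h1 with h1 | h1
    · exact absurd (Equiv.swap_eq_one_iff.mp h1) hxy.ne
    · have h2 : s m x = y := by rw [← Set.mem_singleton_iff.mp h1, Equiv.swap_apply_left]
      have h3 := s_apply_val m x
      rw [h2] at h3
      rw [Fin.lt_def] at hxy
      simp only [Fin.ext_iff, lo, hi]
      split_ifs at h3 <;> omega
  · rintro ⟨rfl, rfl⟩
    have h1 : s m ∈ stab lam := by rw [hs]; exact Or.inr rfl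
    have h2 := (h.mem_stab_iff _).mp h1 (hi m)
    rwa [s_inv, s, Equiv.swap_apply_right] at h2

theorem IsShift.isBoundedWeight_prodS_of_stab (h0 : 0 < n) (h : IsShift lam c a) (ha : Antitone a)
    {m : Fin (n - 1)} (hs : stab lam = {1, s m}) (k : Fin (n - 1)) :
    IsBoundedWeight (dot (prodS k m) lam) := by
  have key : ∀ p, MonoOff (prodS k m)⁻¹ p →
      ((prodS k m)⁻¹ p = lo m ∨ (prodS k m)⁻¹ p = hi m) →
      IsBoundedWeight (dot (prodS k m) lam) := by
    intro p hp hq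
    refine (h.dot_shift (prodS k m)).isBoundedWeight_of_almostAnti h0
      ⟨p, fun x y hx hy hxy => ?_⟩
    have h1 := hp x y hx hy hxy
    refine lt_of_le_of_ne (ha h1.le) fun e => ?_
    obtain ⟨e1, e2⟩ := (h.eq_of_stab hs h1).mp e.symm
    rcases hq with hq | hq
    · exact hx ((prodS k m)⁻¹.injective (e1.trans hq.symm))
    · exact hy ((prodS k m)⁻¹.injective (e2.trans hq.symm))
  rcases le_total k m with hkm | hkm
  · exact key (lo k) (monoOff_prodS_inv_lo hkm) (Or.inr (prodS_inv_lo hkm))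
  · exact key (hi k) (monoOff_prodS_inv_hi hkm) (Or.inl (prodS_inv_hi hkm))

/-- Both w and w s_m give the same weight and move only p out of order: s_m exchanges two adjacent
values, one of which is the image of p. The inverses of these representatives send p to different
members of the repeated pair. -/
theorem IsShift.exists_eq_prodS_of_stab (h0 : 0 < n) (h : IsShift lam c a) (ha : Antitone a)
    {m : Fin (n - 1)} (hs : stab lam = {1, s m}) {w : Equiv.Perm (Fin n)}
    (hb : IsBoundedWeight (dot w lam)) : ∃ k, dot w lam = dot (prodS k m) lam := by
  have hsm : dot (s m) lam = lam := by
    change s m ∈ stab lam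
    rw [hs]
    exact Or.inr rfl
  have hlh : a (lo m) = a (hi m) := (h.eq_of_stab hs (lo_lt_hi m)).mpr ⟨rfl, rfl⟩
  have fix : ∀ x, a (s m x) = a x := fun x => by
    have := (h.mem_stab_iff (s m)).mp hsm x
    rwa [s_inv] at this
  have hw : dot (w * s m) lam = dot w lam := by
    rw [(h.dot_shift _).eq_iff (h.dot_shift _)]
    funext x
    rw [mul_inv_rev, s_inv, Equiv.Perm.mul_apply, fix]
  obtain ⟨p, hp, hor⟩ := h.exists_of_isBoundedWeight h0 hb
  replace hp := hp ha
  have hq := hor _ _ (lo_lt_hi m) hlh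
  have hp' : MonoOff (w * s m)⁻¹ p := by
    intro x y hx hy hxy
    have h1 := hp x y hx hy hxy
    have h2 : w⁻¹ x ≠ w⁻¹ p := fun e => hx (w⁻¹.injective e)
    have h3 : w⁻¹ y ≠ w⁻¹ p := fun e => hy (w⁻¹.injective e)
    rw [mul_inv_rev, s_inv, Equiv.Perm.mul_apply, Equiv.Perm.mul_apply]
    rw [Fin.lt_def] at h1 ⊢
    rw [s_apply_val, s_apply_val]
    simp only [ne_eq, Fin.ext_iff, lo, hi] at h2 h3 hq
    split_ifs <;> omega
  have hq' : ((w * s m)⁻¹ p = lo m ∧ w⁻¹ p = hi m) ∨ ((w * s m)⁻¹ p = hi m ∧ w⁻¹ p = lo m) := by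
    rw [mul_inv_rev, s_inv, Equiv.Perm.mul_apply]
    rcases hq with hq | hq
    · right; rw [hq]; exact ⟨Equiv.swap_apply_left _ _, rfl⟩
    · left; rw [hq]; exact ⟨Equiv.swap_apply_right _ _, rfl⟩
  -- Choose the representative that carries p across the pair, since `prodS k m` sends `lo k` to `hi
  -- m` for k ≤ m, and `hi k` to `lo m` for k ≥ m, under its inverse.
  obtain ⟨σ, hσ, hσd, hσp⟩ : ∃ σ, MonoOff σ⁻¹ p ∧ dot σ lam = dot w lam ∧
      σ⁻¹ p = if p ≤ lo m then hi m else lo m := by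
    split_ifs
    · rcases hq' with ⟨_, e⟩ | ⟨e, _⟩
      · exact ⟨w, hp, rfl, e⟩
      · exact ⟨w * s m, hp', hw, e⟩
    · rcases hq' with ⟨e, _⟩ | ⟨_, e⟩
      · exact ⟨w * s m, hp', hw, e⟩
      · exact ⟨w, hp, rfl, e⟩
  rw [← hσd]
  have hm := m.2
  split_ifs at hσp with hpm
  · have hpm' : p.val ≤ m.val := hpm
    have e : p = lo ⟨p.val, by omega⟩ := rfl
    have hle : (⟨p.val, by omega⟩ : Fin (n - 1)) ≤ m := hpm
    refine ⟨⟨p.val, by omega⟩, ?_⟩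
    rw [e] at hσ hσp
    exact congrArg (dot · lam)
      (inv_inj.mp (hσ.unique (monoOff_prodS_inv_lo hle) (by rw [hσp, prodS_inv_lo hle])))
  · have hpm' : m.val < p.val := not_le.mp hpm
    have e : p = hi ⟨p.val - 1, by omega⟩ := Fin.ext (by simp only [hi]; omega)
    have hle : m ≤ (⟨p.val - 1, by omega⟩ : Fin (n - 1)) := by rw [Fin.le_def]; simp only; omega
    refine ⟨⟨p.val - 1, by omega⟩, ?_⟩
    rw [e] at hσ hσp
    exact congrArg (dot · lam)
      (inv_inj.mp (hσ.unique (monoOff_prodS_inv_hi hle) (by rw [hσp, prodS_inv_hi hle])))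

theorem IsShift.singular_orbit (h0 : 0 < n) (h : IsShift lam c a) (ha : Antitone a)
    {m : Fin (n - 1)} (hs : stab lam = {1, s m}) :
    {μ | μ ∈ orbit lam ∧ IsBoundedWeight μ} =
      {μ | ∃ k : Fin (n - 1), μ = dot (prodS k m) lam} := by
  ext μ
  constructor
  · rintro ⟨⟨w, rfl⟩, hb⟩
    exact h.exists_eq_prodS_of_stab h0 ha hs hb
  · rintro ⟨k, rfl⟩
    exact ⟨⟨_, rfl⟩, h.isBoundedWeight_prodS_of_stab h0 ha hs k⟩

theorem IsShift.singular_ncard (h0 : 0 < n) (h : IsShift lam c a) (ha : Antitone a)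
    {m : Fin (n - 1)} (hs : stab lam = {1, s m}) :
    {μ | ∃ k : Fin (n - 1), μ = dot (prodS k m) lam}.ncard = n - 1 := by
  have e : {μ | ∃ k : Fin (n - 1), μ = dot (prodS k m) lam} =
      (fun k : Fin (n - 1) => dot (prodS k m) lam) '' Set.univ := by
    ext μ
    simp [eq_comm]
  rw [e, Set.ncard_image_of_injective, Set.ncard_univ]
  · simp
  · intro k l hq
    simp only at hq
    have hb := h.isBoundedWeight_prodS_of_stab h0 ha hs k
    have h1 := (h.isBoundedOfType_prodS_iff ha (l := k) hb).mpr rfl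
    rwa [hq, h.isBoundedOfType_prodS_iff ha (hq ▸ hb)] at h1

theorem IsShift.singular_type (h0 : 0 < n) (h : IsShift lam c a) (ha : Antitone a)
    {m : Fin (n - 1)} (hs : stab lam = {1, s m}) (k : Fin (n - 1)) :
    {μ | μ ∈ orbit lam ∧ IsBoundedOfType k μ} = {dot (prodS k m) lam} := by
  ext μ
  constructor
  · rintro ⟨⟨w, rfl⟩, ht⟩
    obtain ⟨l, hl⟩ := h.exists_eq_prodS_of_stab h0 ha hs ht.2.1
    simp only [hl] at ht ⊢
    rw [h.isBoundedOfType_prodS_iff ha ht.2.1] at ht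
    rw [ht, Set.mem_singleton_iff]
  · rintro rfl
    exact ⟨⟨_, rfl⟩, (h.isBoundedOfType_prodS_iff ha
      (h.isBoundedWeight_prodS_of_stab h0 ha hs k)).mpr rfl⟩

/-- The deleted entry would lie in both equal pairs, so they share a point and give three equal
entries. The outer two then form an equal pair that avoids the deleted one. -/
theorem IsShift.not_isBoundedWeight_of_two_stab (h0 : 0 < n) (h : IsShift lam c a)
    {i j : Fin (n - 1)} (hij : i < j) (hi' : dot (s i) lam = lam) (hj' : dot (s j) lam = lam)
    (w : Equiv.Perm (Fin n)) : ¬ IsBoundedWeight (dot w lam) := by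
  intro hb
  have fix : ∀ k : Fin (n - 1), dot (s k) lam = lam → a (lo k) = a (hi k) := by
    intro k hk
    have := (h.mem_stab_iff (s k)).mp hk (hi k)
    rwa [s_inv, s, Equiv.swap_apply_right] at this
  have e1 := fix i hi'
  have e2 := fix j hj'
  obtain ⟨p, -, key⟩ := h.exists_of_isBoundedWeight h0 hb
  have h1 := key _ _ (lo_lt_hi i) e1
  have h2 := key _ _ (lo_lt_hi j) e2
  rw [Fin.lt_def] at hij
  have h3 : hi i = (lo j : Fin n) := by
    simp only [Fin.ext_iff, lo, hi] at h1 h2 ⊢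
    omega
  have h4 := key (lo i) (hi j) (by rw [Fin.lt_def]; simp only [lo, hi]; omega)
    (by rw [e1, h3, e2])
  simp only [Fin.ext_iff, lo, hi] at h1 h2 h4
  omega

end Orbits

end GlBounded

theorem mainTheorem12 (n : ℕ) (hn : 1 ≤ n) :
    (∀ lam : Weight n,
      (IsRegularWeight lam ∧ IsWMaximal lam ∧ IsIntegralWeight lam) ↔
        FiniteDimensional ℂ (L lam)) ∧
    (∀ lam : Weight n, IsRegularWeight lam → IsWMaximal lam → IsIntegralWeight lam →
      IsBoundedWeight lam ∧
      {μ | μ ∈ orbit lam ∧ μ ≠ lam ∧ IsBoundedWeight μ} =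
        {μ | ∃ i k : Fin (n - 1), μ = dot (prodS i k) lam} ∧
      {μ | μ ∈ orbit lam ∧ μ ≠ lam ∧ IsBoundedWeight μ}.ncard = (n - 1) ^ 2 ∧
      ∀ i : Fin (n - 1),
        {μ | μ ∈ orbit lam ∧ IsBoundedOfType i μ} =
          {μ | ∃ k : Fin (n - 1), μ = dot (prodS i k) lam}) ∧
    (∀ (lam : Weight n) (m : Fin (n - 1)), IsWMaximal lam → IsIntegralWeight lam →
      stab lam = {1, s m} →
      {μ | μ ∈ orbit lam ∧ IsBoundedWeight μ} =
        {μ | ∃ k : Fin (n - 1), μ = dot (prodS k m) lam} ∧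
      {μ | μ ∈ orbit lam ∧ IsBoundedWeight μ}.ncard = n - 1 ∧
      ∀ k : Fin (n - 1),
        {μ | μ ∈ orbit lam ∧ IsBoundedOfType k μ} = {dot (prodS k m) lam}) ∧
    (∀ lam : Weight n, IsIntegralWeight lam →
      (∃ i j : Fin (n - 1), i ≠ j ∧ dot (s i) lam = lam ∧ dot (s j) lam = lam) →
      ∀ μ ∈ orbit lam, ¬ IsBoundedWeight μ) := by
  have h0 : 0 < n := hn
  refine ⟨regular_maximal_integral_iff h0, ?_, ?_, ?_⟩
  · intro lam hr hw hint
    obtain ⟨c, a, h⟩ := hint.exists_isShift h0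
    have ha : StrictAnti a :=
      (h.isWMaximal_iff.mp hw).strictAnti_of_injective (h.isRegularWeight_iff.mp hr)
    refine ⟨h.isBoundedWeight_of_almostAnti h0 ⟨⟨0, h0⟩, fun _ _ _ _ hxy => ha hxy⟩,
      h.regular_orbit h0 ha, ?_, h.regular_type h0 ha⟩
    rw [h.regular_orbit h0 ha, h.regular_ncard h0 ha]
  · intro lam m hw hint hs
    obtain ⟨c, a, h⟩ := hint.exists_isShift h0
    have ha := h.isWMaximal_iff.mp hw
    refine ⟨h.singular_orbit h0 ha hs, ?_, h.singular_type h0 ha hs⟩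
    rw [h.singular_orbit h0 ha hs, h.singular_ncard h0 ha hs]
  · rintro lam hint ⟨i, j, hij, hi', hj'⟩ _ ⟨w, rfl⟩
    obtain ⟨c, a, h⟩ := hint.exists_isShift h0
    rcases lt_or_gt_of_ne hij with h1 | h1
    · exact h.not_isBoundedWeight_of_two_stab h0 h1 hi' hj' w
    · exact h.not_isBoundedWeight_of_two_stab h0 h1 hj' hi' w
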